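/- Let $\mathbb T=\mathbb R/\mathbb Z$ with Lebesgue measure $\mathcal L$, $V>0$, $T>0$, $\Omega_V=\mathbb T\times\{-V,V\}$, $\iota(x,v)=(x,-v)$, and $\pi=\mathcal L\otimes\mathrm{Unif}_{\{-V,V\}}$. Write $(\sigma,j)\in \mathrm{CE}(0,T;\Omega_V)$ if $\sigma\in C([0,T];\mathcal P(\Omega_V))$ (narrow topology), $j_t=(j^1_t,j^2_t)$, $t\in(0,T)$, is a measurable family of pairs of finite signed measures on $\Omega_V$ with $\int_0^T\|j_t\|_{TV}\,dt<\infty$, and for all $\varphi$ on $\Omega_V$ that are $C^1$ in $x$ and all $0\le s\le t\le T$, $$\int\varphi\,d\sigma_t-\int\varphi\,d\sigma_s=\int_s^t\Big(\int\partial_x\varphi\,dj^1_r+\int(\varphi\circ\iota-\varphi)\,dj^2_r\Big)dr .$$ For $\lambda>0$ let $\mathscr I^\lambda(\sigma,j)=\int_0^T\sup_{\varphi\in C(\Omega_V;\mathbb R^2)}\Big\{\langle\varphi,j_t\rangle-\int\big[v\varphi_1+\lambda(e^{\varphi_2}-1)\big]d\sigma_t\Big\}dt$ if $(\sigma,j)\in\mathrm{CE}(0,T;\Omega_V)$,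 and $+\infty$ otherwise. Let $\mathrm{Ent}(\mu|\nu)=\int(f\log f-f+1)\,d\nu$ if $\mu\ll\nu$, $f=\frac{d\mu}{d\nu}$, and $+\infty$ otherwise; $\mathrm{FI}(\eta|\pi)=\frac12\int(\sqrt{f\circ\iota}-\sqrt f)^2d\pi$ if $\eta\ll\pi$, $f=\frac{d\eta}{d\pi}$, and $+\infty$ otherwise; $\mathcal G_t(\rho,\omega)=\int_0^t\int_{\mathbb T}\big|\frac{d\omega}{d\rho}\big|^2\,\rho(dr\,dx)$ if $\omega\ll\rho$ on $(0,T)\times\mathbb T$, and $+\infty$ otherwise. **Proposition.** Let $\lambda_n>0$, $\lambda_n\to0$, and write the index $n$ as $\lambda$. Let $(\sigma^\lambda,j^\lambda)\in\mathrm{CE}(0,T;\Omega_V)$ satisfy $\mathrm{Ent}(\sigma^\lambda_0|\pi)+\mathscr I^\lambda(\sigma^\lambda,j^\lambda)\le C$ for a constant $C$ independent of $\lambda$. Put $\rho^\lambda_t=\sum_v\sigma^\lambda_t(\cdot,v)$, $\omega^\lambda_t=\sum_v v\,\sigma^\lambda_t(\cdot,v)$, $J^\lambda_t=\sum_v v\,j^{2,\lambda}_t(\cdot,v)$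 on $\mathbb T$, and $\rho^\lambda(dt\,dx)=\rho^\lambda_t(dx)\,dt$, similarly $\omega^\lambda$, $J^\lambda$. Then for every $\lambda$ and every $t\in[0,T]$, $$\tfrac12\mathrm{Ent}(\rho^\lambda_t|\mathcal L)+\frac{\lambda}{2V^2}\mathcal G_t(\rho^\lambda,\omega^\lambda)\le \tfrac12\mathrm{Ent}(\sigma^\lambda_t|\pi)+\lambda\int_0^t\mathrm{FI}(\sigma^\lambda_r|\pi)\,dr\le\tfrac12\mathrm{Ent}(\sigma^\lambda_0|\pi)+\mathscr I^\lambda(\sigma^\lambda,j^\lambda).$$ Moreover, along a subsequence, (1) $\rho^\lambda\to\bar\rho$ in $C([0,T];\mathcal P(\mathbb T))$ and (2) $\omega^\lambda\to\bar\omega$ in $C([0,T];\mathcal M(\mathbb T))$, uniformly in time with respect to the narrow topology in space, and (3) $J^\lambda\to\bar J$ narrowly in $\mathcal M((0,T)\times\mathbb T)$, where $\bar J(dt\,dx)=\bar J_t(dx)\,dt$ for a measurable family $(\bar J_t)$ of finite signed measures with $\int_0^T\|\bar J_t\|_{TV}\,dt<\infty$. The curve $\bar\omega$ is absolutely continuous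 on $[0,T]$ with values in $\mathcal M(\mathbb T)$ with the bounded-Lipschitz metric, and for all $\psi\in C^1(\mathbb T)$ and $0\le s<t\le T$, $$\int_{\mathbb T}\psi\,(d\bar\omega_t-d\bar\omega_s)=\int_s^t\int_{\mathbb T}\big(V^2\partial_x\psi\,d\bar\rho_r-2\psi\,d\bar J_r\big)\,dr .$$ In particular, for almost every $t\in(0,T)$, $\partial_t\bar\omega_t=-V^2D\bar\rho_t-2\bar J_t$, that is, for every $\psi\in C^1(\mathbb T)$ the function $r\mapsto\int\psi\,d\bar\omega_r$ is differentiable at $t$ with derivative $V^2\int\partial_x\psi\,d\bar\rho_t-2\int\psi\,d\bar J_t$. -/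

import Mathlib

open MeasureTheory Set Filter Topology
open scoped ENNReal NNReal BoundedContinuousFunction

noncomputable section

namespace KacFC

/-! ### The phase space -/

/-- The one-dimensional torus of length one; `volume` on it is Lebesgue measure, of total mass one. -/
abbrev Torus : Type := UnitAddCircle

/-- The phase space `𝕋 × {-V, V}` of the Kac process, for `V > 0`. The velocity is recorded by its
sign (`true` for `V`, `false` for `-V`); its value is `vel V`. -/
abbrev Phase : Type := Torus × Bool

/-- The velocity that belongs to a sign. -/
def vel (V : ℝ) (b : Bool) : ℝ := if b then V else -V

/-- The velocity reversal `ι (x, v) = (x, -v)`. -/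
def rev (z : Phase) : Phase := (z.1, !z.2)

/-- The stationary measure `π`: Lebesgue measure on the torus times the uniform probability measure
on the two velocities. -/
def stat : Measure Phase :=
  (volume : Measure Torus).prod ((2⁻¹ : ℝ≥0∞) • (Measure.count : Measure Bool))

/-! ### Continuously differentiable functions on the torus -/

/-- `ψ` is continuously differentiable on the torus: its periodic lift to the line is. -/
def IsC1 (ψ : Torus → ℝ) : Prop := ContDiff ℝ 1 fun s : ℝ => ψ (s : Torus)

/-- The derivative `∂ₓψ` on the torus. -/
def dx (ψ : Torus → ℝ) (x : Torus) : ℝ := deriv (fun s : ℝ => ψ (x + (s : Torus))) 0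

/-! ### Signed measures and measurable families of them -/

/-- The pairing `⟨f, μ⟩ = ∫ f dμ` with a finite signed measure. -/
def pair {X : Type*} [MeasurableSpace X] (f : X → ℝ) (μ : SignedMeasure X) : ℝ :=
  ∫ᵛ x, f x ∂<•μ

/-- Lebesgue measure on the open time interval `(0, T)`. -/
def leb (T : ℝ) : Measure (Ioo (0 : ℝ) T) := (volume : Measure ℝ).comap Subtype.val

/-- `(μ_t)`, `t ∈ (0, T)`, is a measurable family of finite signed measures with
`∫₀ᵀ ‖μ_t‖_TV dt < ∞`. Values of `μ` at times outside `(0, T)` play no role. -/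
structure IsFluxFamily {X : Type*} [MeasurableSpace X] (T : ℝ) (μ : ℝ → SignedMeasure X) :
    Prop where
  measurable : ∀ B : Set X, MeasurableSet B → Measurable fun t : Ioo (0 : ℝ) T => μ t B
  finite : ∫⁻ t, (μ (t : Ioo (0 : ℝ) T)).variation univ ∂(leb T) < ∞

theorem IsFluxFamily.measurable_section {X : Type*} [MeasurableSpace X] {T : ℝ}
    {μ : ℝ → SignedMeasure X} (h : IsFluxFamily T μ) {E : Set (Ioo (0 : ℝ) T × X)}
    (hE : MeasurableSet E) :
    Measurable fun t : Ioo (0 : ℝ) T => μ t (Prod.mk t ⁻¹' E) := by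
  induction E, hE using MeasurableSpace.induction_on_inter generateFrom_prod.symm isPiSystem_prod with
  | empty => simp
  | basic E hE =>
    obtain ⟨A, hA, B, hB, rfl⟩ := hE
    have hA' : MeasurableSet A := hA
    have : (fun t : Ioo (0 : ℝ) T => μ t (Prod.mk t ⁻¹' (A ×ˢ B)))
        = A.indicator fun t => μ t B := by
      ext t
      by_cases ht : t ∈ A
      · simp [Set.indicator_of_mem ht, Set.mk_preimage_prod_right ht]
      · simp [Set.indicator_of_notMem ht, Set.mk_preimage_prod_right_eq_empty ht]
    rw [this]
    exact (h.measurable B hB).indicator hA'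
  | compl E hE ih =>
    have : (fun t : Ioo (0 : ℝ) T => μ t (Prod.mk t ⁻¹' Eᶜ))
        = fun t : Ioo (0 : ℝ) T => μ t univ - μ t (Prod.mk t ⁻¹' E) := by
      ext t
      have h1 := VectorMeasure.of_add_of_sdiff (v := μ t) (measurable_prodMk_left (x := t) hE)
        MeasurableSet.univ (subset_univ _)
      rw [← h1, preimage_compl, compl_eq_univ_sdiff]
      ring
    rw [this]
    exact (h.measurable univ MeasurableSet.univ).sub ih
  | iUnion f hd hm ih =>
    refine measurable_of_tendsto_metrizable
      (f := fun n (t : Ioo (0 : ℝ) T) => ∑ i ∈ Finset.range n, μ t (Prod.mk t ⁻¹' f i))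
      (fun n => Finset.measurable_fun_sum _ fun i _ => ih i) ?_
    rw [tendsto_pi_nhds]
    intro t
    rw [preimage_iUnion]
    exact ((μ t).m_iUnion (fun i => measurable_prodMk_left (hm i))
      fun i j hij => (hd hij).preimage _).tendsto_sum_nat

theorem IsFluxFamily.hasSum {X : Type*} [MeasurableSpace X] {T : ℝ}
    {μ : ℝ → SignedMeasure X} (h : IsFluxFamily T μ) {E : ℕ → Set (Ioo (0 : ℝ) T × X)}
    (hE : ∀ i, MeasurableSet (E i)) (hd : Pairwise (Function.onFun Disjoint E)) :
    HasSum (fun i => ∫ t, μ (t : Ioo (0 : ℝ) T) (Prod.mk t ⁻¹' E i) ∂(leb T))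
      (∫ t, μ (t : Ioo (0 : ℝ) T) (Prod.mk t ⁻¹' ⋃ i, E i) ∂(leb T)) := by
  have key : ∀ s : Finset ℕ, ∑ i ∈ s, ∫⁻ t, ‖μ (t : Ioo (0 : ℝ) T) (Prod.mk t ⁻¹' E i)‖ₑ ∂(leb T)
      ≤ ∫⁻ t, (μ (t : Ioo (0 : ℝ) T)).variation univ ∂(leb T) := by
    intro s
    rw [← lintegral_finsetSum _ fun i _ => (h.measurable_section (hE i)).enorm]
    refine lintegral_mono fun t => ?_
    calc ∑ i ∈ s, ‖μ t (Prod.mk t ⁻¹' E i)‖ₑ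
        ≤ ∑ i ∈ s, (μ t).variation (Prod.mk t ⁻¹' E i) :=
          Finset.sum_le_sum fun i _ => VectorMeasure.enorm_measure_le_variation _ _
      _ ≤ (μ t).variation univ :=
          sum_measure_le_measure_univ
            (fun i _ => (measurable_prodMk_left (hE i)).nullMeasurableSet)
            fun i _ j _ hij => ((hd hij).preimage _).aedisjoint
  have hint : ∀ i, Integrable (fun t : Ioo (0 : ℝ) T => μ t (Prod.mk t ⁻¹' E i)) (leb T) := fun i =>
    ⟨(h.measurable_section (hE i)).aestronglyMeasurable,
      lt_of_le_of_lt (by simpa using key {i}) h.finite⟩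
  have := hasSum_integral_of_summable_integral_norm hint
    (summable_of_sum_le (c := (∫⁻ t, (μ (t : Ioo (0 : ℝ) T)).variation univ ∂(leb T)).toReal)
      (fun i => integral_nonneg fun _ => norm_nonneg _) fun s => by
        have h2 : ∀ i, ∫ t, ‖μ (t : Ioo (0 : ℝ) T) (Prod.mk t ⁻¹' E i)‖ ∂(leb T)
            = (∫⁻ t, ‖μ (t : Ioo (0 : ℝ) T) (Prod.mk t ⁻¹' E i)‖ₑ ∂(leb T)).toReal := fun i =>
          integral_norm_eq_lintegral_enorm (hint i).aestronglyMeasurable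
        simp only [h2]
        rw [← ENNReal.toReal_sum fun i _ => (hint i).2.ne]
        exact ENNReal.toReal_mono h.finite.ne (key s))
  have hU : ∀ t : Ioo (0 : ℝ) T, μ t (Prod.mk t ⁻¹' ⋃ i, E i)
      = ∑' i, μ t (Prod.mk t ⁻¹' E i) := fun t => by
    rw [preimage_iUnion]
    exact VectorMeasure.of_disjoint_iUnion (fun i => measurable_prodMk_left (hE i))
      fun i j hij => (hd hij).preimage _
  simpa only [hU] using this

open Classical in
/-- The finite signed measure `μ(dt dx) = μ_t(dx) dt` on `(0, T) × X` of a measurable family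
with `∫₀ᵀ ‖μ_t‖_TV dt < ∞` (and `0` if the family is not such a family). -/
def spaceTime {X : Type*} [MeasurableSpace X] (T : ℝ) (μ : ℝ → SignedMeasure X) :
    SignedMeasure (Ioo (0 : ℝ) T × X) :=
  if h : IsFluxFamily T μ then
    { measureOf' := fun E => if MeasurableSet E then
        ∫ t, μ (t : Ioo (0 : ℝ) T) (Prod.mk t ⁻¹' E) ∂(leb T) else 0
      empty' := by simp
      not_measurable' := fun E hE => by simp [hE]
      m_iUnion' := fun E hE hd => by
        simpa [hE, MeasurableSet.iUnion hE] using h.hasSum hE hd }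
  else 0

/-- Narrow convergence of finite signed measures: convergence of the integrals of all bounded
continuous functions. -/
def NarrowTendsto {X : Type*} [TopologicalSpace X] [MeasurableSpace X]
    (μ : ℕ → SignedMeasure X) (ν : SignedMeasure X) : Prop :=
  ∀ f : X →ᵇ ℝ, Tendsto (fun n => pair f (μ n)) atTop (𝓝 (pair f ν))

/-- `μ ∈ C([0, T]; 𝓜(X))`, where `𝓜(X)` carries the narrow topology. -/
def NarrowContinuous {X : Type*} [TopologicalSpace X] [MeasurableSpace X]
    (T : ℝ) (μ : ℝ → SignedMeasure X) : Prop :=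
  ∀ f : X →ᵇ ℝ, ContinuousOn (fun t => pair f (μ t)) (Icc 0 T)

/-- Convergence in `C([0, T]; 𝓜(X))`, with the uniform topology in time and the narrow topology
in space. -/
def UniformNarrowTendsto {X : Type*} [TopologicalSpace X] [MeasurableSpace X]
    (T : ℝ) (μ : ℕ → ℝ → SignedMeasure X) (ν : ℝ → SignedMeasure X) : Prop :=
  ∀ f : X →ᵇ ℝ,
    TendstoUniformlyOn (fun n t => pair f (μ n t)) (fun t => pair f (ν t)) atTop (Icc 0 T)

/-- The bounded-Lipschitz distance of two finite signed measures on the torus. -/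
def dBL (μ ν : SignedMeasure Torus) : ℝ≥0∞ :=
  ⨆ (f : Torus → ℝ) (_ : (∀ x, |f x| ≤ 1) ∧ LipschitzWith 1 f),
    ENNReal.ofReal |pair f μ - pair f ν|

/-- `μ ∈ AC([0, T]; (𝓜(𝕋), d_BL))`: the increments of the curve are bounded by the integrals of
an integrable function of time. -/
def IsACBL (T : ℝ) (μ : ℝ → SignedMeasure Torus) : Prop :=
  ∃ m : ℝ → ℝ, IntegrableOn m (Ioo 0 T) ∧
    ∀ s t, 0 ≤ s → s ≤ t → t ≤ T → dBL (μ s) (μ t) ≤ ENNReal.ofReal (∫ r in s..t, m r)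

/-! ### The continuity equation and the rate functional -/

/-- `(σ, j) ∈ CE(0, T; Ω_V)` with `j = (j₁, j₂)`. -/
structure IsCE (T : ℝ) (σ : ℝ → ProbabilityMeasure Phase) (j₁ j₂ : ℝ → SignedMeasure Phase) :
    Prop where
  continuousOn : ContinuousOn σ (Icc 0 T)
  flux₁ : IsFluxFamily T j₁
  flux₂ : IsFluxFamily T j₂
  eq : ∀ φ : Phase → ℝ, (∀ b, IsC1 fun x => φ (x, b)) →
    ∀ s t, 0 ≤ s → s ≤ t → t ≤ T →
      ∫ z, φ z ∂(σ t : Measure Phase) - ∫ z, φ z ∂(σ s : Measure Phase) =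
        ∫ r in s..t, (pair (fun z => dx (fun x => φ (x, z.2)) z.1) (j₁ r)
          + pair (fun z => φ (rev z) - φ z) (j₂ r))

/-- The Hamiltonian `𝓗(σ, φ) = ∫ [v φ₁ + λ (e^{φ₂} - 1)] dσ`. -/
def hamiltonian (V lam : ℝ) (σ : ProbabilityMeasure Phase) (φ₁ φ₂ : C(Phase, ℝ)) : ℝ :=
  ∫ z, (vel V z.2 * φ₁ z + lam * (Real.exp (φ₂ z) - 1)) ∂(σ : Measure Phase)

/-- The Lagrangian `𝓛(σ, j) = sup_φ (⟨φ, j⟩ - 𝓗(σ, φ))`, the supremum over the pairs of continuous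
functions; it is nonnegative (take `φ = 0`), so that negative terms may be replaced by `0`. -/
def lagrangian (V lam : ℝ) (σ : ProbabilityMeasure Phase) (j₁ j₂ : SignedMeasure Phase) : ℝ≥0∞ :=
  ⨆ (φ₁ : C(Phase, ℝ)) (φ₂ : C(Phase, ℝ)),
    ENNReal.ofReal (pair φ₁ j₁ + pair φ₂ j₂ - hamiltonian V lam σ φ₁ φ₂)

open Classical in
/-- The rate functional `𝓘^λ(σ, j)`. -/
def rate (V lam T : ℝ) (σ : ℝ → ProbabilityMeasure Phase) (j₁ j₂ : ℝ → SignedMeasure Phase) :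
    ℝ≥0∞ :=
  if IsCE T σ j₁ j₂ then ∫⁻ t in Ioo 0 T, lagrangian V lam (σ t) (j₁ t) (j₂ t) else ∞

/-! ### Relative entropy and Fisher information -/

/-- The relative entropy `Ent(μ | ν)` of finite measures: the integral of `f log f - f + 1` against
`ν` if `μ ≪ ν` with density `f`, and `∞` otherwise. -/
abbrev ent {X : Type*} [MeasurableSpace X] (μ ν : Measure X) : ℝ≥0∞ :=
  InformationTheory.klDiv μ ν

open Classical in
/-- The Fisher information `FI(η | π) = ½ ∫ (√(f ∘ ι) - √f)² dπ`, `f = dη/dπ`, if `η ≪ π`, and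
`∞` otherwise. -/
def fisher (η : Measure Phase) : ℝ≥0∞ :=
  if η ≪ stat then
    2⁻¹ * ∫⁻ z, ENNReal.ofReal
      ((√(η.rnDeriv stat (rev z)).toReal - √(η.rnDeriv stat z).toReal) ^ 2) ∂stat
  else ∞

/-! ### Density, momentum and the functional `𝓖_t` -/

/-- The density `ρ(dx) = ∑_v σ(dx, v)`. -/
def density (σ : ProbabilityMeasure Phase) : ProbabilityMeasure Torus :=
  σ.map measurable_fst.aemeasurable

/-- The first velocity moment `∑_v v m(dx, v)` of a signed measure `m` on the phase space. -/
def moment (V : ℝ) (m : SignedMeasure Phase) : SignedMeasure Torus :=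
  ∑ b : Bool, vel V b • (m.restrict (Prod.snd ⁻¹' {b})).map Prod.fst

/-- A probability measure as a signed measure. -/
abbrev toSigned {X : Type*} [MeasurableSpace X] (μ : ProbabilityMeasure X) : SignedMeasure X :=
  (μ : Measure X).toSignedMeasure

/-- The nonnegative measure `ρ(dt dx) = ρ_t(dx) dt` on `(0, T) × 𝕋`. -/
def spaceTimeDensity (T : ℝ) (ρ : ℝ → ProbabilityMeasure Torus) :
    Measure (Ioo (0 : ℝ) T × Torus) :=
  (leb T).bind fun t => (ρ t : Measure Torus).map (Prod.mk t)

open Classical in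
/-- `𝓖_t(ρ, ω) = ∫₀ᵗ ∫ |dω/dρ|² dρ` if `ω ≪ ρ`, and `∞` otherwise. -/
def G {T : ℝ} (t : ℝ) (ρ : Measure (Ioo (0 : ℝ) T × Torus))
    (ω : SignedMeasure (Ioo (0 : ℝ) T × Torus)) : ℝ≥0∞ :=
  if ω ≪ᵥ ρ.toENNRealVectorMeasure then
    ∫⁻ p in {p | (p.1 : ℝ) ≤ t}, ENNReal.ofReal (|ω.rnDeriv ρ p| ^ 2) ∂ρ
  else ∞

/-- The distributional derivative `Dρ` of a measure on the torus, `⟨Dρ, ψ⟩ = -∫ ∂ₓψ dρ`. -/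
def distribDeriv (ρ : ProbabilityMeasure Torus) (ψ : Torus → ℝ) : ℝ :=
  -∫ x, dx ψ x ∂(ρ : Measure Torus)

end KacFC

end

open KacFC

/-! Two arguments, almost independent of each other: a chain rule for the entropy, and the
disappearance of the jumps as λ → 0 with V fixed.

Entropy. For a smooth positive density f, test the rate functional with half of (∂ₓ log f, log f ∘ ι
- log f). By the continuity equation the pairing with the fluxes is ½ d/dt Ent, so ½ d/dt Ent is at
most the Lagrangian plus the Hamiltonian. In the Hamiltonian the transport term vanishes, since the
flow preserves π, and the jump term is λ ∫ (√(f ∘ ι / f) - 1) f dπ = -λ FI. For a general curve, let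
M be a smooth positive symmetric Markov kernel that commutes with ι and with the flows, put f = Mσ
and test with M log f. Duality turns integrals against σ into integrals against f, and Jensen's
inequality e^{Mψ} ≤ M e^ψ (`exp_kernelOp_le`) keeps the sign of the jump term. No time derivative of
f is taken: over a short interval the test function is frozen at the right endpoint, Gibbs'
inequality bounds the entropy increment (`entropy_sub_le`), and the error is o(t - s) by uniform
continuity (`half_entropy_add_le`). The kernels then tend to the identity. Smoothing lowers the
initial entropy, and Fatou's lemma recovers entropy and Fisher information at later times
(`ent_add_fisher_le`).

The density and momentum bound is data processing together with a pointwise inequality: if a and b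
are the densities of the right- and left-movers, then (a - b)² ≤ 2(a + b)(√a - √b)².

Limit. Testing with M(χ₁, χ₂) gives M ∫ |⟨χ₁, j¹ - vσ⟩ + ⟨χ₂, j²⟩| dt ≤ I + Tλ e^{M‖χ₂‖}
(`lintegral_flux_le`). Letting λ → 0 and then M → ∞, the jump flux vanishes, so J̄ = 0, and every C¹
observable obeys the free transport equation up to an error uniform in time. The real and imaginary
parts of a Fourier mode carried by one velocity rotate into each other under transport, so
Gronwall's inequality closes on them; density of trigonometric polynomials extends the convergence
to all continuous observables. A subsequence is therefore chosen only at time zero, by compactness,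
and the limit is the explicit free transport of the limiting initial measure. Its momentum satisfies
the limit equation at every time. -/

namespace KacFC

/-! ### Pairing with finite signed measures -/

section Pairing

variable {X : Type*} [MeasurableSpace X]

instance isFiniteMeasure_variation (μ : SignedMeasure X) : IsFiniteMeasure μ.variation := by
  rw [← SignedMeasure.totalVariation_eq_variation]
  unfold SignedMeasure.totalVariation
  infer_instance

theorem integrable_of_bounded {μ : Measure X} [IsFiniteMeasure μ] {f : X → ℝ} (hf : Measurable f)
    {c : ℝ} (hc : ∀ x, |f x| ≤ c) : Integrable f μ :=
  Integrable.of_bound hf.aestronglyMeasurable c (.of_forall hc)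

/-- The Jordan decomposition reduces the pairing to two ordinary integrals, which makes dominated
convergence available. -/
theorem pair_eq_sub {f : X → ℝ} {μ : SignedMeasure X} (hf : Integrable f μ.variation) :
    pair f μ = ∫ x, f x ∂μ.toJordanDecomposition.posPart
      - ∫ x, f x ∂μ.toJordanDecomposition.negPart := by
  have hv : μ.toJordanDecomposition.posPart + μ.toJordanDecomposition.negPart = μ.variation :=
    SignedMeasure.totalVariation_eq_variation μ
  rw [← hv] at hf
  have h1 := SignedMeasure.toSignedMeasure_toJordanDecomposition μ
  conv_lhs => rw [← h1]
  unfold pair JordanDecomposition.toSignedMeasure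
  rw [VectorMeasure.integral_sub_vectorMeasure]
  · simp
  · simpa [VectorMeasure.Integrable] using hf.left_of_add_measure
  · simpa [VectorMeasure.Integrable] using hf.right_of_add_measure

theorem pair_add {f g : X → ℝ} {μ : SignedMeasure X} (hf : Integrable f μ.variation)
    (hg : Integrable g μ.variation) :
    pair (fun x => f x + g x) μ = pair f μ + pair g μ :=
  VectorMeasure.integral_fun_add hf hg

theorem pair_const_mul (c : ℝ) (f : X → ℝ) (μ : SignedMeasure X) :
    pair (fun x => c * f x) μ = c * pair f μ :=
  VectorMeasure.integral_fun_smul μ _ c f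

@[simp] theorem pair_zero_left (μ : SignedMeasure X) : pair (fun _ => (0 : ℝ)) μ = 0 :=
  VectorMeasure.integral_zero

@[simp] theorem pair_zero_right (f : X → ℝ) : pair f (0 : SignedMeasure X) = 0 :=
  VectorMeasure.integral_zero_vectorMeasure

theorem pair_toSignedMeasure (f : X → ℝ) (μ : Measure X) [IsFiniteMeasure μ] :
    pair f μ.toSignedMeasure = ∫ x, f x ∂μ :=
  VectorMeasure.integral_toSignedMeasure

theorem pair_indicator {s : Set X} (hs : MeasurableSet s) (c : ℝ) (μ : SignedMeasure X) :
    pair (s.indicator fun _ => c) μ = c * μ s := by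
  have h1 := SignedMeasure.apply_eq_posPart_real_sub_negPart_real μ hs
  rw [pair_eq_sub ((integrable_const c).indicator hs), integral_indicator_const _ hs,
    integral_indicator_const _ hs, h1]
  simp
  ring

theorem enorm_pair_le {f : X → ℝ} (μ : SignedMeasure X) {c : ℝ} (hc : ∀ x, |f x| ≤ c) :
    ‖pair f μ‖ₑ ≤ ENNReal.ofReal c * μ.variation univ := by
  have h := VectorMeasure.enorm_integral_le_lintegral_enorm (μ := μ) (f := f)
    (B := (ContinuousLinearMap.lsmul ℝ ℝ).flip)
  have h1 : ‖(ContinuousLinearMap.lsmul ℝ ℝ (E := ℝ)).flip‖ₑ ≤ 1 := by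
    rw [← ofReal_norm, ContinuousLinearMap.opNorm_flip]
    simp
  refine h.trans ((mul_le_mul_left h1 _).trans ?_)
  rw [one_mul]
  calc _ ≤ ∫⁻ _, ENNReal.ofReal c ∂μ.variation := by
        refine lintegral_mono fun x => ?_
        rw [← ofReal_norm]
        exact ENNReal.ofReal_le_ofReal (hc x)
    _ = _ := by simp

/-- Bounded measurable functions are obtained from indicators by sums and bounded limits. -/
theorem bounded_measurable_induction {P : (X → ℝ) → Prop}
    (hind : ∀ (s : Set X) (c : ℝ), MeasurableSet s → P (s.indicator fun _ => c))
    (hadd : ∀ f g : X → ℝ, Measurable f → Measurable g → (∃ c, ∀ x, |f x| ≤ c) →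
      (∃ c, ∀ x, |g x| ≤ c) → P f → P g → P (fun x => f x + g x))
    (hlim : ∀ (F : ℕ → X → ℝ) (f : X → ℝ) (c : ℝ), (∀ n, Measurable (F n)) →
      (∀ n x, |F n x| ≤ c) → (∀ x, Tendsto (fun n => F n x) atTop (𝓝 (f x))) →
      (∀ n, P (F n)) → P f)
    {f : X → ℝ} (hf : Measurable f) {c : ℝ} (hc : ∀ x, |f x| ≤ c) : P f := by
  have hsimple : ∀ g : SimpleFunc X ℝ, P g := by
    intro g
    induction g using SimpleFunc.induction with
    | const c hs =>
      rename_i s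
      have : ⇑(SimpleFunc.piecewise s hs (SimpleFunc.const X c) (SimpleFunc.const X 0))
          = s.indicator fun _ => c := by
        ext x
        by_cases hx : x ∈ s <;> simp [hx]
      rw [this]
      exact hind s c hs
    | add hd hf hg =>
      rename_i f g
      have hb : ∀ u : SimpleFunc X ℝ, ∃ c, ∀ x, |u x| ≤ c := fun u => by
        obtain ⟨c, hc⟩ := u.exists_forall_norm_le
        exact ⟨c, hc⟩
      exact hadd f g f.measurable g.measurable (hb f) (hb g) hf hg
  have hfs := hf.stronglyMeasurable
  -- The bounded approximation needs `0 ≤ c`, which follows from `hc` at any point; the empty space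
  -- has none and is treated apart.
  by_cases hX : IsEmpty X
  · have : f = (∅ : Set X).indicator fun _ => (0 : ℝ) := by ext x; exact (hX.false x).elim
    rw [this]
    exact hind _ _ MeasurableSet.empty
  · rw [not_isEmpty_iff] at hX
    obtain ⟨x0⟩ := hX
    have hc0 : 0 ≤ c := (abs_nonneg _).trans (hc x0)
    exact hlim (fun n => hfs.approxBounded c n) f c (fun n => SimpleFunc.measurable _)
      (fun n x => hfs.norm_approxBounded_le hc0 n x)
      (fun x => hfs.tendsto_approxBounded_of_norm_le (hc x)) fun n => hsimple _

theorem tendsto_pair_of_bounded {F : ℕ → X → ℝ} {f : X → ℝ} {c : ℝ} (hF : ∀ n, Measurable (F n))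
    (hc : ∀ n x, |F n x| ≤ c) (h : ∀ x, Tendsto (fun n => F n x) atTop (𝓝 (f x)))
    (μ : SignedMeasure X) : Tendsto (fun n => pair (F n) μ) atTop (𝓝 (pair f μ)) := by
  have hf : Measurable f := measurable_of_tendsto_metrizable hF (tendsto_pi_nhds.2 h)
  have hfc : ∀ x, |f x| ≤ c := fun x =>
    le_of_tendsto (h x).abs (.of_forall fun n => hc n x)
  rw [pair_eq_sub (integrable_of_bounded hf hfc)]
  simp_rw [fun n => pair_eq_sub (μ := μ) (integrable_of_bounded (hF n) (hc n))]
  refine Tendsto.sub ?_ ?_ <;>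
  exact tendsto_integral_of_dominated_convergence (fun _ => c)
    (fun n => (hF n).aestronglyMeasurable) (integrable_const c)
    (fun n => .of_forall (hc n)) (.of_forall h)

theorem variation_lt_top (μ : SignedMeasure X) : μ.variation univ < ∞ := measure_lt_top _ _

theorem pair_map {Y : Type*} [MeasurableSpace Y] {g : X → Y} (hg : Measurable g)
    (μ : SignedMeasure X) {f : Y → ℝ} (hf : Measurable f) {c : ℝ} (hc : ∀ x, |f x| ≤ c) :
    pair f (μ.map g) = pair (fun x => f (g x)) μ := by
  refine bounded_measurable_induction (P := fun f => pair f (μ.map g) = pair (fun x => f (g x)) μ)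
    ?_ ?_ ?_ hf hc
  · intro s c hs
    have : (fun x => s.indicator (fun _ => c) (g x)) = (g ⁻¹' s).indicator fun _ => c := by
      ext x; rfl
    rw [pair_indicator hs, this, pair_indicator (hg hs), VectorMeasure.map_apply _ hg hs]
  · rintro f1 f2 hf1 hf2 ⟨c1, hc1⟩ ⟨c2, hc2⟩ h1 h2
    rw [pair_add (integrable_of_bounded hf1 hc1) (integrable_of_bounded hf2 hc2), h1, h2]
    exact (pair_add (integrable_of_bounded (hf1.comp hg) fun x => hc1 (g x))
      (integrable_of_bounded (hf2.comp hg) fun x => hc2 (g x))).symm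
  · intro F f c hF hFc hlim hP
    refine tendsto_nhds_unique (tendsto_pair_of_bounded hF hFc hlim _) ?_
    simp_rw [hP]
    exact tendsto_pair_of_bounded (fun n => (hF n).comp hg) (fun n x => hFc n (g x))
      (fun x => hlim (g x)) μ

theorem pair_restrict {s : Set X} (hs : MeasurableSet s) (f : X → ℝ) (μ : SignedMeasure X) :
    pair f (μ.restrict s) = pair (s.indicator f) μ :=
  (VectorMeasure.integral_indicator hs).symm

theorem pair_finset_sum_right {ι : Type*} (t : Finset ι) (μ : ι → SignedMeasure X) {f : X → ℝ}
    (hf : Measurable f) {c : ℝ} (hc : ∀ x, |f x| ≤ c) :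
    pair f (∑ i ∈ t, μ i) = ∑ i ∈ t, pair f (μ i) :=
  VectorMeasure.integral_finsetSum_vectorMeasure fun _ _ => integrable_of_bounded hf hc

theorem pair_smul_right (c : ℝ) (f : X → ℝ) (μ : SignedMeasure X) :
    pair f (c • μ) = c * pair f μ :=
  VectorMeasure.integral_smul_vectorMeasure f c

end Pairing

theorem abs_vel {V : ℝ} (hV : 0 ≤ V) (b : Bool) : |vel V b| = V := by
  cases b <;> simp [vel, abs_of_nonneg hV]

/-- Statements about the momentum and about its jump flux become statements about the test function
v ψ(x) on the phase space. -/
theorem pair_moment {V : ℝ} (hV : 0 ≤ V) (m : SignedMeasure Phase) {ψ : Torus → ℝ}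
    (hψ : Measurable ψ) {c : ℝ} (hc : ∀ x, |ψ x| ≤ c) :
    pair ψ (moment V m) = pair (fun z => vel V z.2 * ψ z.1) m := by
  have hms : ∀ b : Bool, MeasurableSet (Prod.snd ⁻¹' {b} : Set Phase) := fun b =>
    measurable_snd (measurableSet_singleton b)
  have hc0 : 0 ≤ c := (abs_nonneg _).trans (hc 0)
  unfold moment
  rw [pair_finset_sum_right _ _ hψ hc]
  have hint : ∀ b : Bool, Integrable ((Prod.snd ⁻¹' {b} : Set Phase).indicator
      fun z => vel V b * ψ z.1) m.variation := fun b => by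
    refine (integrable_of_bounded (c := V * c) ?_ fun z => ?_).indicator (hms b)
    · exact (hψ.comp measurable_fst).const_mul _
    · rw [abs_mul, abs_vel hV]
      exact mul_le_mul_of_nonneg_left (hc _) hV
  have h1 : ∀ b : Bool, pair ψ (vel V b • (m.restrict (Prod.snd ⁻¹' {b})).map Prod.fst)
      = pair ((Prod.snd ⁻¹' {b} : Set Phase).indicator fun z => vel V b * ψ z.1) m := fun b => by
    rw [pair_smul_right, pair_map measurable_fst _ hψ hc, pair_restrict (hms b), ← pair_const_mul]
    congr 1
    ext z
    by_cases hz : z ∈ (Prod.snd ⁻¹' {b} : Set Phase) <;> simp [hz]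
  simp_rw [h1]
  rw [Fintype.sum_bool, ← pair_add (hint true) (hint false)]
  congr 1
  ext ⟨x, b⟩
  cases b <;> simp

/-! ### Measurable families in time and their space-time measures -/

theorem measurable_pair {X : Type*} [MeasurableSpace X] {T : ℝ} {μ : ℝ → SignedMeasure X}
    (h : IsFluxFamily T μ) {f : X → ℝ} (hf : Measurable f) {c : ℝ} (hc : ∀ x, |f x| ≤ c) :
    Measurable fun t : Ioo (0 : ℝ) T => pair f (μ t) := by
  refine bounded_measurable_induction
    (P := fun f => Measurable fun t : Ioo (0 : ℝ) T => pair f (μ t)) ?_ ?_ ?_ hf hc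
  · intro s c hs
    simp_rw [pair_indicator hs]
    exact (h.measurable s hs).const_mul c
  · rintro f1 f2 hf1 hf2 ⟨c1, hc1⟩ ⟨c2, hc2⟩ h1 h2
    simp_rw [fun t => pair_add (μ := μ t) (integrable_of_bounded hf1 hc1)
      (integrable_of_bounded hf2 hc2)]
    exact h1.add h2
  · intro F f c hF hFc hlim hP
    exact measurable_of_tendsto_metrizable hP
      (tendsto_pi_nhds.2 fun t => tendsto_pair_of_bounded hF hFc hlim (μ t))

theorem map_leb (T : ℝ) : (leb T).map Subtype.val = (volume : Measure ℝ).restrict (Ioo 0 T) := by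
  unfold leb
  exact map_comap_subtype_coe measurableSet_Ioo _

theorem lintegral_leb (T : ℝ) (f : ℝ → ℝ≥0∞) :
    ∫⁻ t, f (t : Ioo (0 : ℝ) T) ∂(leb T) = ∫⁻ t in Ioo 0 T, f t := by
  rw [← map_leb, (MeasurableEmbedding.subtype_coe measurableSet_Ioo).lintegral_map]

instance isFiniteMeasure_leb (T : ℝ) : IsFiniteMeasure (leb T) := by
  constructor
  have h := lintegral_leb T (fun _ => 1)
  simp only [lintegral_const, one_mul] at h
  rw [h]
  simp

theorem integrable_leb_iff {T : ℝ} {f : ℝ → ℝ} :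
    Integrable (fun t : Ioo (0 : ℝ) T => f t) (leb T) ↔ IntegrableOn f (Ioo 0 T) := by
  rw [IntegrableOn, ← map_leb,
    (MeasurableEmbedding.subtype_coe measurableSet_Ioo).integrable_map_iff]
  rfl

theorem integrableOn_pair {X : Type*} [MeasurableSpace X] {T : ℝ} {μ : ℝ → SignedMeasure X}
    (h : IsFluxFamily T μ) {f : X → ℝ} (hf : Measurable f) {c : ℝ} (hc : ∀ x, |f x| ≤ c) :
    IntegrableOn (fun t => pair f (μ t)) (Ioo 0 T) := by
  rw [← integrable_leb_iff]
  refine ⟨(measurable_pair h hf hc).aestronglyMeasurable, ?_⟩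
  refine lt_of_le_of_lt (lintegral_mono fun t => enorm_pair_le (μ t) hc) ?_
  rw [lintegral_const_mul' _ _ ENNReal.ofReal_ne_top]
  exact ENNReal.mul_lt_top ENNReal.ofReal_lt_top h.finite

theorem spaceTime_apply {X : Type*} [MeasurableSpace X] {T : ℝ} {μ : ℝ → SignedMeasure X}
    (h : IsFluxFamily T μ) {E : Set (Ioo (0 : ℝ) T × X)} (hE : MeasurableSet E) :
    spaceTime T μ E = ∫ t, μ (t : Ioo (0 : ℝ) T) (Prod.mk t ⁻¹' E) ∂(leb T) := by
  unfold spaceTime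
  rw [dif_pos h]
  exact if_pos hE

theorem spaceTime_zero {X : Type*} [MeasurableSpace X] (T : ℝ) :
    spaceTime T (fun _ => (0 : SignedMeasure X)) = 0 := by
  by_cases h : IsFluxFamily T (fun _ => (0 : SignedMeasure X))
  · ext E hE
    rw [spaceTime_apply h hE]
    simp
  · exact dif_neg h

theorem isFluxFamily_zero {X : Type*} [MeasurableSpace X] (T : ℝ) :
    IsFluxFamily T (fun _ => (0 : SignedMeasure X)) where
  measurable := fun _ _ => by simp
  finite := by simp

/-- Disintegration of the pairing with a space-time measure. -/
theorem pair_spaceTime {X : Type*} [MeasurableSpace X] {T : ℝ} {μ : ℝ → SignedMeasure X}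
    (h : IsFluxFamily T μ) {f : Ioo (0 : ℝ) T × X → ℝ} (hf : Measurable f) {c : ℝ}
    (hc : ∀ x, |f x| ≤ c) :
    Integrable (fun t : Ioo (0 : ℝ) T => pair (fun x => f (t, x)) (μ t)) (leb T) ∧
    pair f (spaceTime T μ) = ∫ t : Ioo (0 : ℝ) T, pair (fun x => f (t, x)) (μ t) ∂(leb T) := by
  have hfin : ∀ g : Ioo (0 : ℝ) T × X → ℝ, ∀ c : ℝ, (∀ x, |g x| ≤ c) →
      ∫⁻ t, ‖pair (fun x => g (t, x)) (μ (t : Ioo (0 : ℝ) T))‖ₑ ∂(leb T) < ∞ := by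
    intro g c hc
    refine lt_of_le_of_lt (lintegral_mono fun t => enorm_pair_le (μ t) fun x => hc (t, x)) ?_
    rw [lintegral_const_mul' _ _ ENNReal.ofReal_ne_top]
    exact ENNReal.mul_lt_top ENNReal.ofReal_lt_top h.finite
  refine bounded_measurable_induction (P := fun f =>
    Integrable (fun t : Ioo (0 : ℝ) T => pair (fun x => f (t, x)) (μ t)) (leb T) ∧
    pair f (spaceTime T μ) = ∫ t : Ioo (0 : ℝ) T, pair (fun x => f (t, x)) (μ t) ∂(leb T))
    ?_ ?_ ?_ hf hc
  · intro s c hs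
    have h1 : ∀ t : Ioo (0 : ℝ) T, pair (fun x => s.indicator (fun _ => c) (t, x)) (μ t)
        = c * μ t (Prod.mk t ⁻¹' s) := fun t => by
      rw [← pair_indicator (measurable_prodMk_left hs)]
      rfl
    have h2 : Integrable (fun t : Ioo (0 : ℝ) T => μ t (Prod.mk t ⁻¹' s)) (leb T) := by
      refine ⟨(h.measurable_section hs).aestronglyMeasurable, ?_⟩
      exact lt_of_le_of_lt (lintegral_mono fun t =>
        (VectorMeasure.enorm_measure_le_variation _ _).trans (measure_mono (subset_univ _))) h.finite
    simp_rw [h1]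
    refine ⟨h2.const_mul c, ?_⟩
    rw [pair_indicator hs, spaceTime_apply h hs, integral_const_mul]
  · rintro f1 f2 hf1 hf2 ⟨c1, hc1⟩ ⟨c2, hc2⟩ ⟨h1, h1'⟩ ⟨h2, h2'⟩
    have h3 : ∀ t : Ioo (0 : ℝ) T, pair (fun x => f1 (t, x) + f2 (t, x)) (μ t)
        = pair (fun x => f1 (t, x)) (μ t) + pair (fun x => f2 (t, x)) (μ t) := fun t =>
      pair_add (integrable_of_bounded (hf1.comp measurable_prodMk_left) fun x => hc1 (t, x))
        (integrable_of_bounded (hf2.comp measurable_prodMk_left) fun x => hc2 (t, x))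
    simp_rw [h3]
    refine ⟨h1.add h2, ?_⟩
    rw [pair_add (integrable_of_bounded hf1 hc1) (integrable_of_bounded hf2 hc2), h1', h2',
      integral_add h1 h2]
  · intro F f c hF hFc hlim hP
    have hfc : ∀ x, |f x| ≤ c := fun x =>
      le_of_tendsto (hlim x).abs (.of_forall fun n => hFc n x)
    have hpt : ∀ t : Ioo (0 : ℝ) T, Tendsto (fun n => pair (fun x => F n (t, x)) (μ t)) atTop
        (𝓝 (pair (fun x => f (t, x)) (μ t))) := fun t =>
      tendsto_pair_of_bounded (fun n => (hF n).comp measurable_prodMk_left)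
        (fun n x => hFc n (t, x)) (fun x => hlim (t, x)) (μ t)
    have hmeas := aestronglyMeasurable_of_tendsto_ae atTop (fun n => (hP n).1.aestronglyMeasurable)
      (.of_forall hpt)
    refine ⟨⟨hmeas, hfin f c hfc⟩, ?_⟩
    refine tendsto_nhds_unique (tendsto_pair_of_bounded hF hFc hlim _) ?_
    simp_rw [fun n => (hP n).2]
    -- The total variation is not known to be measurable in time, so the dominating function is the
    -- countable supremum of the pairings, which is measurable and lies below it.
    have hsup : ∀ t : Ioo (0 : ℝ) T, ⨆ n, ‖pair (fun x => F n (t, x)) (μ t)‖ₑ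
        ≤ ENNReal.ofReal c * (μ t).variation univ := fun t =>
      iSup_le fun n => enorm_pair_le (μ t) fun x => hFc n (t, x)
    have hfinite : ∫⁻ t : Ioo (0 : ℝ) T, ⨆ n, ‖pair (fun x => F n (t, x)) (μ t)‖ₑ ∂(leb T) ≠ ∞ := by
      refine (lt_of_le_of_lt (lintegral_mono hsup) ?_).ne
      rw [lintegral_const_mul' _ _ ENNReal.ofReal_ne_top]
      exact ENNReal.mul_lt_top ENNReal.ofReal_lt_top h.finite
    refine tendsto_integral_of_dominated_convergence
      (fun t => (⨆ n, ‖pair (fun x => F n (t, x)) (μ (t : Ioo (0 : ℝ) T))‖ₑ).toReal)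
      (fun n => (hP n).1.aestronglyMeasurable) ?_ ?_ (.of_forall hpt)
    · exact integrable_toReal_of_lintegral_ne_top
        (AEMeasurable.iSup fun n => (hP n).1.aestronglyMeasurable.enorm) hfinite
    · refine fun n => .of_forall fun t => ?_
      have hne : (⨆ n, ‖pair (fun x => F n (t, x)) (μ t)‖ₑ) ≠ ∞ :=
        ((hsup t).trans_lt (ENNReal.mul_lt_top ENNReal.ofReal_lt_top (variation_lt_top _))).ne
      have := ENNReal.toReal_mono hne
        (le_iSup (fun n => ‖pair (fun x => F n (t, x)) (μ t)‖ₑ) n)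
      simpa using this

end KacFC

namespace KacFC

/-! ### The stationary measure, the velocity reversal and the free flow -/

section PhaseSpace

instance isProbabilityMeasure_torus : IsProbabilityMeasure (volume : Measure Torus) :=
  ⟨UnitAddCircle.measure_univ⟩

instance isProbabilityMeasure_stat : IsProbabilityMeasure stat := by
  constructor
  unfold stat
  rw [← univ_prod_univ, Measure.prod_prod]
  have : Measure.count (univ : Set Bool) = 2 := by
    rw [Measure.count_univ]; simp
  rw [Measure.smul_apply, this, smul_eq_mul, measure_univ, one_mul,
    ENNReal.inv_mul_cancel two_ne_zero ENNReal.ofNat_ne_top]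

theorem half_count : (2⁻¹ : ℝ≥0∞) • (Measure.count : Measure Bool)
    = (2⁻¹ : ℝ≥0∞) • Measure.dirac true + (2⁻¹ : ℝ≥0∞) • Measure.dirac false := by
  rw [← smul_add]
  congr 1
  ext s hs
  rw [Measure.count, Measure.sum_apply _ hs, tsum_fintype, Fintype.sum_bool]
  rfl

theorem lintegral_stat {f : Phase → ℝ≥0∞} (hf : Measurable f) :
    ∫⁻ z, f z ∂stat = 2⁻¹ * (∫⁻ x, f (x, true)) + 2⁻¹ * ∫⁻ x, f (x, false) := by
  unfold stat
  rw [lintegral_prod _ hf.aemeasurable, half_count]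
  have h1 : ∀ b, Measurable fun x : Torus => f (x, b) := fun b => hf.comp measurable_prodMk_right
  simp only [lintegral_add_measure, lintegral_smul_measure, lintegral_dirac, smul_eq_mul]
  rw [lintegral_add_left ((h1 true).const_mul _), lintegral_const_mul _ (h1 true),
    lintegral_const_mul _ (h1 false)]

theorem measurable_rev : Measurable rev :=
  measurable_fst.prodMk ((measurable_of_finite not).comp measurable_snd)

theorem continuous_rev : Continuous rev :=
  continuous_fst.prodMk ((continuous_of_discreteTopology (f := not)).comp continuous_snd)

/-- The free flow `(x, v) ↦ (x + v h, v)`. -/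
noncomputable def flow (V h : ℝ) (z : Phase) : Phase := (z.1 + ((vel V z.2 * h : ℝ) : Torus), z.2)

theorem continuous_vel (V : ℝ) : Continuous fun z : Phase => vel V z.2 :=
  (continuous_of_discreteTopology (f := vel V)).comp continuous_snd

theorem continuous_flow₂ (V : ℝ) : Continuous fun p : ℝ × Phase => flow V p.1 p.2 := by
  refine Continuous.prodMk ?_ (continuous_snd.comp continuous_snd)
  refine (continuous_fst.comp continuous_snd).add ?_
  exact (AddCircle.continuous_mk' 1).comp (((continuous_vel V).comp continuous_snd).mul
    continuous_fst)

theorem continuous_flow (V h : ℝ) : Continuous (flow V h) :=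
  (continuous_flow₂ V).comp (continuous_const.prodMk continuous_id)

theorem measurable_flow (V h : ℝ) : Measurable (flow V h) := (continuous_flow V h).measurable

@[simp] theorem flow_zero (V : ℝ) (z : Phase) : flow V 0 z = z := by
  ext <;> simp [flow]

theorem lintegral_comp_rev {f : Phase → ℝ≥0∞} (hf : Measurable f) :
    ∫⁻ z, f (rev z) ∂stat = ∫⁻ z, f z ∂stat := by
  rw [lintegral_stat (f := fun z => f (rev z)) (hf.comp measurable_rev), lintegral_stat hf]
  simp only [rev, Bool.not_true, Bool.not_false]
  rw [add_comm]

theorem measurePreserving_rev : MeasurePreserving rev stat stat := by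
  refine ⟨measurable_rev, ?_⟩
  ext s hs
  rw [Measure.map_apply measurable_rev hs, ← lintegral_indicator_one hs,
    ← lintegral_indicator_one (measurable_rev hs)]
  exact lintegral_comp_rev (measurable_one.indicator hs)

theorem lintegral_comp_flow (V h : ℝ) {f : Phase → ℝ≥0∞} (hf : Measurable f) :
    ∫⁻ z, f (flow V h z) ∂stat = ∫⁻ z, f z ∂stat := by
  rw [lintegral_stat (f := fun z => f (flow V h z)) (hf.comp (measurable_flow V h)),
    lintegral_stat hf]
  simp only [flow]
  congr 2
  · exact lintegral_add_right_eq_self (fun x : Torus => f (x, true)) _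
  · exact lintegral_add_right_eq_self (fun x : Torus => f (x, false)) _

theorem measurePreserving_flow (V h : ℝ) : MeasurePreserving (flow V h) stat stat := by
  refine ⟨measurable_flow V h, ?_⟩
  ext s hs
  rw [Measure.map_apply (measurable_flow V h) hs, ← lintegral_indicator_one hs,
    ← lintegral_indicator_one (measurable_flow V h hs)]
  exact lintegral_comp_flow V h (measurable_one.indicator hs)

theorem integral_comp_rev {f : Phase → ℝ} (hf : Measurable f) :
    ∫ z, f (rev z) ∂stat = ∫ z, f z ∂stat := by
  have h := measurePreserving_rev.map_eq
  conv_rhs => rw [← h, integral_map measurable_rev.aemeasurable hf.aestronglyMeasurable]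

theorem integral_comp_flow (V h : ℝ) {f : Phase → ℝ} (hf : Measurable f) :
    ∫ z, f (flow V h z) ∂stat = ∫ z, f z ∂stat := by
  have h := (measurePreserving_flow V h).map_eq
  conv_rhs => rw [← h, integral_map (measurable_flow V _).aemeasurable hf.aestronglyMeasurable]

theorem map_fst_stat : stat.map Prod.fst = (volume : Measure Torus) := by
  ext s hs
  rw [Measure.map_apply measurable_fst hs, ← lintegral_indicator_one (measurable_fst hs),
    lintegral_stat (measurable_one.indicator (measurable_fst hs))]
  have h : ∀ b : Bool, ∫⁻ x : Torus, (Prod.fst ⁻¹' s : Set Phase).indicator 1 (x, b)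
      = volume s := fun b => by
    rw [← lintegral_indicator_one hs]
    rfl
  rw [h, h, ← add_mul, ENNReal.inv_two_add_inv_two, one_mul]

end PhaseSpace

/-! ### Differentiation on the torus -/

section Derivative

theorem hasDerivAt_of_isC1 {ψ : Torus → ℝ} (hψ : IsC1 ψ) (x : Torus) (s : ℝ) :
    HasDerivAt (fun r : ℝ => ψ (x + (r : Torus))) (dx ψ (x + (s : Torus))) s := by
  obtain ⟨y, rfl⟩ := QuotientAddGroup.mk_surjective x
  have h1 : ∀ u : ℝ, HasDerivAt (fun r : ℝ => ψ (r : Torus))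
      (deriv (fun r : ℝ => ψ (r : Torus)) u) u := fun u =>
    (hψ.differentiable one_ne_zero u).hasDerivAt
  have h2 : ∀ a u : ℝ, HasDerivAt (fun r : ℝ => ψ ((a : Torus) + (r : Torus)))
      (deriv (fun r : ℝ => ψ (r : Torus)) (a + u)) u := fun a u => by
    have := (h1 (a + u)).comp_const_add a u
    exact this
  have h3 : dx ψ ((y : Torus) + (s : Torus)) = deriv (fun r : ℝ => ψ (r : Torus)) (y + s) := by
    unfold dx
    rw [← AddCircle.coe_add]
    simpa using (h2 (y + s) 0).deriv
  have := h2 y s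
  rw [← h3] at this
  exact this

theorem hasDerivAt_zero_of_isC1 {ψ : Torus → ℝ} (hψ : IsC1 ψ) (x : Torus) :
    HasDerivAt (fun r : ℝ => ψ (x + (r : Torus))) (dx ψ x) 0 := by
  simpa using hasDerivAt_of_isC1 hψ x 0

/-- By translation, a derivative at increment zero at every base point is a derivative everywhere.
Smoothed functions and Fourier modes are recognised as admissible test functions in this way. -/
theorem isC1_of_hasDerivAt {ψ ψ' : Torus → ℝ}
    (h : ∀ x, HasDerivAt (fun r : ℝ => ψ (x + (r : Torus))) (ψ' x) 0) (hc : Continuous ψ') :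
    IsC1 ψ ∧ dx ψ = ψ' := by
  refine ⟨?_, funext fun x => (h x).deriv⟩
  have h1 : ∀ u : ℝ, HasDerivAt (fun r : ℝ => ψ (r : Torus)) (ψ' (u : Torus)) u := fun u => by
    have h2 : HasDerivAt (fun r : ℝ => ψ ((u : Torus) + (r : Torus))) (ψ' (u : Torus)) (u - u) := by
      simpa using h u
    have h3 := h2.comp_sub_const u u
    refine h3.congr_of_eventuallyEq (.of_forall fun r => ?_)
    simp only
    rw [← AddCircle.coe_add]
    simp
  unfold IsC1
  rw [contDiff_one_iff_deriv]
  refine ⟨fun u => (h1 u).differentiableAt, ?_⟩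
  have : deriv (fun r : ℝ => ψ (r : Torus)) = fun u : ℝ => ψ' (u : Torus) :=
    funext fun u => (h1 u).deriv
  rw [this]
  exact hc.comp (AddCircle.continuous_mk' 1)

theorem continuous_torus_iff {ψ : Torus → ℝ} :
    Continuous ψ ↔ Continuous fun s : ℝ => ψ (s : Torus) := by
  refine ⟨fun h => h.comp (AddCircle.continuous_mk' 1), fun h => ?_⟩
  exact (QuotientAddGroup.isQuotientMap_mk _).continuous_iff.2 h

theorem continuous_of_isC1 {ψ : Torus → ℝ} (hψ : IsC1 ψ) : Continuous ψ :=
  continuous_torus_iff.2 hψ.continuous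

theorem continuous_dx {ψ : Torus → ℝ} (hψ : IsC1 ψ) : Continuous (dx ψ) := by
  rw [continuous_torus_iff]
  have : (fun s : ℝ => dx ψ (s : Torus)) = deriv fun s : ℝ => ψ (s : Torus) := by
    ext s
    have := hasDerivAt_of_isC1 hψ 0 s
    simp only [zero_add] at this
    exact this.deriv.symm
  rw [this]
  exact (contDiff_one_iff_deriv.1 hψ).2

theorem exists_abs_le_of_continuous {X : Type*} [TopologicalSpace X] [CompactSpace X]
    {f : X → ℝ} (hf : Continuous f) : ∃ c, ∀ x, |f x| ≤ c :=
  ⟨‖BoundedContinuousFunction.mkOfCompact ⟨f, hf⟩‖, fun x =>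
    (BoundedContinuousFunction.mkOfCompact ⟨f, hf⟩).norm_coe_le_norm x⟩

theorem continuous_phase_iff {φ : Phase → ℝ} :
    Continuous φ ↔ ∀ b, Continuous fun x : Torus => φ (x, b) := by
  refine ⟨fun h b => h.comp (continuous_id.prodMk continuous_const), fun h => ?_⟩
  exact continuous_prod_of_discrete_right.2 h

theorem integrable_of_continuous {X : Type*} [TopologicalSpace X] [CompactSpace X]
    [MeasurableSpace X] [OpensMeasurableSpace X] {f : X → ℝ} (hf : Continuous f)
    (μ : Measure X) [IsFiniteMeasure μ] : Integrable f μ := by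
  obtain ⟨c, hc⟩ := exists_abs_le_of_continuous hf
  exact integrable_of_bounded hf.measurable hc

end Derivative

/-! ### Narrow continuity in time -/

section TimeContinuity

variable {T : ℝ} {σ : ℝ → ProbabilityMeasure Phase}

theorem continuousOn_integral (hσ : ContinuousOn σ (Icc 0 T)) {φ : Phase → ℝ}
    (hφ : Continuous φ) : ContinuousOn (fun t => ∫ z, φ z ∂(σ t : Measure Phase)) (Icc 0 T) := by
  intro t ht
  have h := hσ t ht
  exact (ProbabilityMeasure.tendsto_iff_forall_integral_tendsto.1 h)
    (BoundedContinuousFunction.mkOfCompact ⟨φ, hφ⟩)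

theorem abs_integral_sub_le (μ : Measure Phase) [IsProbabilityMeasure μ] (f g : C(Phase, ℝ)) :
    |∫ z, f z ∂μ - ∫ z, g z ∂μ| ≤ ‖f - g‖ := by
  rw [← integral_sub (integrable_of_continuous f.continuous μ)
    (integrable_of_continuous g.continuous μ)]
  have := norm_integral_le_of_norm_le_const (μ := μ) (f := fun z => f z - g z) (C := ‖f - g‖)
    (.of_forall fun z => (f - g).norm_coe_le_norm z)
  simpa using this

end TimeContinuity

/-! ### Bounds extracted from the rate functional -/

section Lagrangian

variable {V lam T : ℝ} {σ : ℝ → ProbabilityMeasure Phase} {j₁ j₂ : ℝ → SignedMeasure Phase}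

theorem intervalIntegrable_pair (h : IsFluxFamily T j₁) {f : Phase → ℝ} (hf : Continuous f)
    {s t : ℝ} (hs : 0 ≤ s) (hst : s ≤ t) (ht : t ≤ T) :
    IntervalIntegrable (fun r => pair f (j₁ r)) volume s t := by
  obtain ⟨c, hc⟩ := exists_abs_le_of_continuous hf
  rw [intervalIntegrable_iff_integrableOn_Ioo_of_le hst]
  exact (integrableOn_pair h hf.measurable hc).mono_set (Ioo_subset_Ioo hs ht)

theorem intervalIntegrable_of_continuousOn {f : ℝ → ℝ} (hf : ContinuousOn f (Icc 0 T))
    {s t : ℝ} (hs : 0 ≤ s) (hst : s ≤ t) (ht : t ≤ T) : IntervalIntegrable f volume s t :=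
  (hf.mono (by rw [uIcc_of_le hst]; exact Icc_subset_Icc hs ht)).intervalIntegrable

theorem continuousOn_hamiltonian (hσ : ContinuousOn σ (Icc 0 T)) (φ₁ φ₂ : C(Phase, ℝ)) :
    ContinuousOn (fun r => hamiltonian V lam (σ r) φ₁ φ₂) (Icc 0 T) :=
  continuousOn_integral hσ (((continuous_vel V).mul φ₁.continuous).add
    (continuous_const.mul ((Real.continuous_exp.comp φ₂.continuous).sub continuous_const)))

theorem ofReal_integral_le_lintegral_ofReal {X : Type*} [MeasurableSpace X] {μ : Measure X}
    {f : X → ℝ} (hf : Integrable f μ) :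
    ENNReal.ofReal (∫ x, f x ∂μ) ≤ ∫⁻ x, ENNReal.ofReal (f x) ∂μ := by
  rw [integral_eq_lintegral_pos_part_sub_lintegral_neg_part hf]
  exact (ENNReal.ofReal_le_ofReal (sub_le_self _ ENNReal.toReal_nonneg)).trans
    ENNReal.ofReal_toReal_le

/-- The rate functional bounds the action of a pair of test functions that do not depend on time. -/
theorem ofReal_integral_le_lintegral_lagrangian (hCE : IsCE T σ j₁ j₂) (φ₁ φ₂ : C(Phase, ℝ))
    {s t : ℝ} (hs : 0 ≤ s) (hst : s ≤ t) (ht : t ≤ T) :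
    ENNReal.ofReal (∫ r in s..t, (pair φ₁ (j₁ r) + pair φ₂ (j₂ r)
        - hamiltonian V lam (σ r) φ₁ φ₂))
      ≤ ∫⁻ r in Ioc s t, lagrangian V lam (σ r) (j₁ r) (j₂ r) := by
  have hint : IntervalIntegrable (fun r => pair φ₁ (j₁ r) + pair φ₂ (j₂ r)
      - hamiltonian V lam (σ r) φ₁ φ₂) volume s t :=
    ((intervalIntegrable_pair hCE.flux₁ φ₁.continuous hs hst ht).add
      (intervalIntegrable_pair hCE.flux₂ φ₂.continuous hs hst ht)).sub
      (intervalIntegrable_of_continuousOn (continuousOn_hamiltonian hCE.continuousOn φ₁ φ₂)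
        hs hst ht)
  rw [intervalIntegral.integral_of_le hst]
  have hI := (intervalIntegrable_iff_integrableOn_Ioc_of_le hst).1 hint
  refine (ofReal_integral_le_lintegral_ofReal hI).trans ?_
  exact lintegral_mono fun r => le_iSup₂_of_le φ₁ φ₂ le_rfl

/-- Test with ±M(χ₁, χ₂), the sign being that of the flux defect. The Hamiltonian is linear in the
first component, which produces the term v χ₁ exactly; the second component costs at most λ e^{MB}.
The free parameter M decides how this cost is weighed against the Lagrangian. -/
theorem ofReal_mul_abs_flux_le (hlam : 0 < lam) (μ : ProbabilityMeasure Phase)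
    (m₁ m₂ : SignedMeasure Phase) (χ₁ χ₂ : C(Phase, ℝ)) {B M : ℝ} (hM : 0 < M)
    (hB : ∀ z, |χ₂ z| ≤ B) :
    ENNReal.ofReal (M * |pair χ₁ m₁ - ∫ z, vel V z.2 * χ₁ z ∂(μ : Measure Phase) + pair χ₂ m₂|)
      ≤ lagrangian V lam μ m₁ m₂ + ENNReal.ofReal (lam * Real.exp (M * B)) := by
  set a := pair χ₁ m₁ - ∫ z, vel V z.2 * χ₁ z ∂(μ : Measure Phase) + pair χ₂ m₂ with ha
  obtain ⟨e, he, hea⟩ : ∃ e : ℝ, |e| = 1 ∧ e * a = |a| := by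
    rcases le_total 0 a with h | h
    · exact ⟨1, by simp, by rw [abs_of_nonneg h, one_mul]⟩
    · exact ⟨-1, by simp, by rw [abs_of_nonpos h]; ring⟩
  have hham : hamiltonian V lam μ ((e * M) • χ₁) ((e * M) • χ₂)
      ≤ e * M * ∫ z, vel V z.2 * χ₁ z ∂(μ : Measure Phase) + lam * Real.exp (M * B) := by
    unfold hamiltonian
    have hi1 : Integrable (fun z => vel V z.2 * ((e * M) • χ₁) z) (μ : Measure Phase) :=
      integrable_of_continuous ((continuous_vel V).mul ((e * M) • χ₁).continuous) _
    have hi2 : Integrable (fun z => lam * (Real.exp (((e * M) • χ₂) z) - 1)) (μ : Measure Phase) :=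
      integrable_of_continuous (continuous_const.mul
        ((Real.continuous_exp.comp ((e * M) • χ₂).continuous).sub continuous_const)) _
    rw [integral_add hi1 hi2]
    refine add_le_add (le_of_eq ?_) ?_
    · rw [← integral_const_mul]
      congr 1
      ext z
      simp
      ring
    · have : ∫ z, lam * (Real.exp (((e * M) • χ₂) z) - 1) ∂(μ : Measure Phase)
          ≤ ∫ _z, lam * Real.exp (M * B) ∂(μ : Measure Phase) := by
        refine integral_mono hi2 (integrable_const _) fun z => ?_
        refine mul_le_mul_of_nonneg_left ?_ hlam.le
        have h1 : ((e * M) • χ₂) z ≤ M * B := by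
          refine (le_abs_self _).trans ?_
          simp only [ContinuousMap.coe_smul, Pi.smul_apply, smul_eq_mul, abs_mul, he, one_mul,
            abs_of_pos hM]
          exact mul_le_mul_of_nonneg_left (hB z) hM.le
        have := Real.exp_le_exp.2 h1
        simp only
        linarith
      simpa using this
  have hL : ENNReal.ofReal (pair ((e * M) • χ₁) m₁ + pair ((e * M) • χ₂) m₂
      - hamiltonian V lam μ ((e * M) • χ₁) ((e * M) • χ₂)) ≤ lagrangian V lam μ m₁ m₂ :=
    le_iSup₂_of_le _ _ le_rfl
  refine le_trans ?_ (add_le_add_left hL _)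
  refine le_trans (ENNReal.ofReal_le_ofReal ?_) ENNReal.ofReal_add_le
  have h1 : pair ((e * M) • χ₁) m₁ = e * M * pair χ₁ m₁ := pair_const_mul (e * M) χ₁ m₁
  have h2 : pair ((e * M) • χ₂) m₂ = e * M * pair χ₂ m₂ := pair_const_mul (e * M) χ₂ m₂
  rw [h1, h2, ← hea]
  rw [ha]
  linarith

theorem lintegral_flux_le (hlam : 0 < lam) (χ₁ χ₂ : C(Phase, ℝ)) {B M : ℝ} (hM : 0 < M)
    (hB : ∀ z, |χ₂ z| ≤ B) :
    ENNReal.ofReal M * ∫⁻ r in Ioo 0 T, ENNReal.ofReal |pair χ₁ (j₁ r)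
        - ∫ z, vel V z.2 * χ₁ z ∂(σ r : Measure Phase) + pair χ₂ (j₂ r)|
      ≤ (∫⁻ r in Ioo 0 T, lagrangian V lam (σ r) (j₁ r) (j₂ r))
        + ENNReal.ofReal T * ENNReal.ofReal (lam * Real.exp (M * B)) := by
  rw [← lintegral_const_mul' _ _ ENNReal.ofReal_ne_top]
  refine (lintegral_mono fun r => ?_).trans_eq
    (?_ : ∫⁻ r in Ioo 0 T, (lagrangian V lam (σ r) (j₁ r) (j₂ r)
      + ENNReal.ofReal (lam * Real.exp (M * B))) = _)
  · rw [← ENNReal.ofReal_mul hM.le]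
    exact ofReal_mul_abs_flux_le hlam (σ r) (j₁ r) (j₂ r) χ₁ χ₂ hM hB
  -- Only the constant summand has to be measurable; measurability of the Lagrangian in time, an
  -- uncountable supremum, is not needed.
  · rw [lintegral_add_right _ measurable_const, lintegral_const, Measure.restrict_apply_univ,
      Real.volume_Ioo, sub_zero, mul_comm (ENNReal.ofReal T)]

end Lagrangian

end KacFC

namespace KacFC

/-! ### Smoothing operators -/

section KernelOperators

theorem continuous_integral_kernel {F : Phase → Phase → ℝ}
    (hF : Continuous fun p : Phase × Phase => F p.1 p.2) (μ : Measure Phase) [IsFiniteMeasure μ] :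
    Continuous fun z => ∫ w, F z w ∂μ := by
  obtain ⟨c, hc⟩ := exists_abs_le_of_continuous hF
  refine continuous_of_dominated (bound := fun _ => c) (fun z => ?_) (fun z => .of_forall fun w => ?_)
    (integrable_const c) (.of_forall fun w => ?_)
  · exact (hF.comp (continuous_const.prodMk continuous_id)).aestronglyMeasurable
  · exact hc (z, w)
  · exact hF.comp (continuous_id.prodMk continuous_const)

/-- The integral operator `φ ↦ ∫ F(·, w) φ(w) dπ(w)`. -/
noncomputable def kernelOp (F : C(Phase × Phase, ℝ)) (φ : C(Phase, ℝ)) : C(Phase, ℝ) where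
  toFun z := ∫ w, F (z, w) * φ w ∂stat
  continuous_toFun := continuous_integral_kernel (F := fun z w => F (z, w) * φ w)
    (by fun_prop) stat

/-- The density `w ↦ ∫ F(z, w) dμ(z)`. -/
noncomputable def kernelDual (F : C(Phase × Phase, ℝ)) (μ : ProbabilityMeasure Phase) : C(Phase, ℝ) where
  toFun w := ∫ z, F (z, w) ∂(μ : Measure Phase)
  continuous_toFun := continuous_integral_kernel (F := fun w z => F (z, w)) (by fun_prop) _

theorem integral_kernelOp (F : C(Phase × Phase, ℝ)) (φ : C(Phase, ℝ))
    (μ : ProbabilityMeasure Phase) :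
    ∫ z, kernelOp F φ z ∂(μ : Measure Phase) = ∫ w, φ w * kernelDual F μ w ∂stat := by
  have h : ∀ w, φ w * kernelDual F μ w = ∫ z, F (z, w) * φ w ∂(μ : Measure Phase) := fun w => by
    rw [integral_mul_const, mul_comm]
    rfl
  simp_rw [h]
  refine integral_integral_swap ?_
  exact integrable_of_continuous (f := Function.uncurry fun z w => F (z, w) * φ w)
    (by unfold Function.uncurry; fun_prop) _

theorem norm_kernelOp_sub_le (F : C(Phase × Phase, ℝ)) (φ ψ : C(Phase, ℝ)) :
    ‖kernelOp F φ - kernelOp F ψ‖ ≤ ‖F‖ * ‖φ - ψ‖ := by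
  rw [ContinuousMap.norm_le _ (by positivity)]
  intro z
  have h1 : (kernelOp F φ - kernelOp F ψ) z = ∫ w, F (z, w) * (φ w - ψ w) ∂stat := by
    change ∫ w, F (z, w) * φ w ∂stat - ∫ w, F (z, w) * ψ w ∂stat = _
    rw [← integral_sub (integrable_of_continuous (by fun_prop) _)
      (integrable_of_continuous (by fun_prop) _)]
    simp_rw [mul_sub]
  rw [h1]
  have := norm_integral_le_of_norm_le_const (μ := stat) (f := fun w => F (z, w) * (φ w - ψ w))
    (C := ‖F‖ * ‖φ - ψ‖) (.of_forall fun w => by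
      rw [norm_mul]
      exact mul_le_mul (F.norm_coe_le_norm _) ((φ - ψ).norm_coe_le_norm w) (norm_nonneg _)
        (norm_nonneg _))
  simpa using this

theorem continuous_kernelOp (F : C(Phase × Phase, ℝ)) : Continuous (kernelOp F) := by
  refine (LipschitzWith.of_dist_le_mul (K := ‖F‖₊) fun φ ψ => ?_).continuous
  rw [dist_eq_norm, dist_eq_norm]
  exact norm_kernelOp_sub_le F φ ψ

/-- Smoothing upgrades narrow continuity to continuity in the supremum norm: the functions `F (·,
w)` depend continuously on `w` in that norm, so the smoothed density is jointly continuous in time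
and space, and compactness of the phase space does the rest. -/
theorem continuousOn_kernelDual (F : C(Phase × Phase, ℝ)) {T : ℝ}
    {σ : ℝ → ProbabilityMeasure Phase} (hσ : ContinuousOn σ (Icc 0 T)) :
    ContinuousOn (fun t => kernelDual F (σ t)) (Icc 0 T) := by
  let Fc : C(Phase, C(Phase, ℝ)) := (F.comp ⟨Prod.swap, continuous_swap⟩).curry
  have hjoint : Continuous fun p : Icc (0 : ℝ) T × Phase =>
      ∫ z, Fc p.2 z ∂(σ p.1 : Measure Phase) := by
    rw [continuous_iff_continuousAt]
    rintro ⟨t, w⟩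
    have h1 : Continuous fun s : Icc (0 : ℝ) T => ∫ z, Fc w z ∂(σ s : Measure Phase) :=
      continuousOn_iff_continuous_domRestrict.1 (continuousOn_integral hσ (Fc w).continuous)
    have h2 : Tendsto (fun p : Icc (0 : ℝ) T × Phase => ∫ z, Fc p.2 z ∂(σ p.1 : Measure Phase)
        - ∫ z, Fc w z ∂(σ p.1 : Measure Phase)) (𝓝 (t, w)) (𝓝 0) := by
      refine squeeze_zero_norm (a := fun p => ‖Fc p.2 - Fc w‖)
        (fun p => abs_integral_sub_le (σ p.1 : Measure Phase) (Fc p.2) (Fc w)) ?_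
      have : Continuous fun p : Icc (0 : ℝ) T × Phase => Fc p.2 := Fc.continuous.comp continuous_snd
      exact tendsto_iff_norm_sub_tendsto_zero.1 (this.tendsto (t, w))
    have h3 := h2.add ((h1.comp continuous_fst).tendsto (t, w))
    simp only [Function.comp_apply, sub_add_cancel, zero_add] at h3
    exact h3
  rw [continuousOn_iff_continuous_domRestrict]
  exact (ContinuousMap.curry ⟨_, hjoint⟩).continuous

end KernelOperators

/-- A smooth positive symmetric Markov kernel with respect to `π` on the phase space that commutes
with the velocity reversal and with the free flows. -/
structure SmoothKernel where
  ker : C(Phase × Phase, ℝ)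
  ker' : C(Phase × Phase, ℝ)
  lower : ℝ
  lower_pos : 0 < lower
  lower_le : ∀ p, lower ≤ ker p
  symm : ∀ z w, ker (z, w) = ker (w, z)
  comm_rev : ∀ z w, ker (rev z, rev w) = ker (z, w)
  comm_flow : ∀ V h z w, ker (flow V h z, flow V h w) = ker (z, w)
  integral_eq : ∀ z, ∫ w, ker (z, w) ∂stat = 1
  hasDerivAt : ∀ x b w, HasDerivAt (fun s : ℝ => ker ((x + (s : Torus), b), w)) (ker' ((x, b), w)) 0

namespace SmoothKernel

variable (S : SmoothKernel)

/-- The smoothed density of a probability measure. -/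
noncomputable abbrev dens (μ : ProbabilityMeasure Phase) : C(Phase, ℝ) := kernelDual S.ker μ

theorem lower_le_dens (μ : ProbabilityMeasure Phase) (w : Phase) : S.lower ≤ S.dens μ w := by
  have : ∫ _z, S.lower ∂(μ : Measure Phase) ≤ ∫ z, S.ker (z, w) ∂(μ : Measure Phase) :=
    integral_mono (integrable_const _) (integrable_of_continuous (by fun_prop) _)
      fun z => S.lower_le _
  rw [integral_const, probReal_univ, one_smul] at this
  exact this

theorem dens_pos (μ : ProbabilityMeasure Phase) (w : Phase) : 0 < S.dens μ w :=
  S.lower_pos.trans_le (S.lower_le_dens μ w)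

theorem integral_dens (μ : ProbabilityMeasure Phase) : ∫ w, S.dens μ w ∂stat = 1 := by
  have h := integral_kernelOp S.ker 1 μ
  have h1 : ∀ z, kernelOp S.ker 1 z = 1 := fun z => by
    have := S.integral_eq z
    simpa [kernelOp] using this
  simp_rw [h1] at h
  simpa using h.symm

/-- Truncated at the lower bound of the kernel, the logarithm is continuous on the whole line and
agrees with `log` on smoothed densities. Log densities are thus postcompositions with one fixed
continuous map and inherit continuity in time. -/
theorem continuous_log_max : Continuous fun x : ℝ => Real.log (max x S.lower) :=
  Continuous.log (by fun_prop) fun x => (lt_max_of_lt_right S.lower_pos).ne'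

/-- The logarithm of the smoothed density. -/
noncomputable def logDens (μ : ProbabilityMeasure Phase) : C(Phase, ℝ) :=
  (⟨_, S.continuous_log_max⟩ : C(ℝ, ℝ)).comp (S.dens μ)

theorem logDens_apply (μ : ProbabilityMeasure Phase) (w : Phase) :
    S.logDens μ w = Real.log (S.dens μ w) := by
  simp [logDens, max_eq_left (S.lower_le_dens μ w)]

theorem exp_logDens (μ : ProbabilityMeasure Phase) (w : Phase) :
    Real.exp (S.logDens μ w) = S.dens μ w := by
  rw [logDens_apply, Real.exp_log (S.dens_pos μ w)]

/-- Jensen's inequality for the probability density `S.ker (z, ·)`: integrate the tangent line of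
the exponential at the mean `m`. -/
theorem exp_kernelOp_le (φ : C(Phase, ℝ)) (z : Phase) :
    Real.exp (kernelOp S.ker φ z)
      ≤ kernelOp S.ker ((⟨Real.exp, Real.continuous_exp⟩ : C(ℝ, ℝ)).comp φ) z := by
  set m := kernelOp S.ker φ z with hm
  have h1 : ∫ w, S.ker (z, w) * (Real.exp m * (1 + φ w - m)) ∂stat
      ≤ ∫ w, S.ker (z, w) * Real.exp (φ w) ∂stat := by
    refine integral_mono (integrable_of_continuous (by fun_prop) _)
      (integrable_of_continuous (by fun_prop) _) fun w => ?_
    refine mul_le_mul_of_nonneg_left ?_ (S.lower_pos.le.trans (S.lower_le _))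
    have h2 := Real.add_one_le_exp (φ w - m)
    have h3 : Real.exp (φ w) = Real.exp m * Real.exp (φ w - m) := by
      rw [← Real.exp_add]; congr 1; ring
    rw [h3]
    exact mul_le_mul_of_nonneg_left (by linarith) (Real.exp_pos m).le
  have h4 : ∫ w, S.ker (z, w) * (Real.exp m * (1 + φ w - m)) ∂stat = Real.exp m := by
    have h5 : ∀ w, S.ker (z, w) * (Real.exp m * (1 + φ w - m))
        = Real.exp m * (1 - m) * S.ker (z, w) + Real.exp m * (S.ker (z, w) * φ w) := fun w => by
      ring
    simp_rw [h5]
    rw [integral_add (integrable_of_continuous (by fun_prop) _)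
      (integrable_of_continuous (by fun_prop) _), integral_const_mul, integral_const_mul,
      S.integral_eq]
    have : ∫ w, S.ker (z, w) * φ w ∂stat = m := rfl
    rw [this]
    ring
  rw [h4] at h1
  exact h1

theorem kernelOp_rev (φ : C(Phase, ℝ)) (z : Phase) :
    kernelOp S.ker φ (rev z) = kernelOp S.ker (φ.comp ⟨rev, continuous_rev⟩) z := by
  change ∫ w, S.ker (rev z, w) * φ w ∂stat = ∫ w, S.ker (z, w) * φ (rev w) ∂stat
  have hc : Continuous fun w => S.ker (rev z, w) * φ w := by fun_prop
  rw [← integral_comp_rev hc.measurable]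
  simp_rw [S.comm_rev]

theorem kernelOp_flow (V h : ℝ) (φ : C(Phase, ℝ)) (z : Phase) :
    kernelOp S.ker φ (flow V h z) = kernelOp S.ker (φ.comp ⟨flow V h, continuous_flow V h⟩) z := by
  change ∫ w, S.ker (flow V h z, w) * φ w ∂stat = ∫ w, S.ker (z, w) * φ (flow V h w) ∂stat
  have hc : Continuous fun w => S.ker (flow V h z, w) * φ w := by fun_prop
  rw [← integral_comp_flow V h hc.measurable]
  simp_rw [S.comm_flow]

theorem hasDerivAt_kernelOp (φ : C(Phase, ℝ)) (x : Torus) (b : Bool) :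
    HasDerivAt (fun s : ℝ => kernelOp S.ker φ (x + (s : Torus), b)) (kernelOp S.ker' φ (x, b)) 0 := by
  have hc : ∀ w, Continuous fun x : Torus => S.ker' ((x, b), w) := fun w => by fun_prop
  have h1 : ∀ w (s : ℝ), HasDerivAt (fun s : ℝ => S.ker ((x + (s : Torus), b), w))
      (S.ker' ((x + (s : Torus), b), w)) s := fun w s => by
    obtain ⟨hC1, hdx⟩ := isC1_of_hasDerivAt (ψ := fun x => S.ker ((x, b), w))
      (fun x => S.hasDerivAt x b w) (hc w)
    have := hasDerivAt_of_isC1 hC1 x s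
    rw [hdx] at this
    exact this
  have key := hasDerivAt_integral_of_dominated_loc_of_deriv_le (μ := stat) (𝕜 := ℝ)
    (F := fun s w => S.ker ((x + (s : Torus), b), w) * φ w)
    (F' := fun s w => S.ker' ((x + (s : Torus), b), w) * φ w) (x₀ := 0) (s := univ)
    (bound := fun _ => ‖S.ker'‖ * ‖φ‖) univ_mem
    (.of_forall fun s => Continuous.aestronglyMeasurable (by fun_prop))
    (integrable_of_continuous (by fun_prop) _)
    (Continuous.aestronglyMeasurable (by fun_prop))
    (.of_forall fun w s _ => by
      rw [norm_mul]
      exact mul_le_mul (S.ker'.norm_coe_le_norm _) (φ.norm_coe_le_norm w) (norm_nonneg _)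
        (norm_nonneg _))
    (integrable_const _) (.of_forall fun w s _ => (h1 w s).mul_const _)
  have := key.2
  simp only [AddCircle.coe_zero, add_zero] at this
  exact this

theorem isC1_kernelOp (φ : C(Phase, ℝ)) (b : Bool) :
    IsC1 (fun x => kernelOp S.ker φ (x, b)) ∧
      dx (fun x => kernelOp S.ker φ (x, b)) = fun x => kernelOp S.ker' φ (x, b) :=
  isC1_of_hasDerivAt (fun x => S.hasDerivAt_kernelOp φ x b)
    ((kernelOp S.ker' φ).continuous.comp (continuous_id.prodMk continuous_const))

end SmoothKernel

theorem mul_log_sub_log_ge {a b : ℝ} (ha : 0 < a) (hb : 0 < b) :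
    b - a ≤ b * (Real.log b - Real.log a) := by
  have h := Real.log_le_sub_one_of_pos (div_pos ha hb)
  rw [Real.log_div ha.ne' hb.ne'] at h
  have h2 := mul_le_mul_of_nonneg_left h hb.le
  have h3 : b * (a / b - 1) = a - b := by field_simp
  rw [h3] at h2
  linarith

/-- Gibbs' inequality for positive continuous densities of equal mass. -/
theorem integral_mul_log_le {f g : Phase → ℝ} (hf : Continuous f) (hg : Continuous g)
    (hf0 : ∀ z, 0 < f z) (hg0 : ∀ z, 0 < g z) (h : ∫ z, f z ∂stat = ∫ z, g z ∂stat) :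
    ∫ z, f z * Real.log (g z) ∂stat ≤ ∫ z, f z * Real.log (f z) ∂stat := by
  have hlf : Continuous fun z => Real.log (f z) := hf.log fun z => (hf0 z).ne'
  have hlg : Continuous fun z => Real.log (g z) := hg.log fun z => (hg0 z).ne'
  have hfi := integrable_of_continuous hf stat
  have hgi := integrable_of_continuous hg stat
  have h1 : Integrable (fun z => f z * Real.log (f z)) stat :=
    integrable_of_continuous (hf.mul hlf) stat
  have h2 : Integrable (fun z => f z * Real.log (g z)) stat :=
    integrable_of_continuous (hf.mul hlg) stat
  have h3 : ∫ z, (f z - g z) ∂stat ≤ ∫ z, (f z * Real.log (f z) - f z * Real.log (g z)) ∂stat := by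
    refine integral_mono (hfi.sub hgi) (h1.sub h2) fun z => ?_
    have := mul_log_sub_log_ge (hg0 z) (hf0 z)
    simp only
    linarith
  rw [integral_sub hfi hgi, integral_sub h1 h2, h] at h3
  linarith

end KacFC

/-! ### Entropy dissipation for smoothed densities -/

namespace KacFC

/-- A function whose increments over short intervals are at most `o(1)` times the length of the
interval is nonincreasing. -/
theorem le_of_local_increment_le {T : ℝ} {A : ℝ → ℝ}
    (h : ∀ ε > 0, ∃ η > 0, ∀ s t, 0 ≤ s → s ≤ t → t ≤ T → t - s < η → A t - A s ≤ ε * (t - s))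
    {t : ℝ} (ht0 : 0 ≤ t) (htT : t ≤ T) : A t ≤ A 0 := by
  refine le_of_forall_pos_le_add fun ε hε => ?_
  -- The increments over a partition of `[0, t]` with mesh below `η` add up to at most `ε * t / (t +
  -- 1) ≤ ε`.
  obtain ⟨η, hη, H⟩ := h (ε / (t + 1)) (by positivity)
  obtain ⟨N, hN⟩ := exists_nat_gt (t / η)
  have hN0 : (0 : ℝ) < N := lt_of_le_of_lt (by positivity) hN
  set d := t / N with hd
  have hd0 : 0 ≤ d := by positivity
  have hdη : d < η := by
    rw [hd, div_lt_iff₀ hN0]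
    rwa [div_lt_iff₀ hη, mul_comm] at hN
  have hNd : N * d = t := by rw [hd]; field_simp
  have key : ∀ i : ℕ, i ≤ N → A (i * d) ≤ A 0 + ε / (t + 1) * (i * d) := by
    intro i
    induction i with
    | zero => simp
    | succ i ih =>
      intro hi
      have h1 := ih (by omega)
      have h2 : ((i + 1 : ℕ) : ℝ) * d ≤ T := by
        have : ((i + 1 : ℕ) : ℝ) * d ≤ N * d :=
          mul_le_mul_of_nonneg_right (by exact_mod_cast hi) hd0
        linarith
      have h3 : ((i + 1 : ℕ) : ℝ) * d - i * d = d := by push_cast; ring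
      have h4 := H (i * d) ((i + 1 : ℕ) * d) (by positivity) (by linarith) h2 (by linarith)
      rw [h3] at h4
      have h5 : ε / (t + 1) * (((i + 1 : ℕ) : ℝ) * d) = ε / (t + 1) * (i * d) + ε / (t + 1) * d := by
        push_cast; ring
      linarith
  have h1 := key N le_rfl
  rw [hNd] at h1
  have h2 : ε / (t + 1) * t ≤ ε := by
    rw [div_mul_eq_mul_div, div_le_iff₀ (by positivity)]
    nlinarith
  linarith

namespace SmoothKernel

variable (S : SmoothKernel)

/-- The test function `M log f`, for the smoothed density `f`. -/
noncomputable def potential (μ : ProbabilityMeasure Phase) : C(Phase, ℝ) :=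
  kernelOp S.ker (S.logDens μ)

/-- The space derivative of `potential`. -/
noncomputable def potential' (μ : ProbabilityMeasure Phase) : C(Phase, ℝ) :=
  kernelOp S.ker' (S.logDens μ)

/-- Half the jump of `potential` under the velocity reversal. -/
noncomputable def halfJump (μ : ProbabilityMeasure Phase) : C(Phase, ℝ) :=
  (2⁻¹ : ℝ) • ((S.potential μ).comp ⟨rev, continuous_rev⟩ - S.potential μ)

/-- The entropy of the smoothed density. -/
noncomputable def entropy (μ : ProbabilityMeasure Phase) : ℝ :=
  ∫ w, S.dens μ w * Real.log (S.dens μ w) ∂stat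

/-- The Fisher information of the smoothed density, as one minus a Hellinger affinity. -/
noncomputable def fisherInfo (μ : ProbabilityMeasure Phase) : ℝ :=
  1 - ∫ w, √(S.dens μ w * S.dens μ (rev w)) ∂stat

/-- The integrand of the Hamiltonian at half the potential. -/
noncomputable def hamDensity (V lam : ℝ) (μ : ProbabilityMeasure Phase) : C(Phase, ℝ) :=
  (⟨fun z => vel V z.2, continuous_vel V⟩ : C(Phase, ℝ)) * ((2⁻¹ : ℝ) • S.potential' μ)
    + lam • ((⟨Real.exp, Real.continuous_exp⟩ : C(ℝ, ℝ)).comp (S.halfJump μ) - 1)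

theorem integral_hamDensity (V lam : ℝ) (μ ν : ProbabilityMeasure Phase) :
    ∫ z, S.hamDensity V lam μ z ∂(ν : Measure Phase)
      = hamiltonian V lam ν ((2⁻¹ : ℝ) • S.potential' μ) (S.halfJump μ) := rfl

theorem integral_potential (μ ν : ProbabilityMeasure Phase) :
    ∫ z, S.potential μ z ∂(ν : Measure Phase)
      = ∫ w, S.dens ν w * Real.log (S.dens μ w) ∂stat := by
  unfold potential
  rw [integral_kernelOp]
  simp_rw [S.logDens_apply, mul_comm]

theorem integral_potential_self (μ : ProbabilityMeasure Phase) :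
    ∫ z, S.potential μ z ∂(μ : Measure Phase) = S.entropy μ := S.integral_potential μ μ

/-- Convexity: the potential of `μ` is a subgradient of the smoothed entropy at `μ`, by Gibbs'
inequality. With `μ` the state at the later time, an increment of entropy is bounded by the
increment of a fixed linear observable, to which the continuity equation applies. -/
theorem entropy_sub_le (μ ν : ProbabilityMeasure Phase) :
    S.entropy μ - S.entropy ν
      ≤ ∫ z, S.potential μ z ∂(μ : Measure Phase) - ∫ z, S.potential μ z ∂(ν : Measure Phase) := by
  rw [S.integral_potential_self μ, S.integral_potential μ ν]
  have := integral_mul_log_le (S.dens ν).continuous (S.dens μ).continuous (S.dens_pos ν)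
    (S.dens_pos μ) (by rw [S.integral_dens, S.integral_dens])
  unfold entropy
  linarith

/-- Transport does not produce entropy. -/
theorem integral_vel_mul_potential' (V : ℝ) (μ : ProbabilityMeasure Phase) :
    ∫ z, vel V z.2 * S.potential' μ z ∂(μ : Measure Phase) = 0 := by
  set Φ := S.potential μ with hΦ
  have h1 : ∀ z h, HasDerivAt (fun h : ℝ => Φ (flow V h z))
      (vel V z.2 * S.potential' μ (flow V h z)) h := by
    rintro ⟨x, b⟩ h
    obtain ⟨hC1, hdx⟩ := S.isC1_kernelOp (S.logDens μ) b
    have h2 := hasDerivAt_of_isC1 hC1 x (vel V b * h)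
    rw [hdx] at h2
    have h3 : HasDerivAt (fun h : ℝ => vel V b * h) (vel V b) h := by
      simpa using (hasDerivAt_id h).const_mul (vel V b)
    have := HasDerivAt.comp h h2 h3
    rw [mul_comm] at this
    exact this
  have hfc : ∀ z, Continuous fun h => flow V h z := fun z =>
    (continuous_flow₂ V).comp (continuous_id.prodMk continuous_const)
  have key := hasDerivAt_integral_of_dominated_loc_of_deriv_le (μ := (μ : Measure Phase)) (𝕜 := ℝ)
    (F := fun h z => Φ (flow V h z))
    (F' := fun h z => vel V z.2 * S.potential' μ (flow V h z)) (x₀ := 0) (s := univ)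
    (bound := fun z => |vel V z.2| * ‖S.potential' μ‖) univ_mem
    (.of_forall fun h => (Φ.continuous.comp (continuous_flow V h)).aestronglyMeasurable)
    (integrable_of_continuous (Φ.continuous.comp (continuous_flow V 0)) _)
    ((continuous_vel V).mul
      ((S.potential' μ).continuous.comp (continuous_flow V 0))).aestronglyMeasurable
    (.of_forall fun z h _ => by
      rw [norm_mul]
      exact mul_le_mul_of_nonneg_left ((S.potential' μ).norm_coe_le_norm _) (abs_nonneg _))
    (integrable_of_continuous ((continuous_vel V).abs.mul continuous_const) _)
    (.of_forall fun z h _ => h1 z h)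
  -- Instead of an integration by parts: by Gibbs' inequality and flow invariance of π, pairing f
  -- with log(f ∘ flow) is largest at flow time zero, where the derivative therefore vanishes.
  have hmax : IsLocalMax (fun h => ∫ z, Φ (flow V h z) ∂(μ : Measure Phase)) 0 := by
    refine .of_forall fun h => ?_
    have h2 : ∀ h, ∫ z, Φ (flow V h z) ∂(μ : Measure Phase)
        = ∫ w, S.dens μ w * Real.log (S.dens μ (flow V h w)) ∂stat := fun h => by
      simp_rw [hΦ, potential, S.kernelOp_flow]
      rw [integral_kernelOp]
      refine integral_congr_ae (.of_forall fun w => ?_)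
      simp only [ContinuousMap.comp_apply, ContinuousMap.coe_mk, S.logDens_apply]
      rw [mul_comm]
    simp only
    rw [h2, h2]
    simp only [flow_zero]
    refine integral_mul_log_le (S.dens μ).continuous
      ((S.dens μ).continuous.comp (continuous_flow V h)) (S.dens_pos μ) (fun z => S.dens_pos μ _) ?_
    exact (integral_comp_flow V h (S.dens μ).continuous.measurable).symm
  have := hmax.hasDerivAt_eq_zero key.2
  simpa using this

/-- Since smoothing commutes with reversal, the half jump is Mψ with ψ = ½(log f ∘ ι - log f).
Jensen gives e^{Mψ} ≤ M e^ψ, and duality moves M onto the measure: ∫ e^ψ f dπ = ∫ √(f · f ∘ ι) dπ.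
-/
theorem integral_exp_halfJump_le (μ : ProbabilityMeasure Phase) :
    ∫ z, Real.exp (S.halfJump μ z) ∂(μ : Measure Phase)
      ≤ ∫ w, √(S.dens μ w * S.dens μ (rev w)) ∂stat := by
  set ψ : C(Phase, ℝ) := (2⁻¹ : ℝ) • ((S.logDens μ).comp ⟨rev, continuous_rev⟩ - S.logDens μ)
    with hψ
  have h1 : S.halfJump μ = kernelOp S.ker ψ := by
    ext z
    have hz : S.halfJump μ z = 2⁻¹ * (kernelOp S.ker (S.logDens μ) (rev z)
      - kernelOp S.ker (S.logDens μ) z) := rfl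
    rw [hz, S.kernelOp_rev]
    change 2⁻¹ * (∫ w, S.ker (z, w) * S.logDens μ (rev w) ∂stat
      - ∫ w, S.ker (z, w) * S.logDens μ w ∂stat)
      = ∫ w, S.ker (z, w) * (2⁻¹ * (S.logDens μ (rev w) - S.logDens μ w)) ∂stat
    have hr : Continuous fun w => S.logDens μ (rev w) :=
      (S.logDens μ).continuous.comp continuous_rev
    rw [← integral_sub (integrable_of_continuous (by fun_prop) _)
      (integrable_of_continuous (by fun_prop) _), ← integral_const_mul]
    congr 1
    ext w
    ring
  have h2 : ∫ z, Real.exp (S.halfJump μ z) ∂(μ : Measure Phase)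
      ≤ ∫ z, kernelOp S.ker ((⟨Real.exp, Real.continuous_exp⟩ : C(ℝ, ℝ)).comp ψ) z
        ∂(μ : Measure Phase) := by
    rw [h1]
    exact integral_mono
      (integrable_of_continuous (Real.continuous_exp.comp (kernelOp S.ker ψ).continuous) _)
      (integrable_of_continuous (ContinuousMap.continuous _) _) fun z => S.exp_kernelOp_le ψ z
  refine h2.trans (le_of_eq ?_)
  rw [integral_kernelOp]
  refine integral_congr_ae (.of_forall fun w => ?_)
  change Real.exp (2⁻¹ * (S.logDens μ (rev w) - S.logDens μ w)) * S.dens μ w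
    = √(S.dens μ w * S.dens μ (rev w))
  rw [← S.exp_logDens μ w, ← S.exp_logDens μ (rev w), ← Real.exp_add, ← Real.exp_add,
    ← Real.exp_half]
  congr 1
  ring

theorem integral_hamDensity_le {V lam : ℝ} (hlam : 0 ≤ lam) (μ : ProbabilityMeasure Phase) :
    ∫ z, S.hamDensity V lam μ z ∂(μ : Measure Phase) ≤ -(lam * S.fisherInfo μ) := by
  have h1 : ∀ z, S.hamDensity V lam μ z = 2⁻¹ * (vel V z.2 * S.potential' μ z)
      + lam * (Real.exp (S.halfJump μ z) - 1) := fun z => by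
    change vel V z.2 * (2⁻¹ * S.potential' μ z) + lam * (Real.exp (S.halfJump μ z) - 1) = _
    ring
  simp_rw [h1]
  have hv := continuous_vel V
  have he : Continuous fun z => Real.exp (S.halfJump μ z) :=
    Real.continuous_exp.comp (S.halfJump μ).continuous
  rw [integral_add (integrable_of_continuous (by fun_prop) _)
    (integrable_of_continuous (by fun_prop) _), integral_const_mul,
    S.integral_vel_mul_potential', integral_const_mul,
    integral_sub (integrable_of_continuous he _) (integrable_const _)]
  have h2 := S.integral_exp_halfJump_le μ
  unfold fisherInfo
  have h3 : ∫ _z : Phase, (1 : ℝ) ∂(μ : Measure Phase) = 1 := by simp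
  rw [h3]
  have := mul_le_mul_of_nonneg_left h2 hlam
  linarith

section Continuity

variable {T : ℝ} {σ : ℝ → ProbabilityMeasure Phase}

theorem continuousOn_dens (hσ : ContinuousOn σ (Icc 0 T)) :
    ContinuousOn (fun t => S.dens (σ t)) (Icc 0 T) := continuousOn_kernelDual S.ker hσ

theorem continuousOn_logDens (hσ : ContinuousOn σ (Icc 0 T)) :
    ContinuousOn (fun t => S.logDens (σ t)) (Icc 0 T) :=
  (ContinuousMap.continuous_postcomp _).comp_continuousOn (S.continuousOn_dens hσ)

theorem continuousOn_hamDensity (V lam : ℝ) (hσ : ContinuousOn σ (Icc 0 T)) :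
    ContinuousOn (fun t => S.hamDensity V lam (σ t)) (Icc 0 T) := by
  have h1 : ContinuousOn (fun t => S.potential (σ t)) (Icc 0 T) :=
    (continuous_kernelOp S.ker).comp_continuousOn (S.continuousOn_logDens hσ)
  have h2 : ContinuousOn (fun t => S.potential' (σ t)) (Icc 0 T) :=
    (continuous_kernelOp S.ker').comp_continuousOn (S.continuousOn_logDens hσ)
  have h3 : ContinuousOn (fun t => S.halfJump (σ t)) (Icc 0 T) :=
    (((ContinuousMap.continuous_precomp _).comp_continuousOn h1).sub h1).const_smul (2⁻¹ : ℝ)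
  exact (continuousOn_const.mul (h2.const_smul (2⁻¹ : ℝ))).add
    ((((ContinuousMap.continuous_postcomp _).comp_continuousOn h3).sub
      continuousOn_const).const_smul lam)

theorem continuousOn_fisherInfo (hσ : ContinuousOn σ (Icc 0 T)) :
    ContinuousOn (fun t => S.fisherInfo (σ t)) (Icc 0 T) := by
  let g : C(Phase, ℝ) → C(Phase, ℝ) := fun f =>
    (⟨Real.sqrt, Real.continuous_sqrt⟩ : C(ℝ, ℝ)).comp (f * f.comp ⟨rev, continuous_rev⟩)
  have hg : Continuous g := (ContinuousMap.continuous_postcomp _).comp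
    (continuous_id.mul (ContinuousMap.continuous_precomp _))
  have hI : Continuous fun f : C(Phase, ℝ) => ∫ w, f w ∂stat := by
    refine (LipschitzWith.of_dist_le_mul (K := 1) fun f g => ?_).continuous
    rw [Real.dist_eq, dist_eq_norm, NNReal.coe_one, one_mul]
    exact abs_integral_sub_le stat f g
  exact continuousOn_const.sub ((hI.comp hg).comp_continuousOn (S.continuousOn_dens hσ))

end Continuity

section Dissipation

variable {V lam T : ℝ} {σ : ℝ → ProbabilityMeasure Phase} {j₁ j₂ : ℝ → SignedMeasure Phase}

/-- The test pair is half the derivative and half the jump of the potential, frozen at the right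
endpoint. The factor one half makes the exponential of the jump a square root, whence the Hellinger
form of the Fisher information. -/
theorem half_entropy_sub_le (hCE : IsCE T σ j₁ j₂) {s t : ℝ} (hs : 0 ≤ s) (hst : s ≤ t)
    (ht : t ≤ T) (hfin : ∫⁻ r in Ioc s t, lagrangian V lam (σ r) (j₁ r) (j₂ r) ≠ ∞) :
    2⁻¹ * (S.entropy (σ t) - S.entropy (σ s))
      ≤ (∫⁻ r in Ioc s t, lagrangian V lam (σ r) (j₁ r) (j₂ r)).toReal
        + ∫ r in s..t, ∫ z, S.hamDensity V lam (σ t) z ∂(σ r : Measure Phase) := by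
  have h1 := hCE.eq (S.potential (σ t)) (fun b => (S.isC1_kernelOp (S.logDens (σ t)) b).1) s t
    hs hst ht
  have h2 : ∀ z : Phase, dx (fun x => S.potential (σ t) (x, z.2)) z.1 = S.potential' (σ t) z :=
    fun z => congrFun (S.isC1_kernelOp (S.logDens (σ t)) z.2).2 z.1
  simp_rw [h2] at h1
  have h3 : ∀ r, pair ((2⁻¹ : ℝ) • S.potential' (σ t)) (j₁ r) + pair (S.halfJump (σ t)) (j₂ r)
      = 2⁻¹ * (pair (fun z => S.potential' (σ t) z) (j₁ r)
        + pair (fun z => S.potential (σ t) (rev z) - S.potential (σ t) z) (j₂ r)) := fun r => by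
    rw [mul_add]
    congr 1
    · exact pair_const_mul _ _ _
    · exact pair_const_mul _ _ _
  have h4 := ofReal_integral_le_lintegral_lagrangian (V := V) (lam := lam) hCE
    ((2⁻¹ : ℝ) • S.potential' (σ t)) (S.halfJump (σ t)) hs hst ht
  simp_rw [h3, ← S.integral_hamDensity] at h4
  have h5 := (ENNReal.ofReal_le_iff_le_toReal hfin).1 h4
  have hi1 : IntervalIntegrable (fun r => pair (fun z => S.potential' (σ t) z) (j₁ r)) volume s t :=
    intervalIntegrable_pair hCE.flux₁ (S.potential' (σ t)).continuous hs hst ht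
  have hi2 : IntervalIntegrable (fun r => pair (fun z => S.potential (σ t) (rev z)
      - S.potential (σ t) z) (j₂ r)) volume s t :=
    intervalIntegrable_pair hCE.flux₂
      (((S.potential (σ t)).continuous.comp continuous_rev).sub (S.potential (σ t)).continuous)
      hs hst ht
  have hi3 := intervalIntegrable_of_continuousOn (continuousOn_integral hCE.continuousOn
    (S.hamDensity V lam (σ t)).continuous) hs hst ht
  rw [intervalIntegral.integral_sub ((hi1.add hi2).const_mul _) hi3,
    intervalIntegral.integral_const_mul, ← h1] at h5
  have h6 := S.entropy_sub_le (σ t) (σ s)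
  linarith

/-- The entropy dissipation inequality for smoothed densities. -/
theorem half_entropy_add_le (hlam : 0 ≤ lam) (hCE : IsCE T σ j₁ j₂)
    (hfin : ∫⁻ r in Ioo 0 T, lagrangian V lam (σ r) (j₁ r) (j₂ r) ≠ ∞) {t : ℝ} (ht0 : 0 ≤ t)
    (htT : t ≤ T) :
    2⁻¹ * S.entropy (σ t) + lam * ∫ r in 0..t, S.fisherInfo (σ r)
      ≤ 2⁻¹ * S.entropy (σ 0)
        + (∫⁻ r in Ioo 0 T, lagrangian V lam (σ r) (j₁ r) (j₂ r)).toReal := by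
  set L := fun r => lagrangian V lam (σ r) (j₁ r) (j₂ r) with hL
  have hIoc : ∀ s t, 0 ≤ s → t ≤ T → ∫⁻ r in Ioc s t, L r ≤ ∫⁻ r in Ioo 0 T, L r := by
    intro s t hs ht
    rw [restrict_Ioo_eq_restrict_Ioc]
    exact lintegral_mono_set (Ioc_subset_Ioc hs ht)
  have hne : ∀ s t, 0 ≤ s → t ≤ T → ∫⁻ r in Ioc s t, L r ≠ ∞ := fun s t hs ht =>
    ((hIoc s t hs ht).trans_lt hfin.lt_top).ne
  have hadd : ∀ s t, 0 ≤ s → s ≤ t → t ≤ T → (∫⁻ r in Ioc 0 t, L r).toReal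
      = (∫⁻ r in Ioc 0 s, L r).toReal + (∫⁻ r in Ioc s t, L r).toReal := by
    intro s t hs hst ht
    rw [← ENNReal.toReal_add (hne 0 s le_rfl (hst.trans ht)) (hne s t hs ht),
      ← lintegral_union measurableSet_Ioc (Ioc_disjoint_Ioc_of_le le_rfl),
      Ioc_union_Ioc_eq_Ioc hs hst]
  have hFc := S.continuousOn_fisherInfo hCE.continuousOn
  have hFi : ∀ s t, 0 ≤ s → s ≤ t → t ≤ T →
      IntervalIntegrable (fun r => S.fisherInfo (σ r)) volume s t := fun s t hs hst ht =>
    intervalIntegrable_of_continuousOn hFc hs hst ht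
  have huc := isCompact_Icc.uniformContinuousOn_of_continuous
    (S.continuousOn_hamDensity V lam hCE.continuousOn)
  rw [Metric.uniformContinuousOn_iff] at huc
  -- The claim is that entropy plus dissipated Fisher information minus spent action does not
  -- increase.
  have key := le_of_local_increment_le (T := T)
    (A := fun t => 2⁻¹ * S.entropy (σ t) + lam * (∫ r in 0..t, S.fisherInfo (σ r))
      - (∫⁻ r in Ioc 0 t, L r).toReal) (fun ε hε => ?_) ht0 htT
  · simp only [intervalIntegral.integral_same, Ioc_self, Measure.restrict_empty,
      lintegral_zero_measure, ENNReal.toReal_zero, mul_zero, add_zero, sub_zero] at key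
    have := ENNReal.toReal_mono hfin (hIoc 0 t le_rfl htT)
    linarith
  · obtain ⟨η, hη, H⟩ := huc ε hε
    refine ⟨η, hη, fun s t hs hst ht hts => ?_⟩
    have h1 := S.half_entropy_sub_le hCE hs hst ht (hne s t hs ht)
    have h2 := hadd s t hs hst ht
    have h3 := intervalIntegral.integral_add_adjacent_intervals (hFi 0 s le_rfl hs (hst.trans ht))
      (hFi s t hs hst ht)
    have h4 : ∫ r in s..t, ∫ z, S.hamDensity V lam (σ t) z ∂(σ r : Measure Phase)
        ≤ ∫ r in s..t, (ε - lam * S.fisherInfo (σ r)) := by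
      refine intervalIntegral.integral_mono_on hst
        (intervalIntegrable_of_continuousOn (continuousOn_integral hCE.continuousOn
          (S.hamDensity V lam (σ t)).continuous) hs hst ht)
        (intervalIntegrable_const.sub ((hFi s t hs hst ht).const_mul lam)) fun r hr => ?_
      have hr' : r ∈ Icc 0 T := ⟨hs.trans hr.1, hr.2.trans ht⟩
      -- Replacing the Hamiltonian density frozen at `t` by the one at `r` costs at most `ε` in
      -- supremum norm; at equal times its integral is at most minus `lam` times the Fisher
      -- information.
      have h5 := H t ⟨hs.trans hst, ht⟩ r hr' (by
        rw [Real.dist_eq, abs_of_nonneg (by linarith [hr.2])]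
        linarith [hr.1])
      rw [dist_eq_norm] at h5
      have h6 := (le_abs_self _).trans (abs_integral_sub_le (σ r : Measure Phase)
        (S.hamDensity V lam (σ t)) (S.hamDensity V lam (σ r)))
      have h7 := S.integral_hamDensity_le (V := V) hlam (σ r)
      linarith
    rw [intervalIntegral.integral_sub intervalIntegrable_const
      ((hFi s t hs hst ht).const_mul lam), intervalIntegral.integral_const,
      intervalIntegral.integral_const_mul, smul_eq_mul] at h4
    simp only [hL] at h1 h2
    simp only [hL]
    rw [h2, ← h3]
    linarith

end Dissipation

end SmoothKernel

end KacFC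

namespace KacFC

/-! ### A trigonometric approximate identity on the torus -/

section TrigonometricKernel

/-- The cosine of `2π x` on the torus. -/
noncomputable def torusCos (x : Torus) : ℝ := (fourier 1 x : ℂ).re

/-- The sine of `2π x` on the torus. -/
noncomputable def torusSin (x : Torus) : ℝ := (fourier 1 x : ℂ).im

theorem continuous_torusCos : Continuous torusCos :=
  Complex.continuous_re.comp (fourier 1).continuous

theorem continuous_torusSin : Continuous torusSin :=
  Complex.continuous_im.comp (fourier 1).continuous

theorem torusCos_coe (s : ℝ) : torusCos (s : Torus) = Real.cos (2 * Real.pi * s) := by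
  unfold torusCos
  rw [fourier_coe_apply]
  have : (2 * Real.pi * Complex.I * (1 : ℤ) * s / (1 : ℝ) : ℂ)
      = ((2 * Real.pi * s : ℝ) : ℂ) * Complex.I := by push_cast; ring
  rw [this, Complex.exp_ofReal_mul_I_re]

theorem torusSin_coe (s : ℝ) : torusSin (s : Torus) = Real.sin (2 * Real.pi * s) := by
  unfold torusSin
  rw [fourier_coe_apply]
  have : (2 * Real.pi * Complex.I * (1 : ℤ) * s / (1 : ℝ) : ℂ)
      = ((2 * Real.pi * s : ℝ) : ℂ) * Complex.I := by push_cast; ring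
  rw [this, Complex.exp_ofReal_mul_I_im]

theorem torusCos_neg (x : Torus) : torusCos (-x) = torusCos x := by
  obtain ⟨s, rfl⟩ := QuotientAddGroup.mk_surjective x
  have := torusCos_coe (-s)
  rw [mul_neg, Real.cos_neg, ← torusCos_coe, AddCircle.coe_neg] at this
  exact this

@[simp] theorem torusCos_zero : torusCos 0 = 1 := by
  have := torusCos_coe 0
  simpa using this

theorem neg_one_le_torusCos (x : Torus) : -1 ≤ torusCos x := by
  obtain ⟨s, rfl⟩ := QuotientAddGroup.mk_surjective x
  exact (Real.neg_one_le_cos _).trans_eq (torusCos_coe s).symm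

/-- Uniqueness of the maximum of 1 + cos 2πx is what makes the normalized powers concentrate at
zero. A point of the unit circle with real part one is one, and the map to the circle is injective.
-/
theorem torusCos_lt_one {x : Torus} (hx : x ≠ 0) : torusCos x < 1 := by
  have hn : ‖(fourier 1 x : ℂ)‖ = 1 := by rw [fourier_one]; exact Circle.norm_coe _
  have hle : torusCos x ≤ 1 := (Complex.re_le_norm _).trans hn.le
  refine lt_of_le_of_ne hle fun h => hx ?_
  have h1 : (fourier 1 x : ℂ) = 1 := by
    have h2 := Complex.sq_norm_sub_sq_re (fourier 1 x : ℂ)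
    have h3 : (fourier 1 x : ℂ).re = 1 := h
    rw [hn, h3] at h2
    have h4 : (fourier 1 x : ℂ).im = 0 := by nlinarith
    exact Complex.ext (by simpa using h3) (by simpa using h4)
  rw [fourier_one] at h1
  have h5 : AddCircle.toCircle x = AddCircle.toCircle (0 : Torus) := by
    rw [AddCircle.toCircle_zero]
    exact Circle.ext (by simpa using h1)
  exact AddCircle.injective_toCircle one_ne_zero h5

theorem hasDerivAt_torusCos (x : Torus) :
    HasDerivAt (fun s : ℝ => torusCos (x + (s : Torus))) (-(2 * Real.pi) * torusSin x) 0 := by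
  obtain ⟨y, rfl⟩ := QuotientAddGroup.mk_surjective x
  have h1 : ∀ s : ℝ, torusCos ((y : Torus) + (s : Torus)) = Real.cos (2 * Real.pi * (y + s)) :=
    fun s => by rw [← AddCircle.coe_add, torusCos_coe]
  have h3 : HasDerivAt (fun s : ℝ => 2 * Real.pi * (y + s)) (2 * Real.pi) 0 := by
    simpa using ((hasDerivAt_id (0 : ℝ)).const_add y).const_mul (2 * Real.pi)
  have h2 := h3.cos
  have h4 : -Real.sin (2 * Real.pi * (y + 0)) * (2 * Real.pi)
      = -(2 * Real.pi) * torusSin (y : Torus) := by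
    rw [torusSin_coe]; simp; ring
  rw [h4] at h2
  refine h2.congr_of_eventuallyEq (.of_forall fun s => ?_)
  exact h1 s

/-- The normalizing constant of `(1 + cos 2πx)^n`. -/
noncomputable def peakMass (n : ℕ) : ℝ := ∫ x : Torus, (1 + torusCos x) ^ n

theorem continuous_peak (n : ℕ) : Continuous fun x : Torus => (1 + torusCos x) ^ n :=
  (continuous_const.add continuous_torusCos).pow n

theorem peak_nonneg (n : ℕ) (x : Torus) : 0 ≤ (1 + torusCos x) ^ n :=
  pow_nonneg (by linarith [neg_one_le_torusCos x]) n

theorem peakMass_pos (n : ℕ) : 0 < peakMass n := by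
  unfold peakMass
  refine (continuous_peak n).integral_pos_of_hasCompactSupport_nonneg_nonzero
    (HasCompactSupport.of_compactSpace _) (fun x => peak_nonneg n x) (x := 0) ?_
  simp

/-- The peak functions `c_n (1 + cos 2πx)^n` on the torus. -/
noncomputable def peak (n : ℕ) (x : Torus) : ℝ := (peakMass n)⁻¹ * (1 + torusCos x) ^ n

/-- The derivative of the peak functions. -/
noncomputable def peak' (n : ℕ) (x : Torus) : ℝ :=
  (peakMass n)⁻¹ * (n * (1 + torusCos x) ^ (n - 1) * (-(2 * Real.pi) * torusSin x))

theorem hasDerivAt_peak (n : ℕ) (x : Torus) :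
    HasDerivAt (fun s : ℝ => peak n (x + (s : Torus))) (peak' n x) 0 := by
  have h := (((hasDerivAt_torusCos x).const_add 1).pow n).const_mul (peakMass n)⁻¹
  simp only [AddCircle.coe_zero, add_zero] at h
  exact h

@[fun_prop]
theorem continuous_peak_fun (n : ℕ) : Continuous (peak n) :=
  continuous_const.mul (continuous_peak n)

@[fun_prop]
theorem continuous_peak' (n : ℕ) : Continuous (peak' n) :=
  continuous_const.mul ((continuous_const.mul
    ((continuous_const.add continuous_torusCos).pow _)).mul
    (continuous_const.mul continuous_torusSin))

theorem peak_fun_nonneg (n : ℕ) (x : Torus) : 0 ≤ peak n x :=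
  mul_nonneg (inv_nonneg.2 (peakMass_pos n).le) (peak_nonneg n x)

theorem peak_neg (n : ℕ) (x : Torus) : peak n (-x) = peak n x := by
  unfold peak; rw [torusCos_neg]

theorem integral_peak (n : ℕ) : ∫ x, peak n x = 1 := by
  unfold peak
  rw [integral_const_mul]
  exact inv_mul_cancel₀ (peakMass_pos n).ne'

theorem integral_peak_sub (n : ℕ) (x : Torus) : ∫ y, peak n (x - y) = 1 := by
  rw [integral_sub_left_eq_self (peak n) volume x, integral_peak]

theorem tendsto_integral_peak {g : Torus → ℝ} (hg : Continuous g) :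
    Tendsto (fun n => ∫ y, peak n y * g y) atTop (𝓝 (g 0)) := by
  have h := tendsto_setIntegral_pow_smul_of_unique_maximum_of_isCompact_of_continuousOn
    (μ := (volume : Measure Torus)) (s := univ) (x₀ := 0) (c := fun x => 1 + torusCos x) (g := g)
    isCompact_univ (continuous_const.add continuous_torusCos).continuousOn
    (fun y _ hy => by simpa using torusCos_lt_one hy)
    (fun x _ => by linarith [neg_one_le_torusCos x]) (by simp) (by simp) hg.continuousOn
  refine h.congr fun n => ?_
  simp only [Measure.restrict_univ, smul_eq_mul]
  rw [← integral_const_mul]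
  congr 1
  ext y
  unfold peak peakMass
  ring

theorem tendsto_integral_peak_sub {g : Torus → ℝ} (hg : Continuous g) (x : Torus) :
    Tendsto (fun n => ∫ y, peak n (x - y) * g y) atTop (𝓝 (g x)) := by
  have h := tendsto_integral_peak (g := fun y => g (x - y)) (by fun_prop)
  simp only [sub_zero] at h
  refine h.congr fun n => ?_
  rw [← integral_sub_left_eq_self (fun y => peak n y * g (x - y)) volume x]
  simp

end TrigonometricKernel

theorem integral_stat {f : Phase → ℝ} (hf : Integrable f stat) :
    ∫ z, f z ∂stat = 2⁻¹ * (∫ x, f (x, true)) + 2⁻¹ * ∫ x, f (x, false) := by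
  have h1 : stat = (2⁻¹ : ℝ≥0∞) • (volume : Measure Torus).map (fun x => (x, true))
      + (2⁻¹ : ℝ≥0∞) • (volume : Measure Torus).map (fun x => (x, false)) := by
    unfold stat
    rw [half_count, Measure.prod_add, Measure.prod_smul_right, Measure.prod_smul_right,
      Measure.prod_dirac, Measure.prod_dirac]
  have hm : ∀ b : Bool, MeasurableEmbedding fun x : Torus => (x, b) := fun b =>
    MeasurableEmbedding.prodMk_right MeasurableEmbedding.id b
  rw [h1] at hf ⊢
  rw [integral_add_measure hf.left_of_add_measure hf.right_of_add_measure,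
    integral_smul_measure, integral_smul_measure, (hm true).integral_map, (hm false).integral_map]
  simp

/-! ### Markov kernels tending to the identity -/

section KernelSequence

/-- The indicator of equal velocities. -/
def sameVel (b b' : Bool) : ℝ := if b = b' then 1 else 0

@[fun_prop]
theorem continuous_sameVel {X : Type*} [TopologicalSpace X] {f g : X → Bool} (hf : Continuous f)
    (hg : Continuous g) : Continuous fun x => sameVel (f x) (g x) :=
  (continuous_of_discreteTopology (f := fun p : Bool × Bool => sameVel p.1 p.2)).comp
    (hf.prodMk hg)

/-- The weight of the uniform part of the kernels. -/
noncomputable def mixing (n : ℕ) : ℝ := 1 / ((n : ℝ) + 2)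

theorem mixing_pos (n : ℕ) : 0 < mixing n := by unfold mixing; positivity

theorem mixing_le_one (n : ℕ) : mixing n ≤ 1 := by
  unfold mixing
  rw [div_le_one (by positivity)]
  have : (0 : ℝ) ≤ n := n.cast_nonneg
  linarith

theorem tendsto_mixing : Tendsto mixing atTop (𝓝 0) := by
  have h := (tendsto_add_atTop_iff_nat (f := fun n : ℕ => (1 : ℝ) / n) 2).2
    (tendsto_const_div_atTop_nhds_zero_nat 1)
  refine h.congr fun n => ?_
  unfold mixing
  push_cast
  rfl

/-- The space part of the kernels, tensorized with the identity in the velocity. -/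
noncomputable def kernelSeqFun (n : ℕ) (p : Phase × Phase) : ℝ :=
  (1 - mixing n) * (2 * sameVel p.1.2 p.2.2 * peak n (p.1.1 - p.2.1)) + mixing n

/-- The factor 2 in the kernel cancels the weight one half of each velocity under π. What remains is
a convolution at fixed velocity, mixed with the mean over π; the mixing supplies the positive lower
bound. -/
theorem integral_kernelSeqFun_mul (n : ℕ) (z : Phase) {φ : Phase → ℝ} (hφ : Continuous φ) :
    ∫ w, kernelSeqFun n (z, w) * φ w ∂stat
      = (1 - mixing n) * (∫ y, peak n (z.1 - y) * φ (y, z.2)) + mixing n * ∫ w, φ w ∂stat := by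
  have hφb : ∀ b, Continuous fun x : Torus => φ (x, b) := fun b => by fun_prop
  have h1 : ∀ w, kernelSeqFun n (z, w) * φ w
      = (1 - mixing n) * (2 * (sameVel z.2 w.2 * (peak n (z.1 - w.1) * φ w)))
        + mixing n * φ w := fun w => by
    unfold kernelSeqFun
    ring
  simp_rw [h1]
  have hi : Integrable (fun w : Phase => sameVel z.2 w.2 * (peak n (z.1 - w.1) * φ w)) stat :=
    integrable_of_continuous (by fun_prop) _
  rw [integral_add ((hi.const_mul 2).const_mul _)
    ((integrable_of_continuous hφ _).const_mul _), integral_const_mul, integral_const_mul,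
    integral_const_mul, integral_stat hi]
  congr 2
  rcases z with ⟨x, b⟩
  cases b <;> simp [sameVel]

/-- Smooth kernels that approximate the identity. -/
noncomputable def kernelSeq (n : ℕ) : SmoothKernel where
  ker := ⟨kernelSeqFun n, by unfold kernelSeqFun; fun_prop⟩
  ker' := ⟨fun p => (1 - mixing n) * (2 * sameVel p.1.2 p.2.2 * peak' n (p.1.1 - p.2.1)), by
    fun_prop⟩
  lower := mixing n
  lower_pos := mixing_pos n
  lower_le := fun p => by
    change mixing n ≤ kernelSeqFun n p
    unfold kernelSeqFun
    have h1 : 0 ≤ sameVel p.1.2 p.2.2 := by unfold sameVel; split_ifs <;> norm_num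
    have h2 := peak_fun_nonneg n (p.1.1 - p.2.1)
    have h3 : 0 ≤ 1 - mixing n := by linarith [mixing_le_one n]
    have : 0 ≤ (1 - mixing n) * (2 * sameVel p.1.2 p.2.2 * peak n (p.1.1 - p.2.1)) := by positivity
    linarith
  symm := fun z w => by
    change kernelSeqFun n (z, w) = kernelSeqFun n (w, z)
    unfold kernelSeqFun sameVel
    simp only
    rw [← peak_neg n (w.1 - z.1), neg_sub]
    simp only [eq_comm]
  comm_rev := fun z w => by
    change kernelSeqFun n (rev z, rev w) = kernelSeqFun n (z, w)
    simp [kernelSeqFun, sameVel, rev]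
  comm_flow := fun V h z w => by
    change kernelSeqFun n (flow V h z, flow V h w) = kernelSeqFun n (z, w)
    unfold kernelSeqFun sameVel flow
    simp only
    by_cases hzw : z.2 = w.2
    · rw [hzw, add_sub_add_right_eq_sub]
    · simp [hzw]
  integral_eq := fun z => by
    have := integral_kernelSeqFun_mul n z (φ := fun _ => 1) continuous_const
    simp only [mul_one, integral_peak_sub, integral_const, probReal_univ, smul_eq_mul] at this
    change ∫ w, kernelSeqFun n (z, w) ∂stat = 1
    rw [this]
    ring
  hasDerivAt := fun x b w => by
    have h := ((hasDerivAt_peak n (x - w.1)).const_mul (2 * sameVel b w.2)).const_mul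
      (1 - mixing n)
    have h2 := h.add_const (mixing n)
    refine h2.congr_of_eventuallyEq (.of_forall fun s => ?_)
    change kernelSeqFun n ((x + (s : Torus), b), w) = _
    unfold kernelSeqFun
    simp only
    rw [sub_add_eq_add_sub]

theorem tendsto_kernelOp_kernelSeq (φ : C(Phase, ℝ)) (z : Phase) :
    Tendsto (fun n => kernelOp (kernelSeq n).ker φ z) atTop (𝓝 (φ z)) := by
  have h : ∀ n, kernelOp (kernelSeq n).ker φ z
      = (1 - mixing n) * (∫ y, peak n (z.1 - y) * φ (y, z.2)) + mixing n * ∫ w, φ w ∂stat :=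
    fun n => integral_kernelSeqFun_mul n z φ.continuous
  simp_rw [h]
  have h1 := tendsto_integral_peak_sub (g := fun y => φ (y, z.2)) (by fun_prop) z.1
  have h2 := ((tendsto_const_nhds (x := (1 : ℝ))).sub tendsto_mixing).mul h1
  have h3 := h2.add (tendsto_mixing.mul (tendsto_const_nhds (x := ∫ w, φ w ∂stat)))
  simpa using h3

end KernelSequence

end KacFC

namespace KacFC

open InformationTheory

/-! ### Duality for the relative entropy -/

section Duality

/-- Young's inequality for the conjugate pair g log g - g + 1 and e^φ - 1; it is the tangent
inequality of the exponential at φ - log g. -/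
theorem mul_le_klFun_add_exp {g : ℝ} (hg : 0 ≤ g) (φ : ℝ) :
    φ * g ≤ klFun g + (Real.exp φ - 1) := by
  rw [klFun_apply]
  rcases hg.eq_or_lt with rfl | hg
  · simp [(Real.exp_pos φ).le]
  · have h := Real.add_one_le_exp (φ - Real.log g)
    rw [Real.exp_sub, Real.exp_log hg] at h
    have h2 := mul_le_mul_of_nonneg_left h hg.le
    have h3 : g * (Real.exp φ / g) = Real.exp φ := by field_simp
    rw [h3] at h2
    linarith

/-- The variational inequality for the relative entropy. -/
theorem integral_le_ent_add (μ : ProbabilityMeasure Phase) (h : ent (μ : Measure Phase) stat ≠ ∞)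
    (φ : C(Phase, ℝ)) :
    ∫ z, φ z ∂(μ : Measure Phase)
      ≤ (ent (μ : Measure Phase) stat).toReal + ∫ z, (Real.exp (φ z) - 1) ∂stat := by
  obtain ⟨hac, hllr⟩ := klDiv_ne_top_iff.1 h
  rw [toReal_klDiv_eq_integral_klFun hac, ← integral_rnDeriv_smul hac]
  have h1 := (integrable_klFun_rnDeriv_iff hac).2 hllr
  have h2 : Integrable (fun z => Real.exp (φ z) - 1) stat :=
    integrable_of_continuous (by fun_prop) _
  rw [← integral_add h1 h2]
  refine integral_mono ?_ (h1.add h2) fun z => ?_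
  · have : Integrable (fun z => ((μ : Measure Phase).rnDeriv stat z).toReal) stat :=
      Measure.integrable_toReal_rnDeriv
    exact this.mul_bdd φ.continuous.aestronglyMeasurable (.of_forall φ.norm_coe_le_norm)
  · simp only [smul_eq_mul]
    rw [mul_comm]
    exact mul_le_klFun_add_exp ENNReal.toReal_nonneg _

/-- A probability measure whose integrals of continuous functions satisfy the variational
inequality of the relative entropy is absolutely continuous. -/
theorem absolutelyContinuous_of_integral_le (μ : ProbabilityMeasure Phase) (C : ℝ)
    (h : ∀ φ : C(Phase, ℝ), ∫ z, φ z ∂(μ : Measure Phase)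
      ≤ C + ∫ z, (Real.exp (φ z) - 1) ∂stat) : (μ : Measure Phase) ≪ stat := by
  refine Measure.AbsolutelyContinuous.mk fun A hA hA0 => ?_
  have hclosed : ∀ F ⊆ A, IsClosed F → (μ : Measure Phase) F = 0 := by
    intro F hFA hF
    have hF0 : stat F = 0 := measure_mono_null hFA hA0
    have hlim : ∀ ν : Measure Phase, IsFiniteMeasure ν →
        Tendsto (fun n => ∫ z, (hF.apprSeq n z : ℝ) ∂ν) atTop (𝓝 (ν.real F)) := by
      intro ν hν
      have h1 := HasOuterApproxClosed.tendsto_lintegral_apprSeq hF ν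
      have h2 := (ENNReal.tendsto_toReal (measure_ne_top ν F)).comp h1
      refine h2.congr fun n => ?_
      rw [Function.comp_apply, integral_eq_lintegral_of_nonneg_ae (.of_forall fun _ => by positivity)
        (Continuous.aestronglyMeasurable (by fun_prop))]
      simp
    -- Test with `N` times continuous approximations of the indicator of the π-null closed set `F`.
    -- The exponential term disappears in the limit, so `μ F ≤ C / N` for every `N ≥ 1`.
    have hN : ∀ N : ℕ, N * (μ : Measure Phase).real F ≤ C := by
      intro N
      have h1 : ∀ n, N * ∫ z, (hF.apprSeq n z : ℝ) ∂(μ : Measure Phase)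
          ≤ C + (Real.exp N - 1) * ∫ z, (hF.apprSeq n z : ℝ) ∂stat := fun n => by
        have h2 := h ⟨fun z => N * (hF.apprSeq n z : ℝ), by fun_prop⟩
        simp only [ContinuousMap.coe_mk, integral_const_mul] at h2
        refine h2.trans (add_le_add_right ?_ _)
        rw [← integral_const_mul]
        refine integral_mono (integrable_of_continuous (by fun_prop) _)
          (integrable_of_continuous (by fun_prop) _) fun z => ?_
        have hu0 : (0 : ℝ) ≤ hF.apprSeq n z := by positivity
        have hu1 : (hF.apprSeq n z : ℝ) ≤ 1 := by
          exact_mod_cast HasOuterApproxClosed.apprSeq_apply_le_one hF n z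
        -- For 0 ≤ u ≤ 1 convexity gives e^{Nu} - 1 ≤ u(e^N - 1), which makes the exponential term
        -- linear in the approximation.
        have hconv := convexOn_exp.2 (mem_univ (0 : ℝ)) (mem_univ (N : ℝ))
          (sub_nonneg.2 hu1) hu0 (by ring)
        simp only [smul_eq_mul, mul_zero, zero_add, Real.exp_zero, mul_one] at hconv
        simp only
        rw [mul_comm (N : ℝ)]
        linarith
      have h3 := le_of_tendsto_of_tendsto' ((hlim μ inferInstance).const_mul (N : ℝ))
        (((hlim stat inferInstance).const_mul (Real.exp N - 1)).const_add C) h1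
      simpa [measureReal_def, hF0] using h3
    have h0 : (μ : Measure Phase).real F = 0 := by
      by_contra hne
      have hpos : 0 < (μ : Measure Phase).real F := lt_of_le_of_ne measureReal_nonneg (Ne.symm hne)
      obtain ⟨N, hN'⟩ := exists_nat_gt (C / (μ : Measure Phase).real F)
      rw [div_lt_iff₀ hpos] at hN'
      exact absurd (hN N) (not_le.2 hN')
    exact (measureReal_eq_zero_iff).1 h0
  rw [hA.measure_eq_iSup_isClosed_of_ne_top (measure_ne_top _ _)]
  simp only [ENNReal.iSup_eq_zero]
  exact fun F hFA hF => hclosed F hFA hF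

end Duality

/-! ### Smoothed entropy and Fisher information -/

namespace SmoothKernel

variable (S : SmoothKernel)

theorem ker_nonneg (p : Phase × Phase) : 0 ≤ S.ker p := S.lower_pos.le.trans (S.lower_le p)

theorem abs_kernelOp_le (φ : C(Phase, ℝ)) (z : Phase) : |kernelOp S.ker φ z| ≤ ‖φ‖ := by
  have h : ‖∫ w, S.ker (z, w) * φ w ∂stat‖ ≤ ∫ w, S.ker (z, w) * ‖φ‖ ∂stat := by
    refine norm_integral_le_of_norm_le (integrable_of_continuous (by fun_prop) _)
      (.of_forall fun w => ?_)
    rw [norm_mul, Real.norm_of_nonneg (S.ker_nonneg _)]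
    exact mul_le_mul_of_nonneg_left (φ.norm_coe_le_norm w) (S.ker_nonneg _)
  rw [integral_mul_const, S.integral_eq, one_mul] at h
  exact h

theorem integral_klFun_dens (μ : ProbabilityMeasure Phase) :
    ∫ w, klFun (S.dens μ w) ∂stat = S.entropy μ := by
  have hlog : Continuous fun w => Real.log (S.dens μ w) :=
    (S.dens μ).continuous.log fun w => (S.dens_pos μ w).ne'
  have h1 : ∀ w, klFun (S.dens μ w) = S.dens μ w * Real.log (S.dens μ w) + (1 - S.dens μ w) :=
    fun w => by rw [klFun_apply]; ring
  simp_rw [h1]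
  rw [integral_add (integrable_of_continuous (by fun_prop) _)
    (integrable_of_continuous (by fun_prop) _),
    integral_sub (integrable_const _) (integrable_of_continuous (by fun_prop) _), S.integral_dens]
  simp [entropy]

theorem ofReal_entropy (μ : ProbabilityMeasure Phase) :
    ENNReal.ofReal (S.entropy μ) = ∫⁻ w, ENNReal.ofReal (klFun (S.dens μ w)) ∂stat := by
  rw [← S.integral_klFun_dens]
  exact ofReal_integral_eq_lintegral_ofReal
    (integrable_of_continuous (continuous_klFun.comp (S.dens μ).continuous) _)
    (.of_forall fun w => klFun_nonneg (S.dens_pos μ w).le)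

/-- Expand the square: f and f ∘ ι both have integral one, by invariance of π under reversal, so
only the affinity ∫ √(f · f ∘ ι) dπ is left. -/
theorem ofReal_fisherInfo (μ : ProbabilityMeasure Phase) :
    0 ≤ S.fisherInfo μ ∧ ENNReal.ofReal (S.fisherInfo μ) = 2⁻¹ * ∫⁻ w, ENNReal.ofReal
      ((√(S.dens μ (rev w)) - √(S.dens μ w)) ^ 2) ∂stat := by
  have hr : Continuous fun w => S.dens μ (rev w) := (S.dens μ).continuous.comp continuous_rev
  have h1 : ∀ w, (√(S.dens μ (rev w)) - √(S.dens μ w)) ^ 2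
      = S.dens μ (rev w) + S.dens μ w - 2 * √(S.dens μ w * S.dens μ (rev w)) := fun w => by
    rw [sub_sq, Real.sq_sqrt (S.dens_pos μ _).le, Real.sq_sqrt (S.dens_pos μ _).le,
      Real.sqrt_mul (S.dens_pos μ _).le]
    ring
  have hc : Continuous fun w => (√(S.dens μ (rev w)) - √(S.dens μ w)) ^ 2 := by fun_prop
  have h2 : ∫ w, (√(S.dens μ (rev w)) - √(S.dens μ w)) ^ 2 ∂stat = 2 * S.fisherInfo μ := by
    simp_rw [h1]
    rw [integral_sub (integrable_of_continuous (by fun_prop) _)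
      (integrable_of_continuous (by fun_prop) _),
      integral_add (integrable_of_continuous hr _) (integrable_of_continuous (by fun_prop) _),
      integral_comp_rev (S.dens μ).continuous.measurable, S.integral_dens, integral_const_mul]
    unfold fisherInfo
    ring
  have h3 : S.fisherInfo μ
      = 2⁻¹ * ∫ w, (√(S.dens μ (rev w)) - √(S.dens μ w)) ^ 2 ∂stat := by
    rw [h2]; ring
  refine ⟨?_, ?_⟩
  · rw [h3]
    have : 0 ≤ ∫ w, (√(S.dens μ (rev w)) - √(S.dens μ w)) ^ 2 ∂stat :=
      integral_nonneg fun w => by positivity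
    positivity
  · rw [h3, ENNReal.ofReal_mul (by norm_num), ofReal_integral_eq_lintegral_ofReal
      (integrable_of_continuous hc _) (.of_forall fun w => by positivity),
      ENNReal.ofReal_inv_of_pos two_pos, ENNReal.ofReal_ofNat]

theorem integral_kernelOp_stat (φ : C(Phase, ℝ)) :
    ∫ z, kernelOp S.ker φ z ∂stat = ∫ z, φ z ∂stat := by
  have h := integral_kernelOp S.ker φ ⟨stat, isProbabilityMeasure_stat⟩
  have h1 : ∀ w, kernelDual S.ker ⟨stat, isProbabilityMeasure_stat⟩ w = 1 := fun w => by
    change ∫ z, S.ker (z, w) ∂stat = 1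
    simp_rw [fun z => S.symm z w]
    exact S.integral_eq w
  simp_rw [h1, mul_one] at h
  exact h

/-- Smoothing does not increase the entropy. -/
theorem entropy_le_ent (μ : ProbabilityMeasure Phase) (h : ent (μ : Measure Phase) stat ≠ ∞) :
    S.entropy μ ≤ (ent (μ : Measure Phase) stat).toReal := by
  -- The optimal test function for the smoothed entropy is log f, seen from `μ` as M log f. Its
  -- exponential is at most M f, of integral one, so the correction term is nonpositive.
  have h1 := integral_le_ent_add μ h (S.potential μ)
  rw [S.integral_potential_self] at h1
  have h2 : ∫ z, (Real.exp (S.potential μ z) - 1) ∂stat ≤ 0 := by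
    have h3 : ∫ z, Real.exp (S.potential μ z) ∂stat ≤ 1 := by
      calc ∫ z, Real.exp (S.potential μ z) ∂stat
          ≤ ∫ z, kernelOp S.ker
            ((⟨Real.exp, Real.continuous_exp⟩ : C(ℝ, ℝ)).comp (S.logDens μ)) z ∂stat :=
            integral_mono (integrable_of_continuous (by fun_prop) _)
              (integrable_of_continuous (ContinuousMap.continuous _) _)
              fun z => S.exp_kernelOp_le _ z
        _ = 1 := by
            rw [S.integral_kernelOp_stat]
            change ∫ w, Real.exp (S.logDens μ w) ∂stat = 1
            simp_rw [S.exp_logDens]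
            exact S.integral_dens μ
    rw [integral_sub (integrable_of_continuous (by fun_prop) _) (integrable_const _)]
    simp only [integral_const, probReal_univ, smul_eq_mul, mul_one]
    linarith
  linarith

/-- The variational inequality for the smoothed density, with the smoothing moved onto the test
function. As the kernels tend to the identity, a uniform bound on the smoothed entropies becomes the
same inequality for `μ` itself, and hence absolute continuity. -/
theorem integral_kernelOp_le (μ : ProbabilityMeasure Phase) (φ : C(Phase, ℝ)) :
    ∫ z, kernelOp S.ker φ z ∂(μ : Measure Phase)
      ≤ S.entropy μ + ∫ z, (Real.exp (φ z) - 1) ∂stat := by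
  rw [integral_kernelOp, ← S.integral_klFun_dens]
  have h1 : Integrable (fun w => klFun (S.dens μ w)) stat :=
    integrable_of_continuous (continuous_klFun.comp (S.dens μ).continuous) _
  have h2 : Integrable (fun w => Real.exp (φ w) - 1) stat :=
    integrable_of_continuous (by fun_prop) _
  rw [← integral_add h1 h2]
  exact integral_mono (integrable_of_continuous (by fun_prop) _) (h1.add h2)
    fun w => mul_le_klFun_add_exp (S.dens_pos μ w).le _

end SmoothKernel

/-! ### Removal of the smoothing -/

section Limit

theorem absolutelyContinuous_of_entropy_le (μ : ProbabilityMeasure Phase) (C : ℝ)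
    (h : ∀ n, (kernelSeq n).entropy μ ≤ C) : (μ : Measure Phase) ≪ stat := by
  refine absolutelyContinuous_of_integral_le μ C fun φ => ?_
  have h1 : Tendsto (fun n => ∫ z, kernelOp (kernelSeq n).ker φ z ∂(μ : Measure Phase)) atTop
      (𝓝 (∫ z, φ z ∂(μ : Measure Phase))) :=
    tendsto_integral_of_dominated_convergence (fun _ => ‖φ‖)
      (fun n => (ContinuousMap.continuous _).aestronglyMeasurable) (integrable_const _)
      (fun n => .of_forall fun z => (kernelSeq n).abs_kernelOp_le φ z)
      (.of_forall fun z => tendsto_kernelOp_kernelSeq φ z)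
  refine le_of_tendsto' h1 fun n => ?_
  exact ((kernelSeq n).integral_kernelOp_le μ φ).trans (add_le_add_left (h n) _)

theorem tendsto_lintegral_kernelOp_sub (φ : C(Phase, ℝ)) :
    Tendsto (fun n => ∫⁻ z, ‖kernelOp (kernelSeq n).ker φ z - φ z‖ₑ ∂stat) atTop (𝓝 0) := by
  have h := tendsto_lintegral_of_dominated_convergence (μ := stat)
    (F := fun n z => ‖kernelOp (kernelSeq n).ker φ z - φ z‖ₑ) (f := fun _ => 0)
    (fun _ => ENNReal.ofReal (‖φ‖ + ‖φ‖))
    (fun n => by fun_prop) (fun n => .of_forall fun z => ?_) (by simp)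
    (.of_forall fun z => ?_)
  · simpa using h
  · simp only
    rw [← ofReal_norm]
    refine ENNReal.ofReal_le_ofReal ((norm_sub_le _ _).trans ?_)
    exact add_le_add ((kernelSeq n).abs_kernelOp_le φ z) (φ.norm_coe_le_norm z)
  · have h1 := (tendsto_kernelOp_kernelSeq φ z).sub_const (φ z)
    rw [sub_self] at h1
    simpa using h1.enorm

/-- With g the density of `μ`, split Mg - g = M(g - φ) + (Mφ - φ) - (g - φ). The kernel is a
contraction in L¹(π), so the first and last terms have the same bound, which explains the factor 2.
-/
theorem SmoothKernel.lintegral_dens_sub_le (S : SmoothKernel) {μ : ProbabilityMeasure Phase}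
    (hμ : (μ : Measure Phase) ≪ stat) (φ : C(Phase, ℝ)) :
    ∫⁻ w, ‖S.dens μ w - ((μ : Measure Phase).rnDeriv stat w).toReal‖ₑ ∂stat
      ≤ 2 * (∫⁻ w, ‖((μ : Measure Phase).rnDeriv stat w).toReal - φ w‖ₑ ∂stat)
        + ∫⁻ w, ‖kernelOp S.ker φ w - φ w‖ₑ ∂stat := by
  set g : Phase → ℝ := fun w => ((μ : Measure Phase).rnDeriv stat w).toReal with hg
  have hgm : Measurable g := (Measure.measurable_rnDeriv _ _).ennreal_toReal
  have hgi : Integrable g stat := Measure.integrable_toReal_rnDeriv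
  have hd : ∀ w, S.dens μ w = ∫ z, S.ker (z, w) * g z ∂stat := fun w => by
    change ∫ z, S.ker (z, w) ∂(μ : Measure Phase) = _
    rw [← integral_rnDeriv_smul hμ]
    simp_rw [smul_eq_mul, mul_comm]
    rfl
  have hpt : ∀ w, ‖S.dens μ w - g w‖ₑ ≤ (∫⁻ z, ENNReal.ofReal (S.ker (z, w)) * ‖g z - φ z‖ₑ ∂stat)
      + ‖kernelOp S.ker φ w - φ w‖ₑ + ‖g w - φ w‖ₑ := fun w => by
    have h1 : S.dens μ w - kernelOp S.ker φ w = ∫ z, S.ker (z, w) * (g z - φ z) ∂stat := by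
      have h2 : kernelOp S.ker φ w = ∫ z, S.ker (z, w) * φ z ∂stat := by
        change ∫ z, S.ker (w, z) * φ z ∂stat = _
        simp_rw [S.symm w]
      have h3 : Integrable (fun z => S.ker (z, w) * g z) stat :=
        hgi.bdd_mul (c := ‖S.ker‖) (Continuous.aestronglyMeasurable (by fun_prop))
          (.of_forall fun z => S.ker.norm_coe_le_norm _)
      rw [hd, h2, ← integral_sub h3 (integrable_of_continuous (by fun_prop) _)]
      simp_rw [mul_sub]
    have h4 : ‖S.dens μ w - kernelOp S.ker φ w‖ₑ
        ≤ ∫⁻ z, ENNReal.ofReal (S.ker (z, w)) * ‖g z - φ z‖ₑ ∂stat := by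
      rw [h1]
      refine (enorm_integral_le_lintegral_enorm _).trans (lintegral_mono fun z => ?_)
      rw [enorm_mul, Real.enorm_of_nonneg (S.ker_nonneg _)]
    have h5 : S.dens μ w - g w = (S.dens μ w - kernelOp S.ker φ w)
        + (kernelOp S.ker φ w - φ w) - (g w - φ w) := by ring
    rw [h5]
    refine (enorm_sub_le).trans (add_le_add_left ((enorm_add_le _ _).trans ?_) _)
    exact add_le_add_left h4 _
  have hm1 : Measurable fun w => ‖g w - φ w‖ₑ := (hgm.sub φ.continuous.measurable).enorm
  have hm2 : Measurable fun w => ‖kernelOp S.ker φ w - φ w‖ₑ := by fun_prop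
  have hm3 : Measurable fun p : Phase × Phase =>
      ENNReal.ofReal (S.ker (p.2, p.1)) * ‖g p.2 - φ p.2‖ₑ := by
    refine Measurable.mul ?_ (hm1.comp measurable_snd)
    exact ENNReal.measurable_ofReal.comp (Continuous.measurable (by fun_prop))
  have hF : ∫⁻ w, ∫⁻ z, ENNReal.ofReal (S.ker (z, w)) * ‖g z - φ z‖ₑ ∂stat ∂stat
      = ∫⁻ w, ‖g w - φ w‖ₑ ∂stat := by
    rw [lintegral_lintegral_swap hm3.aemeasurable]
    refine lintegral_congr fun z => ?_
    have hk : Measurable fun w => ENNReal.ofReal (S.ker (z, w)) :=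
      ENNReal.measurable_ofReal.comp (Continuous.measurable (by fun_prop))
    rw [lintegral_mul_const _ hk, ← ofReal_integral_eq_lintegral_ofReal
      (integrable_of_continuous (by fun_prop) _) (.of_forall fun w => S.ker_nonneg _),
      S.integral_eq, ENNReal.ofReal_one, one_mul]
  refine (lintegral_mono hpt).trans_eq ?_
  rw [lintegral_add_right _ hm1, lintegral_add_right _ hm2, hF, two_mul]
  ring

/-- The smoothed densities converge in mean to the density. -/
theorem tendsto_lintegral_dens_sub {μ : ProbabilityMeasure Phase}
    (hμ : (μ : Measure Phase) ≪ stat) :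
    Tendsto (fun n => ∫⁻ w, ‖(kernelSeq n).dens μ w
      - ((μ : Measure Phase).rnDeriv stat w).toReal‖ₑ ∂stat) atTop (𝓝 0) := by
  rw [ENNReal.tendsto_nhds_zero]
  intro ε hε
  have hε4 : ε / 4 ≠ 0 := (ENNReal.div_pos hε.ne' (by simp)).ne'
  have hgi : Integrable (fun w => ((μ : Measure Phase).rnDeriv stat w).toReal) stat :=
    Measure.integrable_toReal_rnDeriv
  obtain ⟨φ, hφ, -⟩ := hgi.exists_boundedContinuous_lintegral_sub_le hε4
  have h1 := ENNReal.tendsto_nhds_zero.1 (tendsto_lintegral_kernelOp_sub φ.toContinuousMap) (ε / 2)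
    (ENNReal.half_pos hε.ne')
  filter_upwards [h1] with n hn
  refine ((kernelSeq n).lintegral_dens_sub_le hμ φ.toContinuousMap).trans ?_
  refine (add_le_add (mul_le_mul_right hφ 2) hn).trans_eq ?_
  have : 2 * (ε / 4) = ε / 2 := by
    rw [← mul_div_assoc, show (4 : ℝ≥0∞) = 2 * 2 by norm_num,
      ENNReal.mul_div_mul_left _ _ two_ne_zero ENNReal.ofNat_ne_top]
  rw [this, ENNReal.add_halves]

/-- Fatou's lemma when every subsequence has a further subsequence converging a.e. -/
theorem lintegral_le_liminf_of_subseq {X : Type*} [MeasurableSpace X] {μ : Measure X}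
    {F : ℕ → X → ℝ≥0∞} {f : X → ℝ≥0∞} (hF : ∀ n, Measurable (F n))
    (h : ∀ ns : ℕ → ℕ, StrictMono ns → ∃ ms : ℕ → ℕ,
      ∀ᵐ x ∂μ, Tendsto (fun i => F (ns (ms i)) x) atTop (𝓝 (f x))) :
    ∫⁻ x, f x ∂μ ≤ liminf (fun n => ∫⁻ x, F n x ∂μ) atTop := by
  refine le_of_forall_gt_imp_ge_of_dense fun c hc => ?_
  obtain ⟨ns, hns, hlt⟩ := extraction_of_frequently_atTop (frequently_lt_of_liminf_lt (by isBoundedDefault) hc)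
  obtain ⟨ms, hms⟩ := h ns hns
  calc ∫⁻ x, f x ∂μ = ∫⁻ x, liminf (fun i => F (ns (ms i)) x) atTop ∂μ :=
        lintegral_congr_ae (hms.mono fun x hx => hx.liminf_eq.symm)
    _ ≤ liminf (fun i => ∫⁻ x, F (ns (ms i)) x ∂μ) atTop := lintegral_liminf_le fun i => hF _
    _ ≤ liminf (fun _ : ℕ => c) atTop := liminf_le_liminf (.of_forall fun i => (hlt (ms i)).le)
    _ = c := by simp

theorem exists_subseq_dens {μ : ProbabilityMeasure Phase} (hμ : (μ : Measure Phase) ≪ stat)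
    {ns : ℕ → ℕ} (hns : StrictMono ns) : ∃ ms : ℕ → ℕ, ∀ᵐ w ∂stat,
      Tendsto (fun i => (kernelSeq (ns (ms i))).dens μ w) atTop
        (𝓝 ((μ : Measure Phase).rnDeriv stat w).toReal) := by
  have h1 : TendstoInMeasure stat (fun n w => (kernelSeq (ns n)).dens μ w) atTop
      fun w => ((μ : Measure Phase).rnDeriv stat w).toReal := by
    refine tendstoInMeasure_of_tendsto_eLpNorm (p := 1) one_ne_zero
      (fun n => (ContinuousMap.continuous _).aestronglyMeasurable)
      (Measure.measurable_rnDeriv _ _).ennreal_toReal.aestronglyMeasurable ?_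
    simp_rw [eLpNorm_one_eq_lintegral_enorm]
    exact (tendsto_lintegral_dens_sub hμ).comp hns.tendsto_atTop
  obtain ⟨ms, -, hms⟩ := h1.exists_seq_tendsto_ae
  exact ⟨ms, hms⟩

theorem ent_le_liminf {μ : ProbabilityMeasure Phase} (hμ : (μ : Measure Phase) ≪ stat) :
    ent (μ : Measure Phase) stat
      ≤ liminf (fun n => ENNReal.ofReal ((kernelSeq n).entropy μ)) atTop := by
  unfold ent
  rw [klDiv_eq_lintegral_klFun_of_ac hμ]
  simp_rw [SmoothKernel.ofReal_entropy]
  refine lintegral_le_liminf_of_subseq (fun n => ENNReal.measurable_ofReal.comp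
    (continuous_klFun.comp ((kernelSeq n).dens μ).continuous).measurable) fun ns hns => ?_
  obtain ⟨ms, hms⟩ := exists_subseq_dens hμ hns
  refine ⟨ms, hms.mono fun w hw => ?_⟩
  exact ((ENNReal.continuous_ofReal.comp continuous_klFun).tendsto _).comp hw

theorem fisher_le_liminf {μ : ProbabilityMeasure Phase} (hμ : (μ : Measure Phase) ≪ stat) :
    fisher (μ : Measure Phase)
      ≤ liminf (fun n => ENNReal.ofReal ((kernelSeq n).fisherInfo μ)) atTop := by
  unfold fisher
  rw [if_pos hμ]
  have h1 : ∀ n, ENNReal.ofReal ((kernelSeq n).fisherInfo μ) = ∫⁻ w, 2⁻¹ * ENNReal.ofReal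
      ((√((kernelSeq n).dens μ (rev w)) - √((kernelSeq n).dens μ w)) ^ 2) ∂stat := fun n => by
    rw [((kernelSeq n).ofReal_fisherInfo μ).2, lintegral_const_mul' _ _ (by simp)]
  rw [← lintegral_const_mul' _ _ (by simp)]
  simp_rw [h1]
  have hc : Continuous fun p : ℝ × ℝ => 2⁻¹ * ENNReal.ofReal ((√p.1 - √p.2) ^ 2) :=
    (ENNReal.continuous_const_mul (by simp)).comp (ENNReal.continuous_ofReal.comp (by fun_prop))
  refine lintegral_le_liminf_of_subseq (fun n => ?_) fun ns hns => ?_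
  · exact (hc.comp ((((kernelSeq n).dens μ).continuous.comp continuous_rev).prodMk
      ((kernelSeq n).dens μ).continuous)).measurable
  · obtain ⟨ms, hms⟩ := exists_subseq_dens hμ hns
    -- Reversal preserves π, so almost everywhere convergence also holds at the reversed point.
    have hms' := measurePreserving_rev.quasiMeasurePreserving.ae hms
    refine ⟨ms, ?_⟩
    filter_upwards [hms, hms'] with w hw hw'
    have hlim : ∀ {u v : ℕ → ℝ} {a b : ℝ}, Tendsto u atTop (𝓝 a) → Tendsto v atTop (𝓝 b) →
        Tendsto (fun i => 2⁻¹ * ENNReal.ofReal ((√(u i) - √(v i)) ^ 2)) atTop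
          (𝓝 (2⁻¹ * ENNReal.ofReal ((√a - √b) ^ 2))) := fun hu hv =>
      ENNReal.Tendsto.const_mul (ENNReal.tendsto_ofReal ((hu.sqrt.sub hv.sqrt).pow 2))
        (Or.inr (by simp))
    exact hlim hw' hw

theorem ennreal_liminf_add_le (u v : ℕ → ℝ≥0∞) :
    liminf u atTop + liminf v atTop ≤ liminf (fun n => u n + v n) atTop := by
  have hmono : ∀ w : ℕ → ℝ≥0∞, Monotone fun n => ⨅ i ≥ n, w i := fun w a b hab =>
    le_iInf₂ fun i hi => iInf₂_le i (hab.trans hi)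
  rw [liminf_eq_iSup_iInf_of_nat, liminf_eq_iSup_iInf_of_nat, liminf_eq_iSup_iInf_of_nat,
    ENNReal.iSup_add_iSup_of_monotone (hmono u) (hmono v)]
  exact iSup_mono fun n => le_iInf₂ fun i hi => add_le_add (iInf₂_le i hi) (iInf₂_le i hi)

/-- The entropy dissipation inequality. -/
theorem ent_add_fisher_le {V lam T : ℝ} {σ : ℝ → ProbabilityMeasure Phase}
    {j₁ j₂ : ℝ → SignedMeasure Phase} (hlam : 0 < lam) (hCE : IsCE T σ j₁ j₂)
    (hent : ent (σ 0 : Measure Phase) stat ≠ ∞) (hrate : rate V lam T σ j₁ j₂ ≠ ∞)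
    {t : ℝ} (ht : t ∈ Icc 0 T) :
    2⁻¹ * ent (σ t : Measure Phase) stat
        + ENNReal.ofReal lam * (∫⁻ r in Ioo 0 t, fisher (σ r : Measure Phase))
      ≤ 2⁻¹ * ent (σ 0 : Measure Phase) stat + rate V lam T σ j₁ j₂ := by
  have hrate_eq : rate V lam T σ j₁ j₂
      = ∫⁻ r in Ioo 0 T, lagrangian V lam (σ r) (j₁ r) (j₂ r) := if_pos hCE
  rw [hrate_eq] at hrate ⊢
  set Λ := ∫⁻ r in Ioo 0 T, lagrangian V lam (σ r) (j₁ r) (j₂ r) with hΛ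
  set R := 2⁻¹ * (ent (σ 0 : Measure Phase) stat).toReal + Λ.toReal with hR
  have hmain : ∀ n, ∀ t ∈ Icc 0 T, 2⁻¹ * (kernelSeq n).entropy (σ t)
      + lam * ∫ r in 0..t, (kernelSeq n).fisherInfo (σ r) ≤ R := fun n t ht => by
    have h1 := (kernelSeq n).half_entropy_add_le (V := V) hlam.le hCE hrate ht.1 ht.2
    have h2 := (kernelSeq n).entropy_le_ent (σ 0) hent
    rw [hR]
    linarith
  have hFnn : ∀ n, ∀ t ∈ Icc 0 T, 0 ≤ ∫ r in 0..t, (kernelSeq n).fisherInfo (σ r) := fun n t ht =>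
    intervalIntegral.integral_nonneg ht.1 fun r _ => ((kernelSeq n).ofReal_fisherInfo (σ r)).1
  -- Without the nonnegative Fisher term, the smoothed entropies at each time are bounded uniformly
  -- in `n`. Absolute continuity at every time has to come before Fatou's lemma, which works with
  -- the density.
  have hac : ∀ t ∈ Icc 0 T, (σ t : Measure Phase) ≪ stat := fun t ht => by
    refine absolutelyContinuous_of_entropy_le (σ t) (2 * R) fun n => ?_
    have h1 := hmain n t ht
    have h2 := mul_nonneg hlam.le (hFnn n t ht)
    linarith
  have hfish : ∫⁻ r in Ioo 0 t, fisher (σ r : Measure Phase)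
      ≤ liminf (fun n => ∫⁻ r in Ioo 0 t, ENNReal.ofReal ((kernelSeq n).fisherInfo (σ r)))
        atTop := by
    refine (setLIntegral_mono' measurableSet_Ioo fun r hr =>
      fisher_le_liminf (hac r ⟨hr.1.le, hr.2.le.trans ht.2⟩)).trans ?_
    -- Measurability in time is used only for the smoothed Fisher informations, which are
    -- continuous.
    refine lintegral_liminf_le' fun n => ?_
    have hc := ((kernelSeq n).continuousOn_fisherInfo hCE.continuousOn).mono
      ((Ioo_subset_Ioo_right ht.2).trans Ioo_subset_Icc_self)
    exact ENNReal.measurable_ofReal.comp_aemeasurable (hc.aemeasurable measurableSet_Ioo)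
  have hn : ∀ n, 2⁻¹ * ENNReal.ofReal ((kernelSeq n).entropy (σ t)) + ENNReal.ofReal lam
      * (∫⁻ r in Ioo 0 t, ENNReal.ofReal ((kernelSeq n).fisherInfo (σ r)))
      ≤ 2⁻¹ * ent (σ 0 : Measure Phase) stat + Λ := fun n => by
    have h1 : ∫⁻ r in Ioo 0 t, ENNReal.ofReal ((kernelSeq n).fisherInfo (σ r))
        = ENNReal.ofReal (∫ r in 0..t, (kernelSeq n).fisherInfo (σ r)) := by
      have hi := intervalIntegrable_of_continuousOn
        ((kernelSeq n).continuousOn_fisherInfo hCE.continuousOn) le_rfl ht.1 ht.2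
      rw [intervalIntegral.integral_of_le ht.1, restrict_Ioo_eq_restrict_Ioc]
      exact (ofReal_integral_eq_lintegral_ofReal
        ((intervalIntegrable_iff_integrableOn_Ioc_of_le ht.1).1 hi)
        (.of_forall fun r => ((kernelSeq n).ofReal_fisherInfo (σ r)).1)).symm
    have hen : 0 ≤ (kernelSeq n).entropy (σ t) := by
      rw [← SmoothKernel.integral_klFun_dens]
      exact integral_nonneg fun w => klFun_nonneg ((kernelSeq n).dens_pos _ w).le
    have h2 : (2⁻¹ : ℝ≥0∞) = ENNReal.ofReal 2⁻¹ := by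
      rw [ENNReal.ofReal_inv_of_pos two_pos, ENNReal.ofReal_ofNat]
    rw [h1, h2, ← ENNReal.ofReal_mul (by norm_num), ← ENNReal.ofReal_mul hlam.le,
      ← ENNReal.ofReal_add (by positivity) (mul_nonneg hlam.le (hFnn n t ht)),
      ← ENNReal.ofReal_toReal hent, ← ENNReal.ofReal_toReal hrate,
      ← ENNReal.ofReal_mul (by norm_num), ← ENNReal.ofReal_add (by positivity) (by positivity)]
    exact ENNReal.ofReal_le_ofReal (hmain n t ht)
  calc 2⁻¹ * ent (σ t : Measure Phase) stat
        + ENNReal.ofReal lam * (∫⁻ r in Ioo 0 t, fisher (σ r : Measure Phase))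
      ≤ 2⁻¹ * liminf (fun n => ENNReal.ofReal ((kernelSeq n).entropy (σ t))) atTop
        + ENNReal.ofReal lam * liminf (fun n => ∫⁻ r in Ioo 0 t,
          ENNReal.ofReal ((kernelSeq n).fisherInfo (σ r))) atTop :=
        add_le_add (mul_le_mul_right (ent_le_liminf (hac t ht)) _) (mul_le_mul_right hfish _)
    _ = liminf (fun n => 2⁻¹ * ENNReal.ofReal ((kernelSeq n).entropy (σ t))) atTop
        + liminf (fun n => ENNReal.ofReal lam * ∫⁻ r in Ioo 0 t,
          ENNReal.ofReal ((kernelSeq n).fisherInfo (σ r))) atTop := by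
        rw [ENNReal.liminf_const_mul_of_ne_top (by simp),
          ENNReal.liminf_const_mul_of_ne_top ENNReal.ofReal_ne_top]
    _ ≤ _ := ennreal_liminf_add_le _ _
    _ ≤ liminf (fun _ : ℕ => 2⁻¹ * ent (σ 0 : Measure Phase) stat + Λ) atTop :=
        liminf_le_liminf (.of_forall hn)
    _ = _ := by simp

end Limit

end KacFC

namespace KacFC

open ProbabilityTheory

/-! ### Momentum controlled by the Fisher information -/

section Momentum

/-- The part of a measure on the phase space that moves with a given velocity, as a measure on the
torus. -/
noncomputable def slice (μ : Measure Phase) (b : Bool) : Measure Torus :=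
  (μ.restrict (Prod.snd ⁻¹' {b})).map Prod.fst

theorem measurableSet_snd (b : Bool) : MeasurableSet (Prod.snd ⁻¹' {b} : Set Phase) :=
  measurable_snd (measurableSet_singleton b)

theorem slice_apply (μ : Measure Phase) (b : Bool) {B : Set Torus} (hB : MeasurableSet B) :
    slice μ b B = μ (B ×ˢ {b}) := by
  rw [slice, Measure.map_apply measurable_fst hB, Measure.restrict_apply (measurable_fst hB)]
  rfl

instance isFiniteMeasure_slice (μ : Measure Phase) [IsFiniteMeasure μ] (b : Bool) :
    IsFiniteMeasure (slice μ b) := by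
  unfold slice; infer_instance

theorem map_fst_eq_slice_add (μ : Measure Phase) :
    μ.map Prod.fst = slice μ true + slice μ false := by
  have h : (Prod.snd ⁻¹' {false} : Set Phase) = (Prod.snd ⁻¹' {true})ᶜ := by
    ext z; simp
  unfold slice
  rw [← Measure.map_add _ _ measurable_fst, h, Measure.restrict_add_restrict_compl
    (measurableSet_snd true)]

theorem slice_withDensity {f : Phase → ℝ≥0∞} (hf : Measurable f) (b : Bool) :
    slice (stat.withDensity f) b
      = (volume : Measure Torus).withDensity fun x => 2⁻¹ * f (x, b) := by
  ext B hB
  have hE : MeasurableSet (B ×ˢ {b} : Set Phase) := hB.prod (measurableSet_singleton b)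
  have h1 : ∀ c, Measurable fun x : Torus => f (x, c) := fun c => hf.comp measurable_prodMk_right
  rw [slice_apply _ _ hB, withDensity_apply _ hE, withDensity_apply _ hB,
    ← lintegral_indicator hE, lintegral_stat (hf.indicator hE), lintegral_const_mul _ (h1 b),
    ← lintegral_indicator hB]
  have h2 : ∀ c x, (B ×ˢ {b} : Set Phase).indicator f (x, c)
      = if c = b then B.indicator (fun x => f (x, b)) x else 0 := fun c x => by
    by_cases hc : c = b
    · subst hc
      by_cases hx : x ∈ B <;> simp [hx]
    · simp [hc]
  simp only [h2]
  cases b <;> simp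

/-- Multiply by `F`: the left side becomes ((a - b)/2)². Since a - b = (√a - √b)(√a + √b), the claim
reduces to (√a + √b)² ≤ 2(a + b). Writing `F * θ = a / 2` instead of a quotient leaves room for
vacuum, F = 0. -/
theorem momentum_density_le {a b F θ : ℝ} (ha : 0 ≤ a) (hb : 0 ≤ b) (hF : F = (a + b) / 2)
    (hθ : F * θ = a / 2) : F * (2 * θ - 1) ^ 2 ≤ (√b - √a) ^ 2 := by
  have hF0 : 0 ≤ F := by rw [hF]; positivity
  rcases hF0.eq_or_lt with h0 | h0
  · rw [← h0, zero_mul]; positivity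
  · refine le_of_mul_le_mul_left ?_ h0
    have h1 : F * (F * (2 * θ - 1) ^ 2) = ((a - b) / 2) ^ 2 := by
      have : F * (2 * θ - 1) = (a - b) / 2 := by linarith
      rw [← this]; ring
    have h2 : a = √a ^ 2 := (Real.sq_sqrt ha).symm
    have h3 : b = √b ^ 2 := (Real.sq_sqrt hb).symm
    rw [h1, hF, h2, h3, Real.sqrt_sq (Real.sqrt_nonneg a), Real.sqrt_sq (Real.sqrt_nonneg b)]
    nlinarith [mul_nonneg (sq_nonneg (√b - √a)) (sq_nonneg (√b - √a))]

/-- Here θ is the fraction of right-movers, so V(2θ - 1) is the momentum per unit density, and the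
pointwise inequality is integrated over the torus. The constant is 2V² because the Fisher
information carries a factor one half; being positive, it also gives infinity when `μ` is not
absolutely continuous. -/
theorem lintegral_momentum_le {V : ℝ} (hV : 0 < V) (μ : Measure Phase) [IsFiniteMeasure μ]
    {θ : Torus → ℝ≥0∞} (hθ : Measurable θ)
    (h : slice μ true = (μ.map Prod.fst).withDensity θ) :
    ∫⁻ x, ENNReal.ofReal (|V * (2 * (θ x).toReal - 1)| ^ 2) ∂(μ.map Prod.fst)
      ≤ ENNReal.ofReal (2 * V ^ 2) * fisher μ := by
  by_cases hμ : μ ≪ stat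
  swap
  · rw [fisher, if_neg hμ, ENNReal.mul_top (by simpa using by positivity)]
    exact le_top
  rw [fisher, if_pos hμ]
  have hf : Measurable (μ.rnDeriv stat) := Measure.measurable_rnDeriv _ _
  have hμf : stat.withDensity (μ.rnDeriv stat) = μ := Measure.withDensity_rnDeriv_eq _ _ hμ
  generalize μ.rnDeriv stat = f at hf hμf ⊢
  have h1 : ∀ c, Measurable fun x : Torus => f (x, c) := fun c => hf.comp measurable_prodMk_right
  have hs : ∀ b, slice μ b = (volume : Measure Torus).withDensity fun x => 2⁻¹ * f (x, b) :=
    fun b => by rw [← slice_withDensity hf, hμf]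
  have hF : Measurable fun x : Torus => 2⁻¹ * f (x, true) + 2⁻¹ * f (x, false) :=
    ((h1 true).const_mul _).add ((h1 false).const_mul _)
  have hρ : μ.map Prod.fst = (volume : Measure Torus).withDensity
      fun x => 2⁻¹ * f (x, true) + 2⁻¹ * f (x, false) := by
    rw [map_fst_eq_slice_add, hs, hs]
    exact (withDensity_add_left ((h1 true).const_mul _) _).symm
  have hfin : ∀ b, ∫⁻ x : Torus, 2⁻¹ * f (x, b) ≠ ∞ := fun b => by
    rw [← setLIntegral_univ, ← withDensity_apply _ MeasurableSet.univ, ← hs]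
    exact measure_ne_top _ _
  have hae : ∀ b, ∀ᵐ x : Torus, 2⁻¹ * f (x, b) < ∞ := fun b =>
    ae_lt_top ((h1 b).const_mul _) (hfin b)
  have hθF : (fun x : Torus => 2⁻¹ * f (x, true)) =ᵐ[volume]
      fun x => (2⁻¹ * f (x, true) + 2⁻¹ * f (x, false)) * θ x := by
    have ha : Measurable fun x : Torus => 2⁻¹ * f (x, true) := (h1 true).const_mul _
    have hb : Measurable fun x : Torus => (2⁻¹ * f (x, true) + 2⁻¹ * f (x, false)) * θ x :=
      hF.mul hθ
    have hc : (volume : Measure Torus).withDensity (fun x => 2⁻¹ * f (x, true))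
        = (volume : Measure Torus).withDensity
          fun x => (2⁻¹ * f (x, true) + 2⁻¹ * f (x, false)) * θ x := by
      rw [← hs, h, hρ]
      exact (withDensity_mul _ hF hθ).symm
    exact (withDensity_eq_iff ha.aemeasurable hb.aemeasurable (hfin true)).1 hc
  have hm : Measurable fun x => ENNReal.ofReal (|V * (2 * (θ x).toReal - 1)| ^ 2) := by fun_prop
  have hg : Measurable fun z => ENNReal.ofReal ((√(f (rev z)).toReal - √(f z).toReal) ^ 2) := by
    have h2 : Measurable fun z => f (rev z) := hf.comp measurable_rev
    exact (((h2.ennreal_toReal.sqrt).sub hf.ennreal_toReal.sqrt).pow_const 2).ennreal_ofReal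
  have hg1 : Measurable fun x : Torus =>
      ENNReal.ofReal ((√(f (x, false)).toReal - √(f (x, true)).toReal) ^ 2) :=
    ((((h1 false).ennreal_toReal.sqrt).sub (h1 true).ennreal_toReal.sqrt).pow_const
      2).ennreal_ofReal
  rw [hρ, lintegral_withDensity_eq_lintegral_mul _ hF hm, lintegral_stat hg]
  have hsym : ∫⁻ x : Torus, ENNReal.ofReal ((√(f (rev (x, false))).toReal
      - √(f (x, false)).toReal) ^ 2)
      = ∫⁻ x : Torus, ENNReal.ofReal ((√(f (x, false)).toReal - √(f (x, true)).toReal) ^ 2) := by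
    refine lintegral_congr fun x => ?_
    congr 1
    change (√(f (x, true)).toReal - √(f (x, false)).toReal) ^ 2 = _
    ring
  have hsym' : ∫⁻ x : Torus, ENNReal.ofReal ((√(f (rev (x, true))).toReal
      - √(f (x, true)).toReal) ^ 2)
      = ∫⁻ x : Torus, ENNReal.ofReal ((√(f (x, false)).toReal - √(f (x, true)).toReal) ^ 2) :=
    lintegral_congr fun x => rfl
  rw [hsym, hsym', ← add_mul, ENNReal.inv_two_add_inv_two, one_mul, ← mul_assoc,
    ← lintegral_const_mul _ hg1]
  refine lintegral_mono_ae ?_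
  filter_upwards [hae true, hae false, hθF] with x hx1 hx2 hx3
  have hc : ENNReal.ofReal (2 * V ^ 2) * 2⁻¹ = ENNReal.ofReal (V ^ 2) := by
    rw [ENNReal.ofReal_mul two_pos.le, ENNReal.ofReal_ofNat, mul_comm, ← mul_assoc,
      ENNReal.inv_mul_cancel two_ne_zero ENNReal.ofNat_ne_top, one_mul]
  rw [hc, ← ENNReal.ofReal_mul (sq_nonneg V), Pi.mul_apply,
    ← ENNReal.ofReal_toReal (ENNReal.add_lt_top.2 ⟨hx1, hx2⟩).ne,
    ← ENNReal.ofReal_mul ENNReal.toReal_nonneg]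
  refine ENNReal.ofReal_le_ofReal ?_
  have hk := momentum_density_le (a := (f (x, true)).toReal) (b := (f (x, false)).toReal)
    (F := (2⁻¹ * f (x, true) + 2⁻¹ * f (x, false)).toReal) (θ := (θ x).toReal)
    ENNReal.toReal_nonneg ENNReal.toReal_nonneg
    (by rw [ENNReal.toReal_add hx1.ne hx2.ne]; simp; ring)
    (by rw [← ENNReal.toReal_mul, ← hx3]; simp; ring)
  have := mul_le_mul_of_nonneg_left hk (sq_nonneg V)
  rw [sq_abs]
  linarith

theorem abs_two_mul_sub_one_le {θ : ℝ≥0∞} (h : θ ≤ 1) : |2 * θ.toReal - 1| ≤ 1 := by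
  have h1 : θ.toReal ≤ 1 := by simpa using ENNReal.toReal_mono ENNReal.one_ne_top h
  have h2 : 0 ≤ θ.toReal := ENNReal.toReal_nonneg
  rw [abs_le]; constructor <;> linarith

/-- Momentum of a measure with density `θ` of the right-moving part with respect to the total
density. -/
theorem moment_apply_eq {V : ℝ} (hV : 0 ≤ V) (μ : Measure Phase) [IsFiniteMeasure μ]
    {θ : Torus → ℝ≥0∞} (hθ : Measurable θ) (hθ1 : ∀ x, θ x ≤ 1)
    (h : slice μ true = (μ.map Prod.fst).withDensity θ) {B : Set Torus} (hB : MeasurableSet B) :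
    moment V μ.toSignedMeasure B
      = ∫ x, B.indicator (fun x => V * (2 * (θ x).toReal - 1)) x ∂(μ.map Prod.fst) := by
  have hind : ∀ x, |B.indicator (fun _ => (1 : ℝ)) x| ≤ 1 := fun x => by
    by_cases hx : x ∈ B <;> simp [hx]
  have hindm : Measurable (B.indicator fun _ => (1 : ℝ)) := measurable_const.indicator hB
  have h1 : moment V μ.toSignedMeasure B = pair (B.indicator fun _ => 1) (moment V μ.toSignedMeasure) := by
    rw [pair_indicator hB, one_mul]
  rw [h1, pair_moment hV _ hindm hind, pair_toSignedMeasure]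
  have hsplit : ∫ z, vel V z.2 * B.indicator (fun _ => (1 : ℝ)) z.1 ∂μ
      = V * (2 * (slice μ true).real B - (μ.map Prod.fst).real B) := by
    have e1 : (fun z : Phase => vel V z.2 * B.indicator (fun _ => (1 : ℝ)) z.1)
        = fun z => (B ×ˢ {true} : Set Phase).indicator (fun _ => 2 * V) z
          - (Prod.fst ⁻¹' B : Set Phase).indicator (fun _ => V) z := by
      ext ⟨x, b⟩
      by_cases hx : x ∈ B <;> cases b <;> simp [hx, vel]; ring
    have hE : MeasurableSet (B ×ˢ {true} : Set Phase) := hB.prod (measurableSet_singleton true)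
    rw [e1, integral_sub ((integrable_const _).indicator hE)
      ((integrable_const _).indicator (measurable_fst hB)), integral_indicator_const _ hE,
      integral_indicator_const _ (measurable_fst hB), measureReal_def, measureReal_def,
      measureReal_def, measureReal_def, slice_apply _ _ hB, Measure.map_apply measurable_fst hB,
      smul_eq_mul, smul_eq_mul]
    ring
  have hθr : Measurable fun x => (θ x).toReal := hθ.ennreal_toReal
  have hθb : ∀ x, |(θ x).toReal| ≤ 1 := fun x => by
    rw [abs_of_nonneg ENNReal.toReal_nonneg]
    simpa using ENNReal.toReal_mono ENNReal.one_ne_top (hθ1 x)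
  have hint : Integrable (fun x => (θ x).toReal) (μ.map Prod.fst) :=
    integrable_of_bounded hθr hθb
  have hsl : (slice μ true).real B = ∫ x in B, (θ x).toReal ∂(μ.map Prod.fst) := by
    rw [integral_toReal hθ.aemeasurable (.of_forall fun x => (hθ1 x).trans_lt ENNReal.one_lt_top),
      measureReal_def, h, withDensity_apply _ hB]
  rw [hsplit, integral_indicator hB, integral_const_mul, integral_sub
    (hint.integrableOn.const_mul 2) (integrable_const _), integral_const_mul, hsl]
  simp

end Momentum

/-! ### Joint measurability in time and space, and the functional `G` -/

section Kernels

theorem measurable_restrict_measure {X : Type*} [MeasurableSpace X] {s : Set X}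
    (hs : MeasurableSet s) : Measurable fun μ : Measure X => μ.restrict s :=
  Measure.measurable_of_measurable_coe _ fun t ht => by
    simp_rw [Measure.restrict_apply ht]
    exact Measure.measurable_coe (ht.inter hs)

/-- Closed sets form a generating π-system, and the mass of a closed set is a pointwise limit of
integrals of continuous functions, each continuous along the curve. -/
theorem measurable_measure_of_continuous {X Y : Type*} [TopologicalSpace X] [MeasurableSpace X]
    [OpensMeasurableSpace X] [TopologicalSpace Y] [TopologicalSpace.PseudoMetrizableSpace Y]
    [MeasurableSpace Y] [BorelSpace Y] {s : X → ProbabilityMeasure Y} (hs : Continuous s) :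
    Measurable fun t => (s t : Measure Y) := by
  refine Measurable.measure_of_isPiSystem_of_isProbabilityMeasure
    ((BorelSpace.measurable_eq (α := Y)).trans borel_eq_generateFrom_isClosed)
    isPiSystem_isClosed ?_
  intro F hF
  have hF : IsClosed F := hF
  refine ENNReal.measurable_of_tendsto
    (f := fun n t => ∫⁻ y, hF.apprSeq n y ∂(s t : Measure Y)) (fun n => ?_)
    (tendsto_pi_nhds.2 fun t => HasOuterApproxClosed.tendsto_lintegral_apprSeq hF _)
  refine Continuous.measurable (continuous_iff_continuousAt.2 fun t => ?_)
  exact ProbabilityMeasure.tendsto_iff_forall_lintegral_tendsto.1 (hs.tendsto t) _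

variable {T : ℝ} {σ : ℝ → ProbabilityMeasure Phase}

theorem measurable_curve (hσ : ContinuousOn σ (Icc 0 T)) :
    Measurable fun t : Ioo (0 : ℝ) T => (σ t : Measure Phase) :=
  measurable_measure_of_continuous (hσ.mono Ioo_subset_Icc_self).domRestrict

/-- The kernel of the total spatial densities along a curve. -/
noncomputable def densityKernel (hσ : ContinuousOn σ (Icc 0 T)) : Kernel (Ioo (0 : ℝ) T) Torus where
  toFun t := (σ t : Measure Phase).map Prod.fst
  measurable' := (Measure.measurable_map _ measurable_fst).comp (measurable_curve hσ)

/-- The kernel of the densities of the right-moving part along a curve. -/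
noncomputable def sliceKernel (hσ : ContinuousOn σ (Icc 0 T)) : Kernel (Ioo (0 : ℝ) T) Torus where
  toFun t := slice (σ t : Measure Phase) true
  measurable' := (Measure.measurable_map _ measurable_fst).comp
    ((measurable_restrict_measure (measurableSet_snd true)).comp (measurable_curve hσ))

theorem densityKernel_apply (hσ : ContinuousOn σ (Icc 0 T)) (t : Ioo (0 : ℝ) T) :
    densityKernel hσ t = (σ t : Measure Phase).map Prod.fst := rfl

theorem sliceKernel_apply (hσ : ContinuousOn σ (Icc 0 T)) (t : Ioo (0 : ℝ) T) :
    sliceKernel hσ t = slice (σ t : Measure Phase) true := rfl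

instance isMarkovKernel_densityKernel (hσ : ContinuousOn σ (Icc 0 T)) :
    IsMarkovKernel (densityKernel hσ) :=
  ⟨fun _ => by
    rw [densityKernel_apply]
    exact Measure.isProbabilityMeasure_map measurable_fst.aemeasurable⟩

theorem slice_le_map_fst (μ : Measure Phase) : slice μ true ≤ μ.map Prod.fst := by
  rw [map_fst_eq_slice_add]
  exact Measure.le_add_right le_rfl

instance isFiniteKernel_sliceKernel (hσ : ContinuousOn σ (Icc 0 T)) :
    IsFiniteKernel (sliceKernel hσ) :=
  isFiniteKernel_of_le (ν := densityKernel hσ) fun _ => slice_le_map_fst _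

/-- The fraction of right-movers must be jointly measurable in time and space to serve as a density
in space-time; the Radon-Nikodym derivative of kernels provides this. Truncation at one turns an
almost everywhere bound into an everywhere bound. -/
theorem exists_slice_density (hσ : ContinuousOn σ (Icc 0 T)) :
    ∃ θ : Ioo (0 : ℝ) T × Torus → ℝ≥0∞, Measurable θ ∧ (∀ p, θ p ≤ 1) ∧
      ∀ t : Ioo (0 : ℝ) T, slice (σ t : Measure Phase) true
        = ((σ t : Measure Phase).map Prod.fst).withDensity fun x => θ (t, x) := by
  refine ⟨fun p => min ((sliceKernel hσ).rnDeriv (densityKernel hσ) p.1 p.2) 1,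
    (Kernel.measurable_rnDeriv _ _).min measurable_const, fun p => min_le_right _ _, fun t => ?_⟩
  have h1 := Kernel.rnDeriv_eq_rnDeriv_measure (κ := sliceKernel hσ) (η := densityKernel hσ) (a := t)
  have hle : sliceKernel hσ t ≤ densityKernel hσ t := slice_le_map_fst _
  have h2 := Measure.rnDeriv_le_one_of_le hle
  have h3 := Measure.withDensity_rnDeriv_eq _ _ (Measure.absolutelyContinuous_of_le hle)
  rw [← sliceKernel_apply hσ, ← densityKernel_apply hσ]
  refine h3.symm.trans (withDensity_congr_ae ?_)
  filter_upwards [h1, h2] with x hx1 hx2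
  exact (min_eq_left (hx1.trans_le hx2)).symm ▸ hx1.symm

theorem spaceTimeDensity_eq (hσ : ContinuousOn σ (Icc 0 T)) :
    spaceTimeDensity T (fun t => density (σ t)) = leb T ⊗ₘ densityKernel hσ := by
  ext E hE
  have hm : Measurable fun t : Ioo (0 : ℝ) T => (density (σ t) : Measure Torus).map (Prod.mk t) := by
    refine Measure.measurable_of_measurable_coe _ fun s hs => ?_
    have := Kernel.measurable_kernel_prodMk_left (κ := densityKernel hσ) hs
    convert this using 2 with t
    rw [Measure.map_apply measurable_prodMk_left hs]
    rfl
  rw [spaceTimeDensity, Measure.bind_apply hE hm.aemeasurable, Measure.compProd_apply hE]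
  refine lintegral_congr fun t => ?_
  rw [Measure.map_apply measurable_prodMk_left hE]
  rfl

/-- Guarantees that `spaceTime` of the momentum is the intended measure and not its default value
zero. The total variation is at most V at each time. -/
theorem isFluxFamily_moment {V : ℝ} (hV : 0 ≤ V) (hσ : ContinuousOn σ (Icc 0 T)) :
    IsFluxFamily T fun t => moment V (toSigned (σ t)) := by
  obtain ⟨θ, hθ, hθ1, hs⟩ := exists_slice_density hσ
  have hm : ∀ B, MeasurableSet B → ∀ t : Ioo (0 : ℝ) T, moment V (toSigned (σ t)) B
      = ∫ x, B.indicator (fun x => V * (2 * (θ (t, x)).toReal - 1)) x ∂(densityKernel hσ t) :=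
    fun B hB t => moment_apply_eq hV _ (hθ.comp measurable_prodMk_left) (fun x => hθ1 _) (hs t) hB
  constructor
  · intro B hB
    simp only [hm B hB]
    have hf : Measurable fun p : Ioo (0 : ℝ) T × Torus =>
        B.indicator (fun x => V * (2 * (θ (p.1, x)).toReal - 1)) p.2 := by
      have : (fun p : Ioo (0 : ℝ) T × Torus =>
          B.indicator (fun x => V * (2 * (θ (p.1, x)).toReal - 1)) p.2)
          = (Prod.snd ⁻¹' B).indicator fun p => V * (2 * (θ p).toReal - 1) := by
        ext p
        by_cases hp : p.2 ∈ B <;> simp [hp]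
      rw [this]
      exact (by fun_prop : Measurable fun p => V * (2 * (θ p).toReal - 1)).indicator
        (measurable_snd hB)
    exact (StronglyMeasurable.integral_kernel_prod_right (κ := densityKernel hσ)
      (f := fun t x => B.indicator (fun x => V * (2 * (θ (t, x)).toReal - 1)) x)
      hf.stronglyMeasurable).measurable
  · have hvar : ∀ t : Ioo (0 : ℝ) T, (moment V (toSigned (σ t))).variation univ
        ≤ ENNReal.ofReal V := fun t => by
      have : (moment V (toSigned (σ t))).variation
          ≤ ENNReal.ofReal V • (densityKernel hσ t) := by
        refine VectorMeasure.variation_le_of_forall_enorm_le fun B hB => ?_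
        rw [hm B hB t, integral_indicator hB, Measure.smul_apply, smul_eq_mul]
        have hb := norm_setIntegral_le_of_norm_le_const (μ := densityKernel hσ t) (s := B) (C := V)
          (f := fun x => V * (2 * (θ (t, x)).toReal - 1)) (measure_lt_top _ _) fun x _ => by
            rw [Real.norm_eq_abs, abs_mul, abs_of_nonneg hV]
            exact mul_le_of_le_one_right hV (abs_two_mul_sub_one_le (hθ1 _))
        rw [← ofReal_norm]
        refine (ENNReal.ofReal_le_ofReal hb).trans ?_
        rw [ENNReal.ofReal_mul hV, ofReal_measureReal]
      refine (this univ).trans ?_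
      simp
    refine (lintegral_mono hvar).trans_lt ?_
    rw [lintegral_const]
    exact ENNReal.mul_lt_top ENNReal.ofReal_lt_top (measure_lt_top _ _)

theorem G_le {V : ℝ} (hV : 0 < V) (hσ : ContinuousOn σ (Icc 0 T)) (t : ℝ) :
    G t (spaceTimeDensity T fun t => density (σ t))
      (spaceTime T fun t => moment V (toSigned (σ t)))
      ≤ ENNReal.ofReal (2 * V ^ 2) * ∫⁻ r in Ioo 0 t, fisher (σ r : Measure Phase) := by
  obtain ⟨θ, hθ, hθ1, hs⟩ := exists_slice_density hσ
  rw [spaceTimeDensity_eq hσ]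
  set P := leb T ⊗ₘ densityKernel hσ with hP
  set h : Ioo (0 : ℝ) T × Torus → ℝ := fun p => V * (2 * (θ p).toReal - 1) with hh
  have hhm : Measurable h := by fun_prop
  have hhb : ∀ p, |h p| ≤ V := fun p => by
    rw [hh, abs_mul, abs_of_nonneg hV.le]
    exact mul_le_of_le_one_right hV.le (abs_two_mul_sub_one_le (hθ1 _))
  have hhi : Integrable h P := integrable_of_bounded hhm hhb
  have hflux := isFluxFamily_moment hV.le hσ
  have hω : spaceTime T (fun t => moment V (toSigned (σ t))) = P.withDensityᵥ h := by
    ext E hE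
    rw [spaceTime_apply hflux hE, withDensityᵥ_apply hhi hE, ← integral_indicator hE, hP,
      Measure.integral_compProd (hhi.indicator hE)]
    refine integral_congr_ae (.of_forall fun t => ?_)
    exact moment_apply_eq hV.le _ (hθ.comp measurable_prodMk_left) (fun x => hθ1 _) (hs t)
      (measurable_prodMk_left hE)
  rw [hω, G, if_pos (Measure.withDensityᵥ_absolutelyContinuous P h)]
  -- Uniqueness of the Lebesgue decomposition with singular part zero; it replaces the abstract
  -- derivative in `G` by the explicit density.
  have hrn : h =ᵐ[P] SignedMeasure.rnDeriv (P.withDensityᵥ h) P :=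
    SignedMeasure.eq_rnDeriv 0 h hhi VectorMeasure.MutuallySingular.zero_left (by simp)
  have hEm : MeasurableSet {p : Ioo (0 : ℝ) T × Torus | (p.1 : ℝ) ≤ t} :=
    measurableSet_le (measurable_subtype_coe.comp measurable_fst) measurable_const
  rw [← lintegral_indicator hEm]
  have hq : Measurable fun p => ENNReal.ofReal (|h p| ^ 2) := by fun_prop
  calc ∫⁻ p, {p : Ioo (0 : ℝ) T × Torus | (p.1 : ℝ) ≤ t}.indicator
        (fun p => ENNReal.ofReal (|SignedMeasure.rnDeriv (P.withDensityᵥ h) P p| ^ 2)) p ∂P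
      = ∫⁻ p, {p : Ioo (0 : ℝ) T × Torus | (p.1 : ℝ) ≤ t}.indicator
        (fun p => ENNReal.ofReal (|h p| ^ 2)) p ∂P := by
        refine lintegral_congr_ae ?_
        filter_upwards [hrn] with p hp
        by_cases hpt : (p.1 : ℝ) ≤ t <;> simp [hpt, hp]
    _ = ∫⁻ r, ∫⁻ x, {p : Ioo (0 : ℝ) T × Torus | (p.1 : ℝ) ≤ t}.indicator
        (fun p => ENNReal.ofReal (|h p| ^ 2)) (r, x) ∂(densityKernel hσ r) ∂(leb T) := by
        rw [hP, Measure.lintegral_compProd (hq.indicator hEm)]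
    _ ≤ ∫⁻ r : Ioo (0 : ℝ) T, (Iic t).indicator
        (fun r => ENNReal.ofReal (2 * V ^ 2) * fisher (σ r : Measure Phase)) (r : ℝ) ∂(leb T) := by
        refine lintegral_mono fun r => ?_
        by_cases hr : (r : ℝ) ≤ t
        · have e : ∀ x, {p : Ioo (0 : ℝ) T × Torus | (p.1 : ℝ) ≤ t}.indicator
              (fun p => ENNReal.ofReal (|h p| ^ 2)) (r, x) = ENNReal.ofReal (|h (r, x)| ^ 2) :=
            fun x => indicator_of_mem (by exact hr) _
          simp only [e]
          rw [indicator_of_mem (by exact hr)]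
          exact lintegral_momentum_le hV _ (hθ.comp measurable_prodMk_left) (hs r)
        · have e : ∀ x, {p : Ioo (0 : ℝ) T × Torus | (p.1 : ℝ) ≤ t}.indicator
              (fun p => ENNReal.ofReal (|h p| ^ 2)) (r, x) = 0 :=
            fun x => indicator_of_notMem (by exact hr) _
          rw [lintegral_congr e, lintegral_zero]
          exact zero_le
    _ = ∫⁻ r in Ioo 0 T, (Iic t).indicator
        (fun r => ENNReal.ofReal (2 * V ^ 2) * fisher (σ r : Measure Phase)) r := lintegral_leb T _
    _ ≤ ∫⁻ r in Ioc 0 t, ENNReal.ofReal (2 * V ^ 2) * fisher (σ r : Measure Phase) := by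
        rw [lintegral_indicator measurableSet_Iic, Measure.restrict_restrict measurableSet_Iic]
        exact lintegral_mono_set fun r hr => ⟨hr.2.1, hr.1⟩
    _ = _ := by
        rw [← restrict_Ioo_eq_restrict_Ioc, lintegral_const_mul' _ _ ENNReal.ofReal_ne_top]

/-- Data processing for the projection to the torus, which sends π to Lebesgue measure. -/
theorem ent_density_le (μ : ProbabilityMeasure Phase) :
    ent (density μ : Measure Torus) volume ≤ ent (μ : Measure Phase) stat := by
  have := InformationTheory.klDiv_map_le (μ := (μ : Measure Phase)) (ν := stat) measurable_fst
  rwa [map_fst_stat] at this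

theorem ent_density_add_G_le {V lam : ℝ} (hV : 0 < V) (hlam : 0 ≤ lam)
    (hσ : ContinuousOn σ (Icc 0 T)) (t : ℝ) :
    2⁻¹ * ent (density (σ t) : Measure Torus) volume + ENNReal.ofReal (lam / (2 * V ^ 2))
        * G t (spaceTimeDensity T fun t => density (σ t))
          (spaceTime T fun t => moment V (toSigned (σ t)))
      ≤ 2⁻¹ * ent (σ t : Measure Phase) stat
        + ENNReal.ofReal lam * ∫⁻ r in Ioo 0 t, fisher (σ r : Measure Phase) := by
  refine add_le_add (mul_le_mul_right (ent_density_le _) _) ?_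
  refine (mul_le_mul_right (G_le hV hσ t) _).trans_eq ?_
  rw [← mul_assoc, ← ENNReal.ofReal_mul (by positivity)]
  congr 2
  field_simp

end Kernels

end KacFC

namespace KacFC

/-! ### Free transport of a measure -/

section Transport

/-- The image of a measure under the free flow. -/
noncomputable def transport (V : ℝ) (μ : ProbabilityMeasure Phase) (t : ℝ) :
    ProbabilityMeasure Phase := μ.map (measurable_flow V t).aemeasurable

/-- The transport derivative `v ∂ₓφ`. -/
noncomputable def velDeriv (V : ℝ) (φ : Phase → ℝ) (z : Phase) : ℝ :=
  vel V z.2 * dx (fun x => φ (x, z.2)) z.1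

theorem integral_transport (V : ℝ) (μ : ProbabilityMeasure Phase) (t : ℝ) {f : Phase → ℝ}
    (hf : Measurable f) :
    ∫ z, f z ∂(transport V μ t : Measure Phase) = ∫ z, f (flow V t z) ∂(μ : Measure Phase) :=
  integral_map (measurable_flow V t).aemeasurable hf.aestronglyMeasurable

theorem transport_zero (V : ℝ) (μ : ProbabilityMeasure Phase) : transport V μ 0 = μ := by
  have h : flow V 0 = id := funext fun z => flow_zero V z
  refine Subtype.ext ?_
  change (μ : Measure Phase).map (flow V 0) = μ
  rw [h, Measure.map_id]

theorem continuous_of_isC1_slices {φ : Phase → ℝ} (hφ : ∀ b, IsC1 fun x => φ (x, b)) :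
    Continuous φ := continuous_phase_iff.2 fun b => continuous_of_isC1 (hφ b)

theorem continuous_dx_slices {φ : Phase → ℝ} (hφ : ∀ b, IsC1 fun x => φ (x, b)) :
    Continuous fun z : Phase => dx (fun x => φ (x, z.2)) z.1 :=
  continuous_phase_iff.2 fun b => continuous_dx (hφ b)

theorem continuous_velDeriv (V : ℝ) {φ : Phase → ℝ} (hφ : ∀ b, IsC1 fun x => φ (x, b)) :
    Continuous (velDeriv V φ) := (continuous_vel V).mul (continuous_dx_slices hφ)

theorem hasDerivAt_comp_flow (V : ℝ) {φ : Phase → ℝ} (hφ : ∀ b, IsC1 fun x => φ (x, b))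
    (z : Phase) (h : ℝ) :
    HasDerivAt (fun h : ℝ => φ (flow V h z)) (velDeriv V φ (flow V h z)) h := by
  obtain ⟨x, b⟩ := z
  have h2 := hasDerivAt_of_isC1 (hφ b) x (vel V b * h)
  have h3 : HasDerivAt (fun h : ℝ => vel V b * h) (vel V b) h := by
    simpa using (hasDerivAt_id h).const_mul (vel V b)
  have := HasDerivAt.comp h h2 h3
  rw [mul_comm] at this
  exact this

theorem hasDerivAt_integral_transport (V : ℝ) (μ : ProbabilityMeasure Phase) {φ : Phase → ℝ}
    (hφ : ∀ b, IsC1 fun x => φ (x, b)) (t : ℝ) :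
    HasDerivAt (fun t => ∫ z, φ z ∂(transport V μ t : Measure Phase))
      (∫ z, velDeriv V φ z ∂(transport V μ t : Measure Phase)) t := by
  have hc := continuous_of_isC1_slices hφ
  have hd := continuous_velDeriv V hφ
  obtain ⟨c, hcb⟩ := exists_abs_le_of_continuous hd
  have key := hasDerivAt_integral_of_dominated_loc_of_deriv_le (μ := (μ : Measure Phase)) (𝕜 := ℝ)
    (F := fun h z => φ (flow V h z)) (F' := fun h z => velDeriv V φ (flow V h z)) (x₀ := t)
    (s := univ) (bound := fun _ => c) univ_mem
    (.of_forall fun h => (hc.comp (continuous_flow V h)).aestronglyMeasurable)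
    (integrable_of_continuous (hc.comp (continuous_flow V t)) _)
    (hd.comp (continuous_flow V t)).aestronglyMeasurable
    (.of_forall fun z h _ => hcb _) (integrable_const _)
    (.of_forall fun z h _ => hasDerivAt_comp_flow V hφ z h)
  rw [integral_transport V μ t hd.measurable]
  simp only [integral_transport V μ _ hc.measurable]
  exact key.2

theorem continuous_integral_transport (V : ℝ) (μ : ProbabilityMeasure Phase) {φ : Phase → ℝ}
    (hφ : Continuous φ) : Continuous fun t => ∫ z, φ z ∂(transport V μ t : Measure Phase) := by
  obtain ⟨c, hc⟩ := exists_abs_le_of_continuous hφ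
  simp only [integral_transport V μ _ hφ.measurable]
  refine continuous_of_dominated (bound := fun _ => c)
    (fun t => (hφ.comp (continuous_flow V t)).aestronglyMeasurable)
    (fun t => .of_forall fun z => hc _) (integrable_const _) (.of_forall fun z => ?_)
  exact hφ.comp ((continuous_flow₂ V).comp (continuous_id.prodMk continuous_const))

theorem continuous_transport (V : ℝ) (μ : ProbabilityMeasure Phase) :
    Continuous (transport V μ) :=
  continuous_iff_continuousAt.2 fun t =>
    ProbabilityMeasure.tendsto_iff_forall_integral_tendsto.2 fun f =>
      (continuous_integral_transport V μ f.continuous).tendsto t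

theorem integral_transport_sub (V : ℝ) (μ : ProbabilityMeasure Phase) {φ : Phase → ℝ}
    (hφ : ∀ b, IsC1 fun x => φ (x, b)) (s t : ℝ) :
    ∫ z, φ z ∂(transport V μ t : Measure Phase) - ∫ z, φ z ∂(transport V μ s : Measure Phase)
      = ∫ r in s..t, ∫ z, velDeriv V φ z ∂(transport V μ r : Measure Phase) :=
  (intervalIntegral.integral_eq_sub_of_hasDerivAt
    (fun r _ => hasDerivAt_integral_transport V μ hφ r)
    ((continuous_integral_transport V μ (continuous_velDeriv V hφ)).intervalIntegrable _ _)).symm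

end Transport

/-! ### Gronwall's inequality in integral form -/

section Gronwall

theorem le_mul_exp_of_le_integral {h : ℝ → ℝ} {ε K T : ℝ} (hc : ContinuousOn h (Icc 0 T))
    (hT : 0 ≤ T) (hK : 0 ≤ K) (hle : ∀ t ∈ Icc 0 T, h t ≤ ε + K * ∫ r in 0..t, h r)
    {t : ℝ} (ht : t ∈ Icc 0 T) : h t ≤ ε * Real.exp (K * t) := by
  -- A continuous extension to the line makes the primitive differentiable at the endpoints as well.
  -- The majorant ε + K ∫ g then satisfies the differential form of the inequality.
  set g : ℝ → ℝ := IccExtend hT ((Icc 0 T).domRestrict h) with hg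
  have hgc : Continuous g := (continuousOn_iff_continuous_domRestrict.1 hc).Icc_extend'
  have hgh : ∀ s ∈ Icc 0 T, g s = h s := fun s hs => by
    rw [hg, IccExtend_of_mem hT _ hs]; rfl
  have hint : ∀ s ∈ Icc 0 T, ∫ r in 0..s, h r = ∫ r in 0..s, g r := fun s hs =>
    intervalIntegral.integral_congr fun r hr => by
      rw [uIcc_of_le hs.1] at hr
      exact (hgh r ⟨hr.1, hr.2.trans hs.2⟩).symm
  have hW : ∀ s, HasDerivAt (fun s => ε + K * ∫ r in 0..s, g r) (K * g s) s := fun s =>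
    ((hgc.integral_hasStrictDerivAt 0 s).hasDerivAt.const_mul K).const_add ε
  have key := le_gronwallBound_of_liminf_deriv_right_le (f := fun s => ε + K * ∫ r in 0..s, g r)
    (f' := fun s => K * g s) (δ := ε) (K := K) (ε := 0) (a := 0) (b := T)
    (fun s _ => (hW s).continuousAt.continuousWithinAt)
    (fun s _ r hr => (hW s).hasDerivWithinAt.liminf_right_slope_le hr) (by simp)
    (fun s hs => by
      have hs' : s ∈ Icc 0 T := ⟨hs.1, hs.2.le⟩
      have := hle s hs'
      rw [hint s hs', ← hgh s hs'] at this
      simpa using mul_le_mul_of_nonneg_left this hK) t ht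
  rw [gronwallBound_ε0, sub_zero] at key
  exact ((hle t ht).trans_eq (by rw [hint t ht])).trans key

end Gronwall

/-! ### Vanishing fluxes and approximate free transport -/

/-- A sequence of solutions of the continuity equation with vanishing jump rates and uniformly
bounded rate functional. -/
structure IsRateBounded (V T R : ℝ) (lam : ℕ → ℝ) (σ : ℕ → ℝ → ProbabilityMeasure Phase)
    (j₁ j₂ : ℕ → ℝ → SignedMeasure Phase) : Prop where
  time_nonneg : 0 ≤ T
  bound_nonneg : 0 ≤ R
  lam_pos : ∀ n, 0 < lam n
  lam_tendsto : Tendsto lam atTop (𝓝 0)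
  ce : ∀ n, IsCE T (σ n) (j₁ n) (j₂ n)
  rate_le : ∀ n, ∫⁻ r in Ioo 0 T, lagrangian V (lam n) (σ n r) (j₁ n r) (j₂ n r) ≤ ENNReal.ofReal R

namespace IsRateBounded

variable {V T R : ℝ} {lam : ℕ → ℝ} {σ : ℕ → ℝ → ProbabilityMeasure Phase}
  {j₁ j₂ : ℕ → ℝ → SignedMeasure Phase}

theorem comp_subseq (h : IsRateBounded V T R lam σ j₁ j₂) {k : ℕ → ℕ} (hk : StrictMono k) :
    IsRateBounded V T R (lam ∘ k) (σ ∘ k) (j₁ ∘ k) (j₂ ∘ k) where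
  time_nonneg := h.time_nonneg
  bound_nonneg := h.bound_nonneg
  lam_pos := fun _ => h.lam_pos _
  lam_tendsto := h.lam_tendsto.comp hk.tendsto_atTop
  ce := fun _ => h.ce _
  rate_le := fun _ => h.rate_le _

/-- The order of choices: first M with `M * ε = R + 1`, leaving a margin of one over R, then n so
large that the exponential cost, multiplied by `lam n → 0`, fits into the margin. -/
theorem exists_eventually_le (h : IsRateBounded V T R lam σ j₁ j₂) (B : ℝ) {ε : ℝ} (hε : 0 < ε) :
    ∃ M, 0 < M ∧ ∀ᶠ n in atTop, R + T * (lam n * Real.exp (M * B)) ≤ M * ε := by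
  have hR := h.bound_nonneg
  refine ⟨(R + 1) / ε, by positivity, ?_⟩
  have h1 : Tendsto (fun n => R + T * (lam n * Real.exp ((R + 1) / ε * B))) atTop
      (𝓝 (R + T * (0 * Real.exp ((R + 1) / ε * B)))) :=
    ((h.lam_tendsto.mul_const _).const_mul T).const_add R
  have h2 : R + T * (0 * Real.exp ((R + 1) / ε * B)) < (R + 1) / ε * ε := by
    rw [div_mul_cancel₀ _ hε.ne']
    linarith
  exact (h1.eventually_lt_const h2).mono fun n hn => hn.le

theorem eventually_lintegral_flux_le (h : IsRateBounded V T R lam σ j₁ j₂) (χ₁ χ₂ : C(Phase, ℝ))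
    {ε : ℝ} (hε : 0 < ε) :
    ∀ᶠ n in atTop, ∫⁻ r in Ioo 0 T, ENNReal.ofReal |pair χ₁ (j₁ n r)
        - ∫ z, vel V z.2 * χ₁ z ∂(σ n r : Measure Phase) + pair χ₂ (j₂ n r)|
      ≤ ENNReal.ofReal ε := by
  obtain ⟨M, hM, hn⟩ := h.exists_eventually_le ‖χ₂‖ hε
  filter_upwards [hn] with n hn
  have h1 := (lintegral_flux_le (V := V) (T := T) (σ := σ n) (j₁ := j₁ n) (j₂ := j₂ n)
    (h.lam_pos n) χ₁ χ₂ hM χ₂.norm_coe_le_norm).trans (add_le_add_left (h.rate_le n) _)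
  have h2 : 0 ≤ lam n * Real.exp (M * ‖χ₂‖) := mul_nonneg (h.lam_pos n).le (Real.exp_pos _).le
  rw [← ENNReal.ofReal_mul h.time_nonneg, ← ENNReal.ofReal_add h.bound_nonneg
    (mul_nonneg h.time_nonneg h2)] at h1
  have h3 := h1.trans (ENNReal.ofReal_le_ofReal hn)
  rw [ENNReal.ofReal_mul hM.le] at h3
  exact (ENNReal.mul_le_mul_iff_right (by simpa using hM) ENNReal.ofReal_ne_top).1 h3

/-- By the continuity equation the deviation from free transport is the time integral of the flux
defect tested with ∂ₓφ and φ ∘ ι - φ. Its L¹ norm over the whole of (0, T) bounds the deviation at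
all times at once. -/
theorem eventually_abs_increment_le (h : IsRateBounded V T R lam σ j₁ j₂) {φ : Phase → ℝ}
    (hφ : ∀ b, IsC1 fun x => φ (x, b)) {ε : ℝ} (hε : 0 < ε) :
    ∀ᶠ n in atTop, ∀ t ∈ Icc 0 T,
      |∫ z, φ z ∂(σ n t : Measure Phase) - ∫ z, φ z ∂(σ n 0 : Measure Phase)
        - ∫ r in 0..t, ∫ z, velDeriv V φ z ∂(σ n r : Measure Phase)| ≤ ε := by
  have hc := continuous_of_isC1_slices hφ
  let χ₁ : C(Phase, ℝ) := ⟨_, continuous_dx_slices hφ⟩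
  let χ₂ : C(Phase, ℝ) := ⟨fun z => φ (rev z) - φ z, (hc.comp continuous_rev).sub hc⟩
  filter_upwards [h.eventually_lintegral_flux_le χ₁ χ₂ hε] with n hn t ht
  have hCE := h.ce n
  set F : ℝ → ℝ := fun r => pair χ₁ (j₁ n r)
    - ∫ z, vel V z.2 * χ₁ z ∂(σ n r : Measure Phase) + pair χ₂ (j₂ n r) with hF
  have hi1 := intervalIntegrable_pair hCE.flux₁ χ₁.continuous le_rfl ht.1 ht.2
  have hi2 := intervalIntegrable_pair hCE.flux₂ χ₂.continuous le_rfl ht.1 ht.2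
  have hi3 := intervalIntegrable_of_continuousOn (continuousOn_integral hCE.continuousOn
    (continuous_velDeriv V hφ)) le_rfl ht.1 ht.2
  have hFi : IntervalIntegrable F volume 0 t := (hi1.sub hi3).add hi2
  have e : ∫ z, φ z ∂(σ n t : Measure Phase) - ∫ z, φ z ∂(σ n 0 : Measure Phase)
      - ∫ r in 0..t, ∫ z, velDeriv V φ z ∂(σ n r : Measure Phase) = ∫ r in 0..t, F r := by
    rw [hCE.eq φ hφ 0 t le_rfl ht.1 ht.2]
    refine (intervalIntegral.integral_sub (hi1.add hi2) hi3).symm.trans ?_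
    refine intervalIntegral.integral_congr fun r _ => ?_
    change pair χ₁ (j₁ n r) + pair χ₂ (j₂ n r) - ∫ z, vel V z.2 * χ₁ z ∂(σ n r : Measure Phase) = _
    rw [hF]
    ring
  rw [e]
  refine (intervalIntegral.abs_integral_le_integral_abs ht.1).trans ?_
  rw [intervalIntegral.integral_of_le ht.1, ← restrict_Ioo_eq_restrict_Ioc,
    integral_eq_lintegral_of_nonneg_ae (.of_forall fun r => abs_nonneg _)]
  · refine ENNReal.toReal_le_of_le_ofReal hε.le ?_
    exact (lintegral_mono_set (Ioo_subset_Ioo_right ht.2)).trans hn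
  · exact (((intervalIntegrable_iff_integrableOn_Ioo_of_le ht.1).1 hFi).aestronglyMeasurable).norm

/-- Uniform convergence to free transport for a pair of test functions that the free flow
rotates into each other. -/
theorem eventually_abs_sub_transport_le_of_rotation (h : IsRateBounded V T R lam σ j₁ j₂)
    {μ : ProbabilityMeasure Phase} (hμ : Tendsto (fun n => σ n 0) atTop (𝓝 μ))
    {φ₁ φ₂ : Phase → ℝ} (hφ₁ : ∀ b, IsC1 fun x => φ₁ (x, b)) (hφ₂ : ∀ b, IsC1 fun x => φ₂ (x, b))
    {κ : ℝ} (h₁ : ∀ z, velDeriv V φ₁ z = -κ * φ₂ z) (h₂ : ∀ z, velDeriv V φ₂ z = κ * φ₁ z)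
    {ε : ℝ} (hε : 0 < ε) :
    ∀ᶠ n in atTop, ∀ t ∈ Icc 0 T,
      |∫ z, φ₁ z ∂(σ n t : Measure Phase) - ∫ z, φ₁ z ∂(transport V μ t : Measure Phase)|
      + |∫ z, φ₂ z ∂(σ n t : Measure Phase) - ∫ z, φ₂ z ∂(transport V μ t : Measure Phase)|
        ≤ ε := by
  -- For each of the two functions there is one error `δ` in the initial datum and one in the
  -- increment, so Gronwall starts from `4 * δ` and gains the factor `Real.exp (|κ| * T)`.
  set δ := ε / (4 * Real.exp (|κ| * T)) with hδ
  have hδ0 : 0 < δ := by positivity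
  have hc₁ := continuous_of_isC1_slices hφ₁
  have hc₂ := continuous_of_isC1_slices hφ₂
  have hini : ∀ φ : Phase → ℝ, Continuous φ → ∀ᶠ n in atTop,
      |∫ z, φ z ∂(σ n 0 : Measure Phase) - ∫ z, φ z ∂(μ : Measure Phase)| ≤ δ := fun φ hφ => by
    have h1 := ProbabilityMeasure.tendsto_iff_forall_integral_tendsto.1 hμ
      (BoundedContinuousFunction.mkOfCompact ⟨φ, hφ⟩)
    filter_upwards [Metric.tendsto_nhds.1 h1 δ hδ0] with n hn
    rw [Real.dist_eq] at hn
    exact hn.le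
  filter_upwards [h.eventually_abs_increment_le hφ₁ hδ0, h.eventually_abs_increment_le hφ₂ hδ0,
    hini φ₁ hc₁, hini φ₂ hc₂] with n e₁ e₂ i₁ i₂ t ht
  have hσ := (h.ce n).continuousOn
  set A₁ : ℝ → ℝ := fun t => ∫ z, φ₁ z ∂(σ n t : Measure Phase)
    - ∫ z, φ₁ z ∂(transport V μ t : Measure Phase) with hA₁
  set A₂ : ℝ → ℝ := fun t => ∫ z, φ₂ z ∂(σ n t : Measure Phase)
    - ∫ z, φ₂ z ∂(transport V μ t : Measure Phase) with hA₂
  have hA₁c : ContinuousOn A₁ (Icc 0 T) := (continuousOn_integral hσ hc₁).sub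
    (continuous_integral_transport V μ hc₁).continuousOn
  have hA₂c : ContinuousOn A₂ (Icc 0 T) := (continuousOn_integral hσ hc₂).sub
    (continuous_integral_transport V μ hc₂).continuousOn
  have step : ∀ φ ψ : Phase → ℝ, ∀ c : ℝ, |c| = |κ| → (∀ b, IsC1 fun x => φ (x, b)) →
      Continuous ψ → (∀ z, velDeriv V φ z = c * ψ z) →
      |∫ z, φ z ∂(σ n 0 : Measure Phase) - ∫ z, φ z ∂(μ : Measure Phase)| ≤ δ →
      (∀ t ∈ Icc 0 T, |∫ z, φ z ∂(σ n t : Measure Phase) - ∫ z, φ z ∂(σ n 0 : Measure Phase)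
        - ∫ r in 0..t, ∫ z, velDeriv V φ z ∂(σ n r : Measure Phase)| ≤ δ) →
      ∀ t ∈ Icc 0 T, |∫ z, φ z ∂(σ n t : Measure Phase)
        - ∫ z, φ z ∂(transport V μ t : Measure Phase)| ≤ 2 * δ + |κ| * ∫ r in 0..t,
          |∫ z, ψ z ∂(σ n r : Measure Phase) - ∫ z, ψ z ∂(transport V μ r : Measure Phase)| := by
    intro φ ψ c hcκ hφ hψ hd hi he t ht
    have hj1 := intervalIntegrable_of_continuousOn (continuousOn_integral hσ hψ) le_rfl ht.1 ht.2
    have hj2 := (continuous_integral_transport V μ hψ).intervalIntegrable (μ := volume) 0 t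
    have k1 := he t ht
    have k2 := integral_transport_sub V μ hφ 0 t
    rw [transport_zero] at k2
    simp only [hd, integral_const_mul, intervalIntegral.integral_const_mul] at k1 k2
    have k3 := intervalIntegral.abs_integral_le_integral_abs ht.1 (μ := volume)
      (f := fun r => ∫ z, ψ z ∂(σ n r : Measure Phase)
        - ∫ z, ψ z ∂(transport V μ r : Measure Phase))
    rw [intervalIntegral.integral_sub hj1 hj2] at k3
    have k4 := mul_le_mul_of_nonneg_left k3 (abs_nonneg κ)
    rw [← hcκ, ← abs_mul, hcκ] at k4
    have e : ∫ z, φ z ∂(σ n t : Measure Phase) - ∫ z, φ z ∂(transport V μ t : Measure Phase)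
        = (∫ z, φ z ∂(σ n t : Measure Phase) - ∫ z, φ z ∂(σ n 0 : Measure Phase)
          - c * ∫ r in 0..t, ∫ z, ψ z ∂(σ n r : Measure Phase))
        + (∫ z, φ z ∂(σ n 0 : Measure Phase) - ∫ z, φ z ∂(μ : Measure Phase))
        + c * ((∫ r in 0..t, ∫ z, ψ z ∂(σ n r : Measure Phase))
          - ∫ r in 0..t, ∫ z, ψ z ∂(transport V μ r : Measure Phase)) := by
      linarith
    rw [e]
    refine (abs_add_three _ _ _).trans ?_
    linarith
  have s₁ := step φ₁ φ₂ (-κ) (abs_neg κ) hφ₁ hc₂ h₁ i₁ e₁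
  have s₂ := step φ₂ φ₁ κ rfl hφ₂ hc₁ h₂ i₂ e₂
  have key := le_mul_exp_of_le_integral (h := fun t => |A₁ t| + |A₂ t|) (ε := 4 * δ) (K := |κ|)
    (hA₁c.abs.add hA₂c.abs) h.time_nonneg (abs_nonneg κ) (fun t ht => by
      rw [intervalIntegral.integral_add
        (intervalIntegrable_of_continuousOn hA₁c.abs le_rfl ht.1 ht.2)
        (intervalIntegrable_of_continuousOn hA₂c.abs le_rfl ht.1 ht.2)]
      have := s₁ t ht
      have := s₂ t ht
      simp only [hA₁, hA₂] at *
      linarith) ht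
  refine key.trans ?_
  have hexp : Real.exp (|κ| * t) ≤ Real.exp (|κ| * T) :=
    Real.exp_le_exp.2 (mul_le_mul_of_nonneg_left ht.2 (abs_nonneg κ))
  calc 4 * δ * Real.exp (|κ| * t) ≤ 4 * δ * Real.exp (|κ| * T) :=
        mul_le_mul_of_nonneg_left hexp (by positivity)
    _ = ε := by rw [hδ]; field_simp

end IsRateBounded

end KacFC

namespace KacFC

/-! ### Fourier modes carried by a single velocity -/

section SliceIntegral

/-- The integral of a function on the torus against the part of a measure on the phase space that
moves with a given velocity. -/
noncomputable def sliceIntegral (μ : ProbabilityMeasure Phase) (b : Bool) (g : C(Torus, ℂ)) : ℂ :=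
  ∫ z, (if z.2 = b then g z.1 else 0) ∂(μ : Measure Phase)

theorem continuous_ite_snd {E : Type*} [TopologicalSpace E] [Zero E] (b : Bool) {g : Torus → E}
    (hg : Continuous g) : Continuous fun z : Phase => if z.2 = b then g z.1 else 0 := by
  refine continuous_prod_of_discrete_right.2 fun c => ?_
  by_cases h : c = b
  · simpa [h] using hg
  · simpa [h] using continuous_const

theorem integrable_slice (μ : ProbabilityMeasure Phase) (b : Bool) (g : C(Torus, ℂ)) :
    Integrable (fun z : Phase => if z.2 = b then g z.1 else 0) (μ : Measure Phase) :=
  (BoundedContinuousFunction.mkOfCompact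
    (⟨_, continuous_ite_snd b g.continuous⟩ : C(Phase, ℂ))).integrable _

theorem sliceIntegral_add (μ : ProbabilityMeasure Phase) (b : Bool) (g₁ g₂ : C(Torus, ℂ)) :
    sliceIntegral μ b (g₁ + g₂) = sliceIntegral μ b g₁ + sliceIntegral μ b g₂ := by
  unfold sliceIntegral
  rw [← integral_add (integrable_slice μ b g₁) (integrable_slice μ b g₂)]
  refine integral_congr_ae (.of_forall fun z => ?_)
  by_cases h : z.2 = b <;> simp [h]

theorem sliceIntegral_smul (μ : ProbabilityMeasure Phase) (b : Bool) (c : ℂ) (g : C(Torus, ℂ)) :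
    sliceIntegral μ b (c • g) = c * sliceIntegral μ b g := by
  unfold sliceIntegral
  rw [← integral_const_mul]
  refine integral_congr_ae (.of_forall fun z => ?_)
  by_cases h : z.2 = b <;> simp [h]

theorem norm_sliceIntegral_le (μ : ProbabilityMeasure Phase) (b : Bool) (g : C(Torus, ℂ)) :
    ‖sliceIntegral μ b g‖ ≤ ‖g‖ := by
  have := norm_integral_le_of_norm_le_const (μ := (μ : Measure Phase)) (C := ‖g‖)
    (f := fun z : Phase => if z.2 = b then g z.1 else 0) (.of_forall fun z => by
      by_cases h : z.2 = b
      · simpa [h] using g.norm_coe_le_norm z.1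
      · simp [h])
  simpa [sliceIntegral] using this

theorem sliceIntegral_re (μ : ProbabilityMeasure Phase) (b : Bool) (g : C(Torus, ℂ)) :
    (sliceIntegral μ b g).re = ∫ z, (if z.2 = b then (g z.1).re else 0) ∂(μ : Measure Phase) := by
  have := Complex.reCLM.integral_comp_comm (integrable_slice μ b g)
  simp only [Complex.reCLM_apply, apply_ite Complex.re, Complex.zero_re] at this
  exact this.symm

theorem sliceIntegral_im (μ : ProbabilityMeasure Phase) (b : Bool) (g : C(Torus, ℂ)) :
    (sliceIntegral μ b g).im = ∫ z, (if z.2 = b then (g z.1).im else 0) ∂(μ : Measure Phase) := by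
  have := Complex.imCLM.integral_comp_comm (integrable_slice μ b g)
  simp only [Complex.imCLM_apply, apply_ite Complex.im, Complex.zero_im] at this
  exact this.symm

theorem hasDerivAt_fourier_add (m : ℤ) (x : Torus) :
    HasDerivAt (fun r : ℝ => (fourier m (x + (r : Torus)) : ℂ))
      (((2 * Real.pi * m : ℝ) : ℂ) * Complex.I * fourier m x) 0 := by
  obtain ⟨s, rfl⟩ := QuotientAddGroup.mk_surjective x
  have h1 : HasDerivAt (fun y : ℝ => (fourier m (y : Torus) : ℂ))
      (2 * Real.pi * Complex.I * m / (1 : ℝ) * fourier m (s : Torus)) (s + 0) := by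
    rw [add_zero]
    exact hasDerivAt_fourier 1 m s
  have h2 := h1.comp_const_add s 0
  refine (h2.congr_deriv ?_)
  push_cast
  ring

/-- Differentiation exchanges the real and imaginary parts of a Fourier mode up to a factor. At
fixed velocity transport therefore rotates them into each other, as the Gronwall argument requires.
-/
theorem isC1_fourier_re (m : ℤ) : IsC1 (fun x : Torus => (fourier m x : ℂ).re) ∧
    dx (fun x : Torus => (fourier m x : ℂ).re)
      = fun x => -(2 * Real.pi * m) * (fourier m x : ℂ).im := by
  refine isC1_of_hasDerivAt (fun x => ?_)
    (continuous_const.mul (Complex.continuous_im.comp (fourier m).continuous))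
  refine (Complex.reCLM.hasFDerivAt.comp_hasDerivAt 0 (hasDerivAt_fourier_add m x)).congr_deriv ?_
  simp

theorem isC1_fourier_im (m : ℤ) : IsC1 (fun x : Torus => (fourier m x : ℂ).im) ∧
    dx (fun x : Torus => (fourier m x : ℂ).im)
      = fun x => (2 * Real.pi * m) * (fourier m x : ℂ).re := by
  refine isC1_of_hasDerivAt (fun x => ?_)
    (continuous_const.mul (Complex.continuous_re.comp (fourier m).continuous))
  refine (Complex.imCLM.hasFDerivAt.comp_hasDerivAt 0 (hasDerivAt_fourier_add m x)).congr_deriv ?_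
  simp

theorem isC1_ite (b : Bool) {ψ : Torus → ℝ} (hψ : IsC1 ψ) (c : Bool) :
    IsC1 fun x => if c = b then ψ x else 0 := by
  by_cases h : c = b
  · simpa [h] using hψ
  · simpa [h, IsC1] using contDiff_const

theorem velDeriv_ite (V : ℝ) (b : Bool) (ψ : Torus → ℝ) (z : Phase) :
    velDeriv V (fun z => if z.2 = b then ψ z.1 else 0) z
      = vel V b * if z.2 = b then dx ψ z.1 else 0 := by
  obtain ⟨x, c⟩ := z
  unfold velDeriv
  by_cases h : c = b
  · simp [h]
  · simp [h, dx]

end SliceIntegral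

namespace IsRateBounded

variable {V T R : ℝ} {lam : ℕ → ℝ} {σ : ℕ → ℝ → ProbabilityMeasure Phase}
  {j₁ j₂ : ℕ → ℝ → SignedMeasure Phase}

/-- Uniform convergence holds for Fourier modes and passes to linear combinations. Slice integrals
are contractive in the supremum norm, uniformly in n and t, so density of trigonometric polynomials
gives all continuous functions. -/
theorem eventually_norm_sliceIntegral_sub_le (h : IsRateBounded V T R lam σ j₁ j₂)
    {μ : ProbabilityMeasure Phase} (hμ : Tendsto (fun n => σ n 0) atTop (𝓝 μ)) (b : Bool)
    (g : C(Torus, ℂ)) {ε : ℝ} (hε : 0 < ε) :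
    ∀ᶠ n in atTop, ∀ t ∈ Icc 0 T,
      ‖sliceIntegral (σ n t) b g - sliceIntegral (transport V μ t) b g‖ ≤ ε := by
  have hspan : ∀ g ∈ Submodule.span ℂ (range (@fourier (1 : ℝ))), ∀ ε : ℝ, 0 < ε →
      ∀ᶠ n in atTop, ∀ t ∈ Icc 0 T,
        ‖sliceIntegral (σ n t) b g - sliceIntegral (transport V μ t) b g‖ ≤ ε := by
    intro g hg
    induction hg using Submodule.span_induction with
    | mem g hg =>
      obtain ⟨m, rfl⟩ := hg
      intro ε hε
      filter_upwards [h.eventually_abs_sub_transport_le_of_rotation hμ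
        (φ₁ := fun z => if z.2 = b then (fourier m z.1 : ℂ).re else 0)
        (φ₂ := fun z => if z.2 = b then (fourier m z.1 : ℂ).im else 0)
        (κ := vel V b * (2 * Real.pi * m))
        (fun c => isC1_ite b (isC1_fourier_re m).1 c) (fun c => isC1_ite b (isC1_fourier_im m).1 c)
        (fun z => by
          rw [velDeriv_ite V b (fun x : Torus => (fourier m x : ℂ).re), (isC1_fourier_re m).2]
          by_cases hz : z.2 = b <;> simp [hz]
          ring)
        (fun z => by
          rw [velDeriv_ite V b (fun x : Torus => (fourier m x : ℂ).im), (isC1_fourier_im m).2]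
          by_cases hz : z.2 = b <;> simp [hz]
          ring) hε] with n hn t ht
      refine (Complex.norm_le_abs_re_add_abs_im _).trans ?_
      rw [Complex.sub_re, Complex.sub_im, sliceIntegral_re, sliceIntegral_re, sliceIntegral_im,
        sliceIntegral_im]
      exact hn t ht
    | zero =>
      intro ε hε
      refine .of_forall fun n t _ => ?_
      simpa [sliceIntegral] using hε.le
    | add g₁ g₂ _ _ h₁ h₂ =>
      intro ε hε
      filter_upwards [h₁ (ε / 2) (half_pos hε), h₂ (ε / 2) (half_pos hε)] with n e₁ e₂ t ht
      rw [sliceIntegral_add, sliceIntegral_add, add_sub_add_comm]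
      exact (norm_add_le _ _).trans (by linarith [e₁ t ht, e₂ t ht])
    | smul c g _ hg =>
      intro ε hε
      have hc : 0 < ‖c‖ + 1 := by positivity
      filter_upwards [hg (ε / (‖c‖ + 1)) (by positivity)] with n hn t ht
      rw [sliceIntegral_smul, sliceIntegral_smul, ← mul_sub, norm_mul]
      calc _ ≤ (‖c‖ + 1) * (ε / (‖c‖ + 1)) := mul_le_mul (by linarith) (hn t ht)
            (norm_nonneg _) hc.le
        _ = ε := mul_div_cancel₀ _ hc.ne'
  have hg : g ∈ (Submodule.span ℂ (range (@fourier (1 : ℝ)))).topologicalClosure := by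
    rw [span_fourier_closure_eq_top]; trivial
  obtain ⟨g', hg', hd⟩ := Metric.mem_closure_iff.1 hg (ε / 4) (by positivity)
  rw [dist_eq_norm] at hd
  filter_upwards [hspan g' hg' (ε / 2) (half_pos hε)] with n hn t ht
  have e : ∀ ν : ProbabilityMeasure Phase,
      sliceIntegral ν b g = sliceIntegral ν b g' + sliceIntegral ν b (g - g') := fun ν => by
    rw [← sliceIntegral_add, add_sub_cancel]
  rw [e, e, add_sub_add_comm]
  refine (norm_add_le _ _).trans ?_
  have h1 := norm_sub_le (sliceIntegral (σ n t) b (g - g'))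
    (sliceIntegral (transport V μ t) b (g - g'))
  have h2 := norm_sliceIntegral_le (σ n t) b (g - g')
  have h3 := norm_sliceIntegral_le (transport V μ t) b (g - g')
  linarith [hn t ht]

/-- Along a sequence with convergent initial data the curves converge to free transport,
uniformly in time. -/
theorem eventually_abs_integral_sub_transport_le (h : IsRateBounded V T R lam σ j₁ j₂)
    {μ : ProbabilityMeasure Phase} (hμ : Tendsto (fun n => σ n 0) atTop (𝓝 μ)) {φ : Phase → ℝ}
    (hφ : Continuous φ) {ε : ℝ} (hε : 0 < ε) :
    ∀ᶠ n in atTop, ∀ t ∈ Icc 0 T,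
      |∫ z, φ z ∂(σ n t : Measure Phase) - ∫ z, φ z ∂(transport V μ t : Measure Phase)| ≤ ε := by
  let g : Bool → C(Torus, ℂ) := fun b =>
    ⟨fun x => (φ (x, b) : ℂ), Complex.continuous_ofReal.comp (continuous_phase_iff.1 hφ b)⟩
  have e : ∀ ν : ProbabilityMeasure Phase, ∫ z, φ z ∂(ν : Measure Phase)
      = (sliceIntegral ν true (g true) + sliceIntegral ν false (g false)).re := fun ν => by
    have hi : ∀ b, Integrable (fun z : Phase => if z.2 = b then (g b z.1).re else 0)
        (ν : Measure Phase) := fun b =>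
      integrable_of_continuous (continuous_ite_snd b
        (Complex.continuous_re.comp (g b).continuous)) _
    rw [Complex.add_re, sliceIntegral_re, sliceIntegral_re, ← integral_add (hi true) (hi false)]
    refine integral_congr_ae (.of_forall ?_)
    rintro ⟨x, b⟩
    cases b <;> simp [g]
  filter_upwards [h.eventually_norm_sliceIntegral_sub_le hμ true (g true) (half_pos hε),
    h.eventually_norm_sliceIntegral_sub_le hμ false (g false) (half_pos hε)] with n h₁ h₂ t ht
  rw [e, e, ← Complex.sub_re, add_sub_add_comm]
  exact (Complex.abs_re_le_norm _).trans ((norm_add_le _ _).trans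
    (by linarith [h₁ t ht, h₂ t ht]))

/-- The momentum flux of the jumps vanishes in the limit: a bounded rate functional bounds the jump
flux by `(R + T λ e^{MB}) / M` for every `M`, and `λ → 0`. -/
theorem narrowTendsto_moment_flux (hV : 0 ≤ V) (h : IsRateBounded V T R lam σ j₁ j₂) :
    NarrowTendsto (fun n => spaceTime T fun t => moment V (j₂ n t)) 0 := by
  intro f
  rw [pair_zero_right, Metric.tendsto_nhds]
  intro ε hε
  obtain ⟨M, hM, hn⟩ := h.exists_eventually_le (V * ‖f‖) (half_pos hε)
  filter_upwards [hn] with n hn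
  rw [Real.dist_eq, sub_zero]
  -- If the family is not admissible, `spaceTime` is zero by its default and there is nothing to
  -- prove.
  by_cases hflux : IsFluxFamily T fun t => moment V (j₂ n t)
  swap
  · rw [spaceTime, dif_neg hflux, pair_zero_right, abs_zero]
    exact hε
  have hfc : ∀ p, |f p| ≤ ‖f‖ := f.norm_coe_le_norm
  rw [(pair_spaceTime hflux f.continuous.measurable hfc).2]
  have hpt : ∀ t : Ioo (0 : ℝ) T, ENNReal.ofReal M * ‖pair (fun x => f (t, x)) (moment V (j₂ n t))‖ₑ
      ≤ lagrangian V (lam n) (σ n t) (j₁ n t) (j₂ n t)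
        + ENNReal.ofReal (lam n * Real.exp (M * (V * ‖f‖))) := fun t => by
    have hft : Continuous fun x => f (t, x) :=
      f.continuous.comp (continuous_const.prodMk continuous_id)
    let χ : C(Phase, ℝ) := ⟨fun z => vel V z.2 * f (t, z.1),
      (continuous_vel V).mul (hft.comp continuous_fst)⟩
    -- Testing is done separately at each time, so `f` may depend on time; the bound `V * ‖f‖` on
    -- the test function does not, and one M serves all times.
    have h1 := ofReal_mul_abs_flux_le (V := V) (h.lam_pos n) (σ n t) (j₁ n t) (j₂ n t) 0 χ hM
      (B := V * ‖f‖) fun z => by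
        change |vel V z.2 * f (t, z.1)| ≤ _
        rw [abs_mul, abs_vel hV]
        exact mul_le_mul_of_nonneg_left (hfc _) hV
    have h2 : pair (⇑(0 : C(Phase, ℝ))) (j₁ n t) = 0 := pair_zero_left _
    rw [pair_moment hV _ hft.measurable fun x => hfc _, ← ofReal_norm, ← ENNReal.ofReal_mul hM.le,
      Real.norm_eq_abs]
    simp only [h2, ContinuousMap.zero_apply, mul_zero, integral_zero, sub_zero, zero_add] at h1
    exact h1
  have h2 : 0 ≤ lam n * Real.exp (M * (V * ‖f‖)) := mul_nonneg (h.lam_pos n).le (Real.exp_pos _).le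
  have hint : ENNReal.ofReal M * ‖∫ t : Ioo (0 : ℝ) T, pair (fun x => f (t, x))
      (moment V (j₂ n t)) ∂(leb T)‖ₑ ≤ ENNReal.ofReal M * ENNReal.ofReal (ε / 2) := by
    calc _ ≤ ENNReal.ofReal M * ∫⁻ t : Ioo (0 : ℝ) T,
          ‖pair (fun x => f (t, x)) (moment V (j₂ n t))‖ₑ ∂(leb T) :=
          mul_le_mul_right (enorm_integral_le_lintegral_enorm _) _
      _ = ∫⁻ t : Ioo (0 : ℝ) T, ENNReal.ofReal M
          * ‖pair (fun x => f (t, x)) (moment V (j₂ n t))‖ₑ ∂(leb T) :=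
          (lintegral_const_mul' _ _ ENNReal.ofReal_ne_top).symm
      _ ≤ ∫⁻ t : Ioo (0 : ℝ) T, (lagrangian V (lam n) (σ n t) (j₁ n t) (j₂ n t)
          + ENNReal.ofReal (lam n * Real.exp (M * (V * ‖f‖)))) ∂(leb T) := lintegral_mono hpt
      _ = ∫⁻ t in Ioo 0 T, (lagrangian V (lam n) (σ n t) (j₁ n t) (j₂ n t)
          + ENNReal.ofReal (lam n * Real.exp (M * (V * ‖f‖)))) :=
          lintegral_leb T fun t => lagrangian V (lam n) (σ n t) (j₁ n t) (j₂ n t)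
            + ENNReal.ofReal (lam n * Real.exp (M * (V * ‖f‖)))
      _ = (∫⁻ t in Ioo 0 T, lagrangian V (lam n) (σ n t) (j₁ n t) (j₂ n t))
          + ENNReal.ofReal (lam n * Real.exp (M * (V * ‖f‖))) * ENNReal.ofReal T := by
          rw [lintegral_add_right _ measurable_const, lintegral_const,
            Measure.restrict_apply_univ, Real.volume_Ioo, sub_zero]
      _ ≤ ENNReal.ofReal R
          + ENNReal.ofReal (lam n * Real.exp (M * (V * ‖f‖))) * ENNReal.ofReal T :=
          add_le_add_left (h.rate_le n) _
      _ = ENNReal.ofReal (R + T * (lam n * Real.exp (M * (V * ‖f‖)))) := by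
          rw [← ENNReal.ofReal_mul h2, ← ENNReal.ofReal_add h.bound_nonneg
            (mul_nonneg h2 h.time_nonneg), mul_comm T]
      _ ≤ ENNReal.ofReal (M * (ε / 2)) := ENNReal.ofReal_le_ofReal hn
      _ = _ := ENNReal.ofReal_mul hM.le
  have h3 := (ENNReal.mul_le_mul_iff_right (by simpa using hM) ENNReal.ofReal_ne_top).1 hint
  rw [← ofReal_norm, ENNReal.ofReal_le_ofReal_iff (half_pos hε).le, Real.norm_eq_abs] at h3
  linarith

end IsRateBounded

/-! ### The limit curve and its momentum equation -/

section LimitCurve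

theorem pair_density (μ : ProbabilityMeasure Phase) {f : Torus → ℝ} (hf : Measurable f) :
    pair f (toSigned (density μ)) = ∫ z, f z.1 ∂(μ : Measure Phase) := by
  rw [pair_toSignedMeasure]
  exact integral_map measurable_fst.aemeasurable hf.aestronglyMeasurable

theorem pair_momentum {V : ℝ} (hV : 0 ≤ V) (μ : ProbabilityMeasure Phase) {f : Torus → ℝ}
    (hf : Continuous f) :
    pair f (moment V (toSigned μ)) = ∫ z, vel V z.2 * f z.1 ∂(μ : Measure Phase) := by
  obtain ⟨c, hc⟩ := exists_abs_le_of_continuous hf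
  rw [pair_moment hV _ hf.measurable hc, pair_toSignedMeasure]

theorem continuous_vel_mul (V : ℝ) {f : Torus → ℝ} (hf : Continuous f) :
    Continuous fun z : Phase => vel V z.2 * f z.1 :=
  (continuous_vel V).mul (hf.comp continuous_fst)

theorem continuous_density_transport (V : ℝ) (μ : ProbabilityMeasure Phase) :
    Continuous fun t => density (transport V μ t) :=
  (ProbabilityMeasure.continuous_map continuous_fst).comp (continuous_transport V μ)

theorem narrowContinuous_momentum_transport {V : ℝ} (hV : 0 ≤ V) (μ : ProbabilityMeasure Phase)
    (T : ℝ) : NarrowContinuous T fun t => moment V (toSigned (transport V μ t)) := fun f => by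
  simp only [pair_momentum hV _ f.continuous]
  exact (continuous_integral_transport V μ (continuous_vel_mul V f.continuous)).continuousOn

theorem norm_coe_torus_le (a : ℝ) : ‖(a : Torus)‖ ≤ |a| := by
  exact QuotientAddGroup.norm_mk_le_norm (S := AddSubgroup.zmultiples (1 : ℝ)) (m := a)

/-- The curve is Lipschitz with constant V²: one factor V is the momentum weight, the other the
speed at which the argument of a 1-Lipschitz function moves. -/
theorem isACBL_momentum_transport {V : ℝ} (hV : 0 ≤ V) (μ : ProbabilityMeasure Phase) (T : ℝ) :
    IsACBL T fun t => moment V (toSigned (transport V μ t)) := by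
  refine ⟨fun _ => V ^ 2, integrableOn_const (by simp), fun s t _ hst _ => ?_⟩
  refine iSup₂_le fun f hf => ENNReal.ofReal_le_ofReal ?_
  have hfc : Continuous f := hf.2.continuous
  have hg := continuous_vel_mul V hfc
  rw [pair_momentum hV _ hfc, pair_momentum hV _ hfc, integral_transport V μ s hg.measurable,
    integral_transport V μ t hg.measurable]
  have hi : ∀ r, Integrable (fun z => vel V (flow V r z).2 * f (flow V r z).1)
      (μ : Measure Phase) := fun r =>
    integrable_of_continuous (hg.comp (continuous_flow V r)) _
  rw [← integral_sub (hi s) (hi t)]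
  have hb := norm_integral_le_of_norm_le_const (μ := (μ : Measure Phase)) (C := V ^ 2 * (t - s))
    (f := fun z => vel V (flow V s z).2 * f (flow V s z).1
      - vel V (flow V t z).2 * f (flow V t z).1) (.of_forall fun z => by
      change ‖vel V z.2 * f (flow V s z).1 - vel V z.2 * f (flow V t z).1‖ ≤ _
      rw [← mul_sub, norm_mul, Real.norm_eq_abs, abs_vel hV, ← dist_eq_norm]
      have h1 : dist (f (flow V s z).1) (f (flow V t z).1)
          ≤ dist (flow V s z).1 (flow V t z).1 := by
        simpa using hf.2.dist_le_mul (flow V s z).1 (flow V t z).1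
      have h2 : dist (flow V s z).1 (flow V t z).1 ≤ V * (t - s) := by
        unfold flow
        simp only
        rw [dist_add_left, dist_eq_norm, ← AddCircle.coe_sub, ← mul_sub]
        refine (norm_coe_torus_le _).trans_eq ?_
        rw [abs_mul, abs_vel hV, abs_sub_comm, abs_of_nonneg (sub_nonneg.2 hst)]
      calc V * dist (f (flow V s z).1) (f (flow V t z).1) ≤ V * (V * (t - s)) :=
            mul_le_mul_of_nonneg_left (h1.trans h2) hV
        _ = _ := by ring)
  rw [intervalIntegral.integral_const, smul_eq_mul, mul_comm (t - s)]
  simpa using hb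

theorem isC1_vel_mul (V : ℝ) {ψ : Torus → ℝ} (hψ : IsC1 ψ) (b : Bool) :
    IsC1 fun x => vel V b * ψ x := contDiff_const.mul hψ

/-- Both velocities have the same square, so the momentum equation closes on the density and
contains no second velocity moment. -/
theorem velDeriv_vel_mul {V : ℝ} {ψ : Torus → ℝ} (hψ : IsC1 ψ) (z : Phase) :
    velDeriv V (fun z => vel V z.2 * ψ z.1) z = V ^ 2 * dx ψ z.1 := by
  have h1 : dx (fun x => vel V z.2 * ψ x) z.1 = vel V z.2 * dx ψ z.1 :=
    ((hasDerivAt_zero_of_isC1 hψ z.1).const_mul (vel V z.2)).deriv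
  have h2 : vel V z.2 * vel V z.2 = V ^ 2 := by
    unfold vel; split_ifs <;> ring
  unfold velDeriv
  rw [h1, ← mul_assoc, h2]

theorem integral_velDeriv_vel_mul (V : ℝ) (μ : ProbabilityMeasure Phase) {ψ : Torus → ℝ}
    (hψ : IsC1 ψ) :
    ∫ z, velDeriv V (fun z => vel V z.2 * ψ z.1) z ∂(μ : Measure Phase)
      = V ^ 2 * ∫ x, dx ψ x ∂(density μ : Measure Torus) := by
  simp only [velDeriv_vel_mul hψ, integral_const_mul]
  congr 1
  exact (integral_map measurable_fst.aemeasurable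
    (continuous_dx hψ).measurable.aestronglyMeasurable).symm

theorem hasDerivAt_pair_momentum_transport {V : ℝ} (hV : 0 ≤ V) (μ : ProbabilityMeasure Phase)
    {ψ : Torus → ℝ} (hψ : IsC1 ψ) (t : ℝ) :
    HasDerivAt (fun r => pair ψ (moment V (toSigned (transport V μ r))))
      (V ^ 2 * ∫ x, dx ψ x ∂(density (transport V μ t) : Measure Torus)) t := by
  simp only [pair_momentum hV _ (continuous_of_isC1 hψ)]
  rw [← integral_velDeriv_vel_mul V _ hψ]
  exact hasDerivAt_integral_transport V μ (fun b => isC1_vel_mul V hψ b) t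

theorem pair_momentum_transport_sub {V : ℝ} (hV : 0 ≤ V) (μ : ProbabilityMeasure Phase)
    {ψ : Torus → ℝ} (hψ : IsC1 ψ) (s t : ℝ) :
    pair ψ (moment V (toSigned (transport V μ t))) - pair ψ (moment V (toSigned (transport V μ s)))
      = ∫ r in s..t, V ^ 2 * ∫ x, dx ψ x ∂(density (transport V μ r) : Measure Torus) := by
  simp only [pair_momentum hV _ (continuous_of_isC1 hψ), ← integral_velDeriv_vel_mul V _ hψ]
  exact integral_transport_sub V μ (φ := fun z => vel V z.2 * ψ z.1)
    (fun b => isC1_vel_mul V hψ b) s t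

end LimitCurve

section Subsequence

theorem exists_subseq_tendsto (μ : ℕ → ProbabilityMeasure Phase) :
    ∃ (ν : ProbabilityMeasure Phase) (k : ℕ → ℕ), StrictMono k ∧
      Tendsto (μ ∘ k) atTop (𝓝 ν) :=
  CompactSpace.tendsto_subseq μ

end Subsequence

end KacFC

theorem proposition4p9 (V T : ℝ) (hV : 0 < V) (hT : 0 < T)
    (lam : ℕ → ℝ) (hlam : ∀ n, 0 < lam n) (hlam0 : Tendsto lam atTop (𝓝 0))
    (σ : ℕ → ℝ → ProbabilityMeasure Phase) (j₁ j₂ : ℕ → ℝ → SignedMeasure Phase)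
    (hCE : ∀ n, IsCE T (σ n) (j₁ n) (j₂ n))
    (C : ℝ≥0)
    (hC : ∀ n, ent (σ n 0 : Measure Phase) stat + rate V (lam n) T (σ n) (j₁ n) (j₂ n) ≤ C)
    (ρ : ℕ → ℝ → ProbabilityMeasure Torus) (hρ : ∀ n t, ρ n t = density (σ n t))
    (ω : ℕ → ℝ → SignedMeasure Torus) (hω : ∀ n t, ω n t = moment V (toSigned (σ n t)))
    (J : ℕ → ℝ → SignedMeasure Torus) (hJ : ∀ n t, J n t = moment V (j₂ n t)) :
    (∀ n, ∀ t ∈ Icc 0 T,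
      2⁻¹ * ent (ρ n t : Measure Torus) volume
          + ENNReal.ofReal (lam n / (2 * V ^ 2))
            * G t (spaceTimeDensity T (ρ n)) (spaceTime T (ω n))
        ≤ 2⁻¹ * ent (σ n t : Measure Phase) stat
          + ENNReal.ofReal (lam n) * (∫⁻ r in Ioo 0 t, fisher (σ n r : Measure Phase)) ∧
      2⁻¹ * ent (σ n t : Measure Phase) stat
          + ENNReal.ofReal (lam n) * (∫⁻ r in Ioo 0 t, fisher (σ n r : Measure Phase))
        ≤ 2⁻¹ * ent (σ n 0 : Measure Phase) stat
          + rate V (lam n) T (σ n) (j₁ n) (j₂ n)) ∧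
    ∃ (k : ℕ → ℕ) (ρ' : ℝ → ProbabilityMeasure Torus) (ω' : ℝ → SignedMeasure Torus)
      (J' : SignedMeasure (Ioo (0 : ℝ) T × Torus)) (J't : ℝ → SignedMeasure Torus),
      StrictMono k ∧
      ContinuousOn ρ' (Icc 0 T) ∧
      UniformNarrowTendsto T (fun n t => toSigned (ρ (k n) t)) (fun t => toSigned (ρ' t)) ∧
      NarrowContinuous T ω' ∧
      UniformNarrowTendsto T (fun n => ω (k n)) ω' ∧
      NarrowTendsto (fun n => spaceTime T (J (k n))) J' ∧
      IsFluxFamily T J't ∧ J' = spaceTime T J't ∧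
      IsACBL T ω' ∧
      (∀ ψ : Torus → ℝ, IsC1 ψ → ∀ s t, 0 ≤ s → s < t → t ≤ T →
        pair ψ (ω' t) - pair ψ (ω' s) =
          ∫ r in s..t, (V ^ 2 * (∫ x, dx ψ x ∂(ρ' r : Measure Torus)) - 2 * pair ψ (J't r))) ∧
      ∀ᵐ t ∂(volume.restrict (Ioo 0 T)), ∀ ψ : Torus → ℝ, IsC1 ψ →
        HasDerivAt (fun r => pair ψ (ω' r))
          (-(V ^ 2) * distribDeriv (ρ' t) ψ - 2 * pair ψ (J't t)) t := by
  obtain rfl : ρ = fun n t => density (σ n t) := funext fun n => funext fun t => hρ n t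
  obtain rfl : ω = fun n t => moment V (toSigned (σ n t)) := funext fun n => funext fun t => hω n t
  obtain rfl : J = fun n t => moment V (j₂ n t) := funext fun n => funext fun t => hJ n t
  have hent : ∀ n, ent (σ n 0 : Measure Phase) stat ≠ ∞ := fun n =>
    ((le_self_add.trans (hC n)).trans_lt ENNReal.coe_lt_top).ne
  have hrate : ∀ n, rate V (lam n) T (σ n) (j₁ n) (j₂ n) ≤ C := fun n => le_add_self.trans (hC n)
  refine ⟨fun n t ht => ⟨ent_density_add_G_le hV (hlam n).le (hCE n).continuousOn t,
    ent_add_fisher_le (hlam n) (hCE n) (hent n)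
      ((hrate n).trans_lt ENNReal.coe_lt_top).ne ht⟩, ?_⟩
  have hbd : IsRateBounded V T C lam σ j₁ j₂ :=
    { time_nonneg := hT.le
      bound_nonneg := C.2
      lam_pos := hlam
      lam_tendsto := hlam0
      ce := hCE
      rate_le := fun n => by
        have h := hrate n
        rw [rate, if_pos (hCE n)] at h
        rwa [ENNReal.ofReal_coe_nnreal] }
  -- Only the initial measures need a subsequence; probability measures on the compact phase space
  -- are compact.
  obtain ⟨μ, k, hk, hμ⟩ := exists_subseq_tendsto fun n => σ n 0
  have hbk := hbd.comp_subseq hk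
  -- The limit is the density and momentum of freely transported initial data, with zero jump flux
  -- and the zero family as its disintegration. The differential equation then holds at every time,
  -- not only almost every time.
  refine ⟨k, fun t => density (transport V μ t), fun t => moment V (toSigned (transport V μ t)),
    0, fun _ => 0, hk, (continuous_density_transport V μ).continuousOn, fun f => ?_,
    narrowContinuous_momentum_transport hV.le μ T, fun f => ?_,
    hbk.narrowTendsto_moment_flux hV.le, isFluxFamily_zero T, (spaceTime_zero T).symm,
    isACBL_momentum_transport hV.le μ T, fun ψ hψ s t _ _ _ => ?_,
    .of_forall fun t ψ hψ => ?_⟩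
  · rw [Metric.tendstoUniformlyOn_iff]
    intro ε hε
    filter_upwards [hbk.eventually_abs_integral_sub_transport_le hμ
      (f.continuous.comp continuous_fst) (half_pos hε)] with n hn t ht
    rw [pair_density _ f.continuous.measurable, pair_density _ f.continuous.measurable, dist_comm,
      Real.dist_eq]
    exact (hn t ht).trans_lt (half_lt_self hε)
  · rw [Metric.tendstoUniformlyOn_iff]
    intro ε hε
    filter_upwards [hbk.eventually_abs_integral_sub_transport_le hμ
      (continuous_vel_mul V f.continuous) (half_pos hε)] with n hn t ht
    rw [pair_momentum hV.le _ f.continuous, pair_momentum hV.le _ f.continuous, dist_comm,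
      Real.dist_eq]
    exact (hn t ht).trans_lt (half_lt_self hε)
  · simpa using pair_momentum_transport_sub hV.le μ hψ s t
  · simpa [distribDeriv] using hasDerivAt_pair_momentum_transport hV.le μ hψ t
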